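/- Setting. Let $G$ be a finite group. Each qudit $i$ has a Hilbert space $\mathcal H_i$ with a unitary representation $R^i$ of $G$ that is regular, i.e. unitarily equivalent to $R^{\mathrm{reg}}_g\otimes\mathbb 1$ on $\mathbb C^{G}\otimes\mathbb C^{d'_i}$ with $R^{\mathrm{reg}}_g|h\rangle=|gh\rangle$ and $d'_i\ge 1$. On a finite set $S$ of qudits, $G$ acts on $\mathcal H_S=\bigotimes_{i\in S}\mathcal H_i$ by $R_g=\bigotimes_{i\in S}R^i_g$; write $D_S=\dim\mathcal H_S$. A symmetric unitary on $S$ is a unitary on $\mathcal H_S$ commuting with all $R_g$, and the symmetric Haar ensemble is the Haar probability measure on the group of symmetric unitaries. For a random symmetric unitary $U\sim\mathcal E$ let $\Phi_{\mathcal E}(X)=\mathbb E\,[U^{\otimes k}X(U^{\otimes k})^\dagger]$, and let $\Phi_H$ be this map for the symmetric Haar ensemble. For maps, $\mathcal A\preceq\mathcal B$ means that $\mathcal B-\mathcal A$ is completely positive. $\mathcal E$ is an $\varepsilon$-approximate symmetric unitary $k$-design if $(1-\varepsilon)\Phi_H\preceq\Phi_{\mathcal E}\preceq(1+\varepsilon)\Phi_H$.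 (1) Gluing. Let $A,B,C$ be pairwise disjoint sets of qudits and $k^2\le D_B/|G|$. If $U_{AB}$ and $U_{BC}$ are drawn independently from an $\varepsilon_{AB}$- and an $\varepsilon_{BC}$-approximate symmetric unitary $k$-design on $A\cup B$ and $B\cup C$, respectively, then $U_{AB}U_{BC}$ is an $\varepsilon$-approximate symmetric unitary $k$-design on $A\cup B\cup C$, where $$1+\varepsilon=(1+\varepsilon_{AB})(1+\varepsilon_{BC})\Big(1-\frac{k^2|G|}{2D_{AB}}\Big)^{-1}\Big(1-\frac{k^2|G|}{2D_{BC}}\Big)^{-1}e^{k(k-1)|G|/2D_B}\Big(1+\frac{k^2|G|}{D_{ABC}}\Big).$$ (2) Two-layer brickwork. Let $n=m\xi$ qudits on a line be divided into $m\ge 2$ consecutive patches of $\xi\ge 1$ qudits. The two-layer brickwork circuit applies independent random symmetric unitaries to pairs of neighbouring patches ($2\xi$ qudits each): first to the 1st and 2nd, the 3rd and 4th, $\dots$ patches, then to the 2nd and 3rd, the 4th and 5th, $\dots$ patches. Let $0<\varepsilon\le1$, let $b>1$ be a real number with $b\le\dim\mathcal H_i$ for every $i$ (for example $b=2$, or $b=|G|$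 if $G$ is non-trivial), and suppose that $\xi\ge\log_b(nk^2|G|/\varepsilon)$. (a) If every small unitary is drawn from the symmetric Haar ensemble on its $2\xi$ qudits, then the circuit is an $\varepsilon$-approximate symmetric unitary $k$-design on the $n$ qudits. (b) If every small unitary is drawn from some $\frac{\varepsilon}{n}$-approximate symmetric unitary $k$-design on its $2\xi$ qudits, then the circuit is an $\varepsilon$-approximate symmetric unitary $k$-design on the $n$ qudits, where, in the case that $b>2$ and $m\ge3$, it is assumed in addition that $\xi\ge3$, or that $\xi=2$ and $\varepsilon\le\frac12$. Moreover, for any set of elementary gates, if the small unitaries almost surely have circuit depth $d$ (a product of $d$ layers of gates with disjoint supports), then the whole circuit almost surely has circuit depth $2d$. -/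

import Mathlib

open MeasureTheory Matrix
open scoped ComplexOrder

noncomputable section

namespace SymDesign

universe u v w

/-! ### Symmetric unitaries and their Haar measure -/

section Symmetric

variable {G : Type u} {X : Type v} [Fintype X] [DecidableEq X]

/-- The group of unitaries on `ℂ^X` that commute with every operator `ρ g`. -/
def symUnitary (ρ : G → Matrix X X ℂ) : Subgroup (unitaryGroup X ℂ) where
  carrier := {U | ∀ g, (U : Matrix X X ℂ) * ρ g = ρ g * (U : Matrix X X ℂ)}
  one_mem' := fun g => by simp
  mul_mem' := fun {U V} hU hV g => by
    simp only [UnitaryGroup.mul_val]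
    rw [Matrix.mul_assoc, hV g, ← Matrix.mul_assoc, hU g, Matrix.mul_assoc]
  inv_mem' := fun {U} hU g => by
    have h1 : ((U⁻¹ : unitaryGroup X ℂ) : Matrix X X ℂ) * (U : Matrix X X ℂ) = 1 := by
      rw [← UnitaryGroup.mul_val]; simp
    have h2 : (U : Matrix X X ℂ) * ((U⁻¹ : unitaryGroup X ℂ) : Matrix X X ℂ) = 1 := by
      rw [← UnitaryGroup.mul_val]; simp
    calc ((U⁻¹ : unitaryGroup X ℂ) : Matrix X X ℂ) * ρ g
        = (U⁻¹ : unitaryGroup X ℂ).val * ρ g * (U.val * (U⁻¹ : unitaryGroup X ℂ).val) := by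
          rw [h2, Matrix.mul_one]
      _ = (U⁻¹ : unitaryGroup X ℂ).val * (ρ g * U.val) * (U⁻¹ : unitaryGroup X ℂ).val := by
          simp only [Matrix.mul_assoc]
      _ = (U⁻¹ : unitaryGroup X ℂ).val * (U.val * ρ g) * (U⁻¹ : unitaryGroup X ℂ).val := by
          rw [hU g]
      _ = ((U⁻¹ : unitaryGroup X ℂ).val * U.val) * ρ g * (U⁻¹ : unitaryGroup X ℂ).val := by
          simp only [Matrix.mul_assoc]
      _ = ρ g * (U⁻¹ : unitaryGroup X ℂ).val := by rw [h1, Matrix.one_mul]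

theorem isCompact_unitaryGroup :
    IsCompact ((unitaryGroup X ℂ : Submonoid (Matrix X X ℂ)) : Set (Matrix X X ℂ)) := by
  have hbox : IsCompact {M : Matrix X X ℂ | ∀ i j, M i j ∈ Metric.closedBall (0 : ℂ) 1} := by
    have := isCompact_univ_pi (X := fun _ : X => X → ℂ) (s := fun _ : X =>
      Set.univ.pi fun _ : X => Metric.closedBall (0 : ℂ) 1)
      (fun _ => isCompact_univ_pi fun _ => isCompact_closedBall (0 : ℂ) 1)
    have e : {M : Matrix X X ℂ | ∀ i j, M i j ∈ Metric.closedBall (0 : ℂ) 1} =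
        (Set.univ.pi fun _ : X => Set.univ.pi fun _ : X => Metric.closedBall (0 : ℂ) 1) := by
      exact Set.ext fun M => ⟨fun h i _ j _ => h i j, fun h i j => h i trivial j trivial⟩
    rw [e]
    exact this
  refine hbox.of_isClosed_subset ?_ ?_
  · have : ((unitaryGroup X ℂ : Submonoid (Matrix X X ℂ)) : Set (Matrix X X ℂ))
        = {M : Matrix X X ℂ | M * star M = 1} := by
      ext M; exact mem_unitaryGroup_iff
    rw [this]
    exact isClosed_eq (continuous_id.mul continuous_star) continuous_const
  · intro M hM i j
    simpa using entry_norm_bound_of_unitary hM i j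

instance instCompactSpaceSymUnitary (ρ : G → Matrix X X ℂ) : CompactSpace (symUnitary ρ) := by
  have : CompactSpace (unitaryGroup X ℂ) := isCompact_iff_compactSpace.mp isCompact_unitaryGroup
  refine isCompact_iff_compactSpace.mp (IsClosed.isCompact ?_)
  have : ((symUnitary ρ : Subgroup (unitaryGroup X ℂ)) : Set (unitaryGroup X ℂ))
      = ⋂ g, {U : unitaryGroup X ℂ | (U : Matrix X X ℂ) * ρ g = ρ g * (U : Matrix X X ℂ)} := by
    ext U; simp [symUnitary]
  rw [this]
  exact isClosed_iInter fun g => isClosed_eq (continuous_subtype_val.mul continuous_const)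
    (continuous_const.mul continuous_subtype_val)

instance instMeasurableSpaceSymUnitary (ρ : G → Matrix X X ℂ) :
    MeasurableSpace (symUnitary ρ) := borel _

instance instBorelSpaceSymUnitary (ρ : G → Matrix X X ℂ) : BorelSpace (symUnitary ρ) := ⟨rfl⟩

/-- The Haar probability measure on the compact group of symmetric unitaries. -/
def symHaar (ρ : G → Matrix X X ℂ) : Measure (symUnitary ρ) :=
  Measure.haarMeasure (⊤ : TopologicalSpace.PositiveCompacts (symUnitary ρ))

instance instIsProbabilityMeasureSymHaar (ρ : G → Matrix X X ℂ) :
    IsProbabilityMeasure (symHaar ρ) :=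
  ⟨Measure.haarMeasure_self (K₀ := (⊤ : TopologicalSpace.PositiveCompacts (symUnitary ρ)))⟩

/-- The inclusion of the symmetric unitaries into all matrices. -/
def symVal (ρ : G → Matrix X X ℂ) (U : symUnitary ρ) : Matrix X X ℂ :=
  ((U : unitaryGroup X ℂ) : Matrix X X ℂ)

end Symmetric

/-! ### Twirls, complete positivity, approximate symmetric designs -/

section Designs

variable {X : Type v} [Fintype X]

/-- `M^{⊗ k}` as a matrix on `(ℂ^X)^{⊗ k}`. -/
def tensorPow (k : ℕ) (M : Matrix X X ℂ) : Matrix (Fin k → X) (Fin k → X) ℂ :=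
  fun x y => ∏ i, M (x i) (y i)

/-- The `k`-fold twirl `A ↦ 𝔼[U^{⊗ k} A (U^{⊗ k})†]` of a random matrix `U` (the expectation is
taken entry by entry). -/
def twirl {Ω : Type w} [MeasurableSpace Ω] (P : Measure Ω) (U : Ω → Matrix X X ℂ) (k : ℕ)
    (A : Matrix (Fin k → X) (Fin k → X) ℂ) : Matrix (Fin k → X) (Fin k → X) ℂ :=
  fun x y => ∫ ω, (tensorPow k (U ω) * A * (tensorPow k (U ω))ᴴ) x y ∂P

/-- Completely positive maps: `Φ` is linear, and `Φ ⊗ id` on `Matrix Y ⊗ Matrix (Fin r)` maps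
positive semidefinite matrices to positive semidefinite ones, for every `r`. -/
def IsCompletelyPositive {Y : Type v} [Fintype Y] (Φ : Matrix Y Y ℂ → Matrix Y Y ℂ) : Prop :=
  IsLinearMap ℂ Φ ∧ ∀ (r : ℕ) (M : Matrix (Y × Fin r) (Y × Fin r) ℂ), M.PosSemidef →
    (Matrix.of fun a b : Y × Fin r =>
      Φ (Matrix.of fun x y => M (x, a.2) (y, b.2)) a.1 b.1).PosSemidef

/-- `𝒜 ≼ ℬ`: the difference `ℬ - 𝒜` is completely positive. -/
def CPLE {Y : Type v} [Fintype Y] (𝒜 ℬ : Matrix Y Y ℂ → Matrix Y Y ℂ) : Prop :=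
  IsCompletelyPositive fun M => ℬ M - 𝒜 M

/-- The random matrix `U` on the probability space `(Ω, P)` is an ensemble of symmetric unitaries
(with respect to the operators `ρ g`) which is an `ε`-approximate symmetric unitary `k`-design:
`(1 - ε) Φ_H ≼ Φ_U ≼ (1 + ε) Φ_H`, with `Φ_H` the twirl of the symmetric Haar ensemble. -/
structure IsApproxSymDesign {G : Type u} [DecidableEq X] (ρ : G → Matrix X X ℂ) (k : ℕ) (ε : ℝ)
    {Ω : Type w} [MeasurableSpace Ω] (P : Measure Ω) (U : Ω → Matrix X X ℂ) : Prop where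
  measurable : ∀ x y, Measurable fun ω => U ω x y
  unitary : ∀ ω, U ω ∈ unitaryGroup X ℂ
  symmetric : ∀ ω g, U ω * ρ g = ρ g * U ω
  lower : CPLE (fun A => ((1 - ε : ℝ) : ℂ) • twirl (symHaar ρ) (symVal ρ) k A) (twirl P U k)
  upper : CPLE (twirl P U k) (fun A => ((1 + ε : ℝ) : ℂ) • twirl (symHaar ρ) (symVal ρ) k A)

end Designs

/-! ### Qudits, on-site symmetries, local operators -/

section Qudits

/-- The regular representation, `|h⟩ ↦ |g h⟩`. -/
def regRep {G : Type u} [Group G] [DecidableEq G] (g : G) : Matrix G G ℂ :=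
  fun a h => if a = g * h then 1 else 0

/-- A unitary representation on `ℂ^X` is regular if it is unitarily equivalent to
`g ↦ R^reg_g ⊗ 1` on `ℂ^G ⊗ ℂ^{d'}`, for an ancilla of some dimension `d' ≥ 1`. -/
def IsRegularRep {G : Type u} [Group G] [Fintype G] [DecidableEq G] {X : Type v} [Fintype X]
    [DecidableEq X] (R : G →* unitaryGroup X ℂ) : Prop :=
  ∃ (d' : ℕ) (W : Matrix X (G × Fin d') ℂ), 0 < d' ∧ W * Wᴴ = 1 ∧ Wᴴ * W = 1 ∧
    ∀ g, (R g : Matrix X X ℂ) =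
      W * kroneckerMap (· * ·) (regRep g) (1 : Matrix (Fin d') (Fin d') ℂ) * Wᴴ

variable {ι : Type u} [DecidableEq ι] (q : ι → Type v)

/-- Labels of the product basis of `⨂_{i ∈ S} ℂ^{q i}`, the Hilbert space of a set `S` of qudits. -/
abbrev Conf (S : Finset ι) : Type (max u v) := ∀ i : S, q i

variable {q} [∀ i, Fintype (q i)] [∀ i, DecidableEq (q i)]

/-- The on-site symmetry operator `⨂_{i ∈ S} R^i_g`. -/
def regionRep {G : Type w} [Group G] (R : ∀ i, G →* unitaryGroup (q i) ℂ) (S : Finset ι) (g : G) :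
    Matrix (Conf q S) (Conf q S) ℂ :=
  fun x y => ∏ i : S, (R i g : Matrix (q i) (q i) ℂ) (x i) (y i)

/-- The operator `M ⊗ 1_{T \ S}` on `T`, for an operator `M` on `S ⊆ T`. -/
def extend {S T : Finset ι} (h : S ⊆ T) (M : Matrix (Conf q S) (Conf q S) ℂ) :
    Matrix (Conf q T) (Conf q T) ℂ :=
  fun x y => M (fun i => x ⟨i, h i.2⟩) (fun i => y ⟨i, h i.2⟩) *
    if ∀ i : T, (i : ι) ∉ S → x i = y i then 1 else 0

theorem union_subset_union_union (A B C : Finset ι) : B ∪ C ⊆ A ∪ B ∪ C :=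
  Finset.union_subset_union_left Finset.subset_union_right

/-- The Hilbert space dimension of a set of qudits, as a real number. -/
def dimR (q : ι → Type v) [∀ i, Fintype (q i)] (S : Finset ι) : ℝ :=
  (Fintype.card (Conf q S) : ℝ)

/-- A gate set: which operators on which sets of qudits are elementary gates. -/
abbrev GateSet (q : ι → Type v) : Type (max u v) :=
  ∀ S : Finset ι, Set (Matrix (Conf q S) (Conf q S) ℂ)

/-- One circuit layer on `T`: finitely many elementary gates with pairwise disjoint supports. -/
def IsLayer (𝒢 : GateSet q) (T : Finset ι) (L : Matrix (Conf q T) (Conf q T) ℂ) : Prop :=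
  ∃ l : List ((S : {S : Finset ι // S ⊆ T}) × Matrix (Conf q S.1) (Conf q S.1) ℂ),
    (l.Pairwise fun a b => Disjoint a.1.1 b.1.1) ∧ (∀ a ∈ l, a.2 ∈ 𝒢 a.1.1) ∧
      L = (l.map fun a => extend a.1.2 a.2).prod

/-- `U` is the product of `d` circuit layers on `T`. -/
def HasDepth (𝒢 : GateSet q) (T : Finset ι) (d : ℕ) (U : Matrix (Conf q T) (Conf q T) ℂ) : Prop :=
  ∃ Ls : List (Matrix (Conf q T) (Conf q T) ℂ),
    Ls.length = d ∧ (∀ L ∈ Ls, IsLayer 𝒢 T L) ∧ U = Ls.prod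

end Qudits

/-! ### The two-layer brickwork circuit on a line of `n` qudits -/

section Brickwork

/-- The two neighbouring patches `j` and `j + 1` of `ξ` qudits each: the qudits
`jξ, …, (j + 2)ξ - 1`. -/
def block (n ξ j : ℕ) : Finset (Fin n) :=
  Finset.univ.filter fun i => j * ξ ≤ i.val ∧ i.val < (j + 2) * ξ

variable {n : ℕ} {q : Fin n → Type v} [∀ i, Fintype (q i)] [∀ i, DecidableEq (q i)]

/-- The product of the unitaries `U j` with `j ≡ p` modulo `2`; their supports are disjoint. -/
def brickLayer (ξ r p : ℕ)
    (U : ∀ j : Fin r, Matrix (Conf q (block n ξ j)) (Conf q (block n ξ j)) ℂ) :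
    Matrix (Conf q Finset.univ) (Conf q Finset.univ) ℂ :=
  (((List.finRange r).filter fun j : Fin r => j.val % 2 = p).map fun j : Fin r =>
    extend (Finset.subset_univ (block n ξ j)) (U j)).prod

/-- The two-layer brickwork circuit: first the unitaries on the pairs of patches
`(0,1), (2,3), …`, then those on the pairs `(1,2), (3,4), …`. -/
def brickwork (ξ r : ℕ)
    (U : ∀ j : Fin r, Matrix (Conf q (block n ξ j)) (Conf q (block n ξ j)) ℂ) :
    Matrix (Conf q Finset.univ) (Conf q Finset.univ) ℂ :=
  brickLayer ξ r 1 U * brickLayer ξ r 0 U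

end Brickwork

end SymDesign

end

/-! Inverting the symmetric Haar twirl exactly would need Weingarten calculus. Instead it is
compared, in the order of completely positive maps, with an explicit map. Let `D` be the dimension
of a region and let `W_w` be the operators of the wreath product `G ≀ S_k` on `k` copies
(permutations of the copies and one group element per copy). If `k|G| ≤ D`, everything commuting
with all `U^{⊗k}`, `U` symmetric, is a combination of the `W_w`
(`IsFreePermRep.mem_span_of_commute`). So `Φ_H(A)` lies in their span, and it has the same traces
against them as `A`.

It follows (`traceMap_eq_mul`) that the trace map `A ↦ D^{-k} ∑ tr(A W_w†) W_w` equals `Φ_H(A) q`,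
where `q = ∑ f(w) W_w` and `f(w) = D^{-k} tr W_w`. As `q` commutes with `Φ_H(A)`, operator bounds `c
≤ q ≤ E` become `c Φ_H ≼ trace map ≼ E Φ_H`. For regular representations `G` permutes a basis
freely, so `f(w)` is a proportion of fixed `k`-tuples, and the bounds reduce to counting: `∑ f ≤ ∏
(1 + j|G|/D) ≤ exp(k(k-1)|G|/2D)`, and `q ≥ 1 - k(k-1)|G|/2D` because tuples with coordinates in
distinct orbits have trivial stabilizer.

For gluing, both designs are replaced by trace maps. Their composition is a double sum over `σ, τ`
weighted by the character of `τσ⁻¹` on the overlap `B`. Its Choi matrix is that of the trace map on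
`ABC` times a commuting class sum `∑ f_B(π) V_π`, which lies between `2 - E` and `E` as soon as `∑
f_B ≤ E` (`overlapMap_cple`, `cple_overlapMap`). Passing back to the Haar twirl on `ABC` gives the
stated product of factors (`IsApproxSymDesign.glue`).

The brickwork circuit is assembled from left to right by gluing one small unitary at a time, with a
single patch as overlap (`exists_partial_brickwork`). Only the overlap costs at first order in
`ε/n`, and `brickwork_bound` sums up the losses. The depth statement holds because circuits with
disjoint supports run in parallel. -/

namespace SymDesign

open scoped Kronecker

universe u v w v'

/-! ### Tensor products composed with permutations of the factors -/

section TwistedTensor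

variable {k : ℕ} {X Y Z : Type*}

/-- The operator `(⨂ a_i) ∘ σ` between `k`-fold tensor powers. -/
def twTensor (a : Fin k → Matrix X Y ℂ) (σ : Equiv.Perm (Fin k)) :
    Matrix (Fin k → X) (Fin k → Y) ℂ :=
  fun x y => ∏ i, a i (x i) (y (σ⁻¹ i))

theorem tensorPow_eq_twTensor [Fintype X] (M : Matrix X X ℂ) :
    tensorPow k M = twTensor (fun _ => M) 1 := by
  ext x y; simp [tensorPow, twTensor]

theorem twTensor_mul [Fintype Y] (a : Fin k → Matrix X Y ℂ) (b : Fin k → Matrix Y Z ℂ)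
    (σ τ : Equiv.Perm (Fin k)) :
    twTensor a σ * twTensor b τ = twTensor (fun i => a i * b (σ⁻¹ i)) (σ * τ) := by
  ext x z
  simp only [twTensor, Matrix.mul_apply, _root_.mul_inv_rev, Equiv.Perm.mul_apply]
  have h1 : ∀ y : Fin k → Y, (∏ i, a i (x i) (y (σ⁻¹ i))) * ∏ i, b i (y i) (z (τ⁻¹ i)) =
      ∏ i, a i (x i) (y (σ⁻¹ i)) * b (σ⁻¹ i) (y (σ⁻¹ i)) (z (τ⁻¹ (σ⁻¹ i))) := fun y => by
    rw [Finset.prod_mul_distrib,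
      Equiv.prod_comp σ⁻¹ (fun j => b j (y j) (z (τ⁻¹ j)))]
  simp only [h1]
  rw [Finset.prod_univ_sum, Fintype.piFinset_univ]
  exact Equiv.sum_comp (Equiv.arrowCongr σ (Equiv.refl Y))
    (fun y => ∏ i, a i (x i) (y i) * b (σ⁻¹ i) (y i) (z (τ⁻¹ (σ⁻¹ i))))

theorem twTensor_conjTranspose (a : Fin k → Matrix X Y ℂ) (σ : Equiv.Perm (Fin k)) :
    (twTensor a σ)ᴴ = twTensor (fun i => (a (σ i))ᴴ) σ⁻¹ := by
  ext y x
  simp only [twTensor, Matrix.conjTranspose_apply, star_prod, inv_inv]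
  rw [← Equiv.prod_comp σ]
  simp

theorem twTensor_one [DecidableEq X] :
    twTensor (fun _ : Fin k => (1 : Matrix X X ℂ)) 1 = 1 := by
  ext x y
  simp only [twTensor, Matrix.one_apply, Finset.prod_ite_zero, inv_one, Equiv.Perm.one_apply,
    Finset.prod_const_one, funext_iff, Finset.mem_univ, forall_true_left]

theorem tensorPow_mul [Fintype X] (A B : Matrix X X ℂ) :
    tensorPow k (A * B) = tensorPow k A * tensorPow k B := by
  simp [tensorPow_eq_twTensor, twTensor_mul]

theorem tensorPow_one [Fintype X] [DecidableEq X] :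
    tensorPow k (1 : Matrix X X ℂ) = 1 := by
  rw [tensorPow_eq_twTensor, twTensor_one]

theorem tensorPow_conjTranspose [Fintype X] (A : Matrix X X ℂ) :
    (tensorPow k A)ᴴ = tensorPow k Aᴴ := by
  simp [tensorPow_eq_twTensor, twTensor_conjTranspose]

theorem tensorPow_smul [Fintype X] (c : ℂ) (A : Matrix X X ℂ) :
    tensorPow k (c • A) = c ^ k • tensorPow k A := by
  ext x y
  simp [tensorPow, Finset.prod_mul_distrib]

end TwistedTensor

/-! ### The wreath product and its representation on tensor powers -/

/-- The wreath product `G ≀ S_k`. -/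
abbrev Wreath (G : Type*) [Group G] (k : ℕ) : Type _ :=
  (Fin k → G) ⋊[mulAutArrow] Equiv.Perm (Fin k)

instance instFintypeWreath (G : Type*) [Group G] [Fintype G] (k : ℕ) : Fintype (Wreath G k) := by
  classical
  exact Fintype.ofEquiv _ SemidirectProduct.equivProd.symm

section WreathRep

variable {G : Type*} [Group G] {k : ℕ} {X Y : Type*} [Fintype X] [DecidableEq X] [Fintype Y]
  [DecidableEq Y]

/-- The representation of `G ≀ S_k` on the `k`-th tensor power of a representation of `G`. -/
def wreathRep (k : ℕ) (ρ : G →* Matrix X X ℂ) :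
    Wreath G k →* Matrix (Fin k → X) (Fin k → X) ℂ where
  toFun w := twTensor (fun i => ρ (w.left i)) w.right
  map_one' := by simp [twTensor_one]
  map_mul' v w := by
    rw [twTensor_mul]
    congr 1
    funext i
    simp only [SemidirectProduct.mul_left, Pi.mul_apply, map_mul]
    rfl

theorem wreathRep_apply (ρ : G →* Matrix X X ℂ) (w : Wreath G k) :
    wreathRep k ρ w = twTensor (fun i => ρ (w.left i)) w.right := rfl

theorem wreathRep_conjTranspose {ρ : G →* Matrix X X ℂ} (hρ : ∀ g, (ρ g)ᴴ = ρ g⁻¹)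
    (w : Wreath G k) : (wreathRep k ρ w)ᴴ = wreathRep k ρ w⁻¹ := by
  rw [wreathRep_apply, twTensor_conjTranspose, wreathRep_apply]
  congr 1
  funext i
  rw [hρ]
  simp only [SemidirectProduct.inv_left]
  rfl

theorem wreathRep_intertwine {ρ : G →* Matrix X X ℂ} {ρ' : G →* Matrix Y Y ℂ} {T : Matrix X Y ℂ}
    (hT : ∀ g, ρ g * T = T * ρ' g) (w : Wreath G k) :
    wreathRep k ρ w * twTensor (fun _ : Fin k => T) 1 =
      twTensor (fun _ : Fin k => T) 1 * wreathRep k ρ' w := by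
  simp [wreathRep_apply, twTensor_mul, hT]

theorem tensorPow_commute_wreathRep {ρ : G →* Matrix X X ℂ} {U : Matrix X X ℂ}
    (hU : ∀ g, U * ρ g = ρ g * U) (w : Wreath G k) :
    tensorPow k U * wreathRep k ρ w = wreathRep k ρ w * tensorPow k U := by
  simp [tensorPow_eq_twTensor, wreathRep_apply, twTensor_mul, hU]

end WreathRep

set_option linter.unusedSectionVars false

/-! ### From symmetric unitaries to all symmetric matrices: the Cayley transform -/

section Cayley

variable {X : Type*} [Fintype X] [DecidableEq X]

/-- For skew-Hermitian `c` the product `(1 + c)(1 - c)` equals `1 + c†c`, which is positive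
definite. -/
theorem isUnit_one_sub_of_skew {c : Matrix X X ℂ} (hc : cᴴ = -c) : IsUnit (1 - c).det := by
  have h : ((1 : Matrix X X ℂ) + cᴴ * c).PosDef :=
    PosDef.one.add_posSemidef (posSemidef_conjTranspose_mul_self c)
  have h2 : (1 : Matrix X X ℂ) + cᴴ * c = (1 + c) * (1 - c) := by
    rw [hc]; noncomm_ring
  have h3 := (Matrix.isUnit_iff_isUnit_det _).mp h.isUnit
  rw [h2, Matrix.det_mul] at h3
  exact isUnit_of_mul_isUnit_right h3

theorem cayley_mem_unitaryGroup {c : Matrix X X ℂ} (hc : cᴴ = -c) :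
    (1 + c) * (1 - c)⁻¹ ∈ unitaryGroup X ℂ := by
  have h1 := isUnit_one_sub_of_skew hc
  have h2 : IsUnit (1 + c).det := by
    have := isUnit_one_sub_of_skew (c := -c) (by rw [conjTranspose_neg, hc])
    rwa [sub_neg_eq_add] at this
  rw [mem_unitaryGroup_iff', star_eq_conjTranspose, conjTranspose_mul,
    conjTranspose_nonsing_inv]
  simp only [conjTranspose_sub, conjTranspose_add, conjTranspose_one, hc, sub_neg_eq_add,
    ← sub_eq_add_neg]
  calc (1 + c)⁻¹ * (1 - c) * ((1 + c) * (1 - c)⁻¹)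
      = (1 + c)⁻¹ * ((1 - c) * (1 + c)) * (1 - c)⁻¹ := by simp only [Matrix.mul_assoc]
    _ = (1 + c)⁻¹ * ((1 + c) * (1 - c)) * (1 - c)⁻¹ := by
        congr 2; noncomm_ring
    _ = ((1 + c)⁻¹ * (1 + c)) * ((1 - c) * (1 - c)⁻¹) := by simp only [Matrix.mul_assoc]
    _ = 1 := by rw [nonsing_inv_mul _ h2, mul_nonsing_inv _ h1, Matrix.one_mul]

theorem nonsing_inv_commute {a r : Matrix X X ℂ} (ha : IsUnit a.det) (h : a * r = r * a) :
    a⁻¹ * r = r * a⁻¹ := by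
  calc a⁻¹ * r = a⁻¹ * (r * a) * a⁻¹ := by
        rw [Matrix.mul_assoc, Matrix.mul_assoc, mul_nonsing_inv _ ha, Matrix.mul_one]
    _ = r * a⁻¹ := by
        rw [← h, ← Matrix.mul_assoc, nonsing_inv_mul _ ha, Matrix.one_mul]

theorem adjugate_eq_det_smul_inv {a : Matrix X X ℂ} (ha : IsUnit a.det) :
    adjugate a = a.det • a⁻¹ := by
  rw [Matrix.inv_def, smul_smul, Ring.mul_inverse_cancel _ ha, one_smul]

variable {G : Type*} {ρ : G → Matrix X X ℂ} {k : ℕ}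

theorem commute_tensorPow_smul {M : Matrix (Fin k → X) (Fin k → X) ℂ} {b : Matrix X X ℂ} (s : ℂ)
    (h : M * tensorPow k b = tensorPow k b * M) :
    M * tensorPow k (s • b) = tensorPow k (s • b) * M := by
  rw [tensorPow_smul, Matrix.mul_smul, h, Matrix.smul_mul]

theorem commute_tensorPow_of_smul {M : Matrix (Fin k → X) (Fin k → X) ℂ} {b : Matrix X X ℂ}
    {s : ℂ} (hs : s ≠ 0) (h : M * tensorPow k (s • b) = tensorPow k (s • b) * M) :
    M * tensorPow k b = tensorPow k b * M := by
  have := commute_tensorPow_smul s⁻¹ h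
  rwa [smul_smul, inv_mul_cancel₀ hs, one_smul] at this

/-- A matrix polynomial that commutes with `M` after taking tensor powers, for real arguments,
does so for complex arguments. -/
theorem commute_tensorPow_eval {M : Matrix (Fin k → X) (Fin k → X) ℂ}
    (F : Matrix X X (Polynomial ℂ))
    (h : ∀ t : ℝ, M * tensorPow k (F.map (Polynomial.eval (t : ℂ))) =
      tensorPow k (F.map (Polynomial.eval (t : ℂ))) * M) (z : ℂ) :
    M * tensorPow k (F.map (Polynomial.eval z)) = tensorPow k (F.map (Polynomial.eval z)) * M := by
  ext x y
  -- Each entry of the commutator is a polynomial in the argument; it vanishes on the infinite set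
  -- of real numbers, hence identically.
  let R : Polynomial ℂ := (∑ u, Polynomial.C (M x u) * ∏ i, F (u i) (y i)) -
    ∑ u : Fin k → X, (∏ i, F (x i) (u i)) * Polynomial.C (M u y)
  have hR : ∀ z : ℂ, R.eval z = (M * tensorPow k (F.map (Polynomial.eval z))) x y -
      (tensorPow k (F.map (Polynomial.eval z)) * M) x y := fun z => by
    simp [R, Matrix.mul_apply, tensorPow, Polynomial.eval_finsetSum, Polynomial.eval_prod]
  have h0 : R = 0 := by
    refine Polynomial.eq_zero_of_infinite_isRoot R
      (Set.Infinite.mono ?_ (Set.infinite_range_of_injective Complex.ofReal_injective))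
    rintro _ ⟨t, rfl⟩
    simp only [Set.mem_ofPred_eq, Polynomial.IsRoot, hR, h t, sub_self]
  have := hR z
  rw [h0, Polynomial.eval_zero] at this
  exact (sub_eq_zero.mp this.symm)

variable {M : Matrix (Fin k → X) (Fin k → X) ℂ}

/-- The adjugate in place of the inverse changes the Cayley transform only by the scalar `det (1 -
c)`, which does not affect commutation, and makes the entries polynomial in those of `c`. -/
theorem commute_tensorPow_cayley_skew
    (hM : ∀ U ∈ unitaryGroup X ℂ, (∀ g, U * ρ g = ρ g * U) →
      M * tensorPow k U = tensorPow k U * M)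
    {c : Matrix X X ℂ} (hc : cᴴ = -c) (hcomm : ∀ g, c * ρ g = ρ g * c) :
    M * tensorPow k ((1 + c) * adjugate (1 - c)) =
      tensorPow k ((1 + c) * adjugate (1 - c)) * M := by
  have h1 := isUnit_one_sub_of_skew hc
  rw [adjugate_eq_det_smul_inv h1, Matrix.mul_smul]
  refine commute_tensorPow_smul _ (hM _ (cayley_mem_unitaryGroup hc) fun g => ?_)
  have h2 : (1 - c) * ρ g = ρ g * (1 - c) := by
    rw [Matrix.sub_mul, Matrix.mul_sub, hcomm, Matrix.one_mul, Matrix.mul_one]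
  rw [Matrix.mul_assoc, nonsing_inv_commute h1 h2, ← Matrix.mul_assoc, ← Matrix.mul_assoc,
    Matrix.add_mul, Matrix.mul_add, hcomm, Matrix.one_mul, Matrix.mul_one]

theorem conjTranspose_commute (hρ : ∀ g, ∃ g', (ρ g)ᴴ = ρ g') {a : Matrix X X ℂ}
    (ha : ∀ g, a * ρ g = ρ g * a) (g : G) :
    aᴴ * ρ g = ρ g * aᴴ := by
  obtain ⟨g', hg'⟩ := hρ g
  have h := congrArg conjTranspose (ha g')
  rw [conjTranspose_mul, conjTranspose_mul, ← hg', conjTranspose_conjTranspose] at h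
  exact h.symm

/-- The commutant is closed under adjoints, so `a = p + i r` with `p`, `r` skew-Hermitian in the
commutant. For real `t` the matrix `p + t r` is skew-Hermitian, and the resulting polynomial
identity in `t` may be evaluated at `t = i`. -/
theorem commute_tensorPow_cayley (hρ : ∀ g, ∃ g', (ρ g)ᴴ = ρ g')
    (hM : ∀ U ∈ unitaryGroup X ℂ, (∀ g, U * ρ g = ρ g * U) →
      M * tensorPow k U = tensorPow k U * M)
    {a : Matrix X X ℂ} (ha : ∀ g, a * ρ g = ρ g * a) :
    M * tensorPow k ((1 + a) * adjugate (1 - a)) =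
      tensorPow k ((1 + a) * adjugate (1 - a)) * M := by
  have ha' := conjTranspose_commute hρ ha
  let p : Matrix X X ℂ := (1 / 2 : ℂ) • (a - aᴴ)
  let r : Matrix X X ℂ := (-Complex.I / 2) • (a + aᴴ)
  have hp : pᴴ = -p := by
    simp only [p, conjTranspose_smul, conjTranspose_sub, conjTranspose_conjTranspose]
    rw [← smul_neg, neg_sub]; congr 1; simp
  have hr : rᴴ = -r := by
    simp only [r, conjTranspose_smul, conjTranspose_add, conjTranspose_conjTranspose]
    rw [← neg_smul, add_comm]; congr 1; simp [neg_div]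
  have hpr : p + Complex.I • r = a := by
    simp only [p, r, smul_smul]
    have : Complex.I * (-Complex.I / 2) = 1 / 2 := by
      linear_combination (-1 / 2 : ℂ) * Complex.I_mul_I
    rw [this, ← smul_add]
    simp only [sub_add_add_cancel, ← two_smul ℂ a, smul_smul]
    norm_num
  let C : Matrix X X (Polynomial ℂ) :=
    p.map Polynomial.C + Polynomial.X (R := ℂ) • r.map Polynomial.C
  have hC : ∀ z : ℂ, (Polynomial.evalRingHom z).mapMatrix C = p + z • r := fun z => by
    ext x y; simp [C]; ring
  have hF : ∀ z : ℂ, ((1 + C) * adjugate (1 - C)).map (Polynomial.eval z) =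
      (1 + (p + z • r)) * adjugate (1 - (p + z • r)) := fun z => by
    have : ((1 + C) * adjugate (1 - C)).map (Polynomial.eval z) =
      (Polynomial.evalRingHom z).mapMatrix ((1 + C) * adjugate (1 - C)) := rfl
    rw [this, map_mul, RingHom.map_adjugate, map_add, map_sub, map_one, hC]
  have key := commute_tensorPow_eval (M := M) ((1 + C) * adjugate (1 - C)) (fun t => by
    rw [hF]
    refine commute_tensorPow_cayley_skew hM ?_ fun g => ?_
    · simp only [conjTranspose_add, conjTranspose_smul, hp, hr, Complex.star_def,
        Complex.conj_ofReal, smul_neg, neg_add]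
    · simp only [p, r, Matrix.add_mul, Matrix.mul_add, Matrix.smul_mul, Matrix.mul_smul,
        Matrix.sub_mul, Matrix.mul_sub, ha, ha']) Complex.I
  rwa [hF, hpr] at key

/-- If `1 + b` is invertible, `b` is the Cayley transform of `(b - 1)(1 + b)⁻¹`. In general some
nonzero multiple `t b` has this property, and scalars do not matter for commutation. -/
theorem commute_tensorPow_of_unitary (hρ : ∀ g, ∃ g', (ρ g)ᴴ = ρ g')
    (hM : ∀ U ∈ unitaryGroup X ℂ, (∀ g, U * ρ g = ρ g * U) →
      M * tensorPow k U = tensorPow k U * M)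
    {b : Matrix X X ℂ} (hb : ∀ g, b * ρ g = ρ g * b) :
    M * tensorPow k b = tensorPow k b * M := by
  have key : ∀ b : Matrix X X ℂ, (∀ g, b * ρ g = ρ g * b) → (1 + b).det ≠ 0 →
      M * tensorPow k b = tensorPow k b * M := fun b hb hdet => by
    have hu : IsUnit (1 + b).det := hdet.isUnit
    have h1 : (1 : Matrix X X ℂ) - (b - 1) * (1 + b)⁻¹ = (2 : ℂ) • (1 + b)⁻¹ := by
      calc (1 : Matrix X X ℂ) - (b - 1) * (1 + b)⁻¹
          = (1 + b) * (1 + b)⁻¹ - (b - 1) * (1 + b)⁻¹ := by rw [mul_nonsing_inv _ hu]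
        _ = _ := by rw [← Matrix.sub_mul, two_smul]; noncomm_ring
    have h2 : (1 : Matrix X X ℂ) + (b - 1) * (1 + b)⁻¹ = (2 : ℂ) • (b * (1 + b)⁻¹) := by
      calc (1 : Matrix X X ℂ) + (b - 1) * (1 + b)⁻¹
          = (1 + b) * (1 + b)⁻¹ + (b - 1) * (1 + b)⁻¹ := by rw [mul_nonsing_inv _ hu]
        _ = _ := by rw [← Matrix.add_mul, two_smul]; noncomm_ring
    have hiu : IsUnit ((1 + b)⁻¹).det := by rwa [Matrix.isUnit_nonsing_inv_det_iff]
    have h3 : IsUnit ((2 : ℂ) • (1 + b)⁻¹).det := by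
      rw [det_smul]; exact (IsUnit.pow _ (by norm_num)).mul hiu
    have hcomm : ∀ g, (b - 1) * (1 + b)⁻¹ * ρ g = ρ g * ((b - 1) * (1 + b)⁻¹) := fun g => by
      have : (1 + b) * ρ g = ρ g * (1 + b) := by
        rw [Matrix.add_mul, Matrix.mul_add, hb, Matrix.one_mul, Matrix.mul_one]
      rw [Matrix.mul_assoc, nonsing_inv_commute hu this, ← Matrix.mul_assoc, ← Matrix.mul_assoc,
        Matrix.sub_mul, Matrix.mul_sub, hb, Matrix.one_mul, Matrix.mul_one]
    have h4 := commute_tensorPow_cayley hρ hM hcomm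
    rw [h1, h2] at h4
    have h5 : (2 : ℂ) • (b * (1 + b)⁻¹) * adjugate ((2 : ℂ) • (1 + b)⁻¹) =
        ((2 : ℂ) • (1 + b)⁻¹).det • b := by
      calc (2 : ℂ) • (b * (1 + b)⁻¹) * adjugate ((2 : ℂ) • (1 + b)⁻¹)
          = b * (((2 : ℂ) • (1 + b)⁻¹) * adjugate ((2 : ℂ) • (1 + b)⁻¹)) := by
            rw [← Matrix.mul_smul, Matrix.mul_assoc]
        _ = _ := by rw [mul_adjugate, Matrix.mul_smul, Matrix.mul_one]
    rw [h5] at h4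
    exact commute_tensorPow_of_smul h3.ne_zero h4
  have hcont : Continuous fun t : ℂ => (1 + t • b).det := by fun_prop
  have hev : ∀ᶠ t in nhds (0 : ℂ), (1 + t • b).det ≠ 0 :=
    hcont.continuousAt.eventually_ne (by simp)
  obtain ⟨t, ht, ht0⟩ := ((hev.filter_mono nhdsWithin_le_nhds).and
    (self_mem_nhdsWithin : {0}ᶜ ∈ nhdsWithin (0 : ℂ) {0}ᶜ)).exists
  refine commute_tensorPow_of_smul ht0 (key _ (fun g => ?_) ht)
  rw [Matrix.smul_mul, Matrix.mul_smul, hb]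

end Cayley

/-! ### Polarization of tensor powers -/

/-- Ryser's formula for the permanent. -/
theorem sum_perm_prod_eq_sum_finset {k : ℕ} (b : Fin k → Fin k → ℂ) :
    ∑ σ : Equiv.Perm (Fin k), ∏ i, b i (σ i) =
      ∑ S : Finset (Fin k), (-1 : ℂ) ^ (Sᶜ).card * ∏ i, ∑ j ∈ S, b i j := by
  have h1 : ∀ S : Finset (Fin k), (-1 : ℂ) ^ (Sᶜ).card * ∏ i, ∑ j ∈ S, b i j =
      ∑ p : Fin k → Fin k, (∏ i, b i (p i)) *
        (if ∀ i, p i ∈ S then (-1 : ℂ) ^ (Sᶜ).card else 0) := fun S => by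
    rw [Finset.prod_univ_sum, Finset.mul_sum]
    rw [← Finset.sum_subset (Finset.subset_univ (Fintype.piFinset fun _ => S))]
    · refine Finset.sum_congr rfl fun p hp => ?_
      rw [if_pos (Fintype.mem_piFinset.mp hp), mul_comm]
    · intro p _ hp
      rw [if_neg (fun h => hp (Fintype.mem_piFinset.mpr h)), mul_zero]
  -- Inclusion-exclusion over the complements `R` of `S`: these range over the subsets of the
  -- complement of the image of `p`, and the signs cancel unless that complement is empty.
  have h2 : ∀ p : Fin k → Fin k,
      ∑ S : Finset (Fin k), (if ∀ i, p i ∈ S then (-1 : ℂ) ^ (Sᶜ).card else 0) =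
        if Function.Bijective p then 1 else 0 := fun p => by
    rw [← Equiv.sum_comp (Function.Involutive.toPerm (compl : Finset (Fin k) → _) compl_involutive)]
    simp only [Function.Involutive.coe_toPerm, compl_compl, Finset.mem_compl]
    rw [← Finset.sum_filter]
    have : (Finset.univ.filter fun R : Finset (Fin k) => ∀ i, p i ∉ R) =
        (Finset.univ.image p)ᶜ.powerset := by
      ext R
      simp only [Finset.mem_filter, Finset.mem_univ, true_and, Finset.mem_powerset]
      constructor
      · intro h a ha
        simp only [Finset.mem_compl, Finset.mem_image, Finset.mem_univ, true_and, not_exists]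
        rintro i rfl
        exact h i ha
      · intro h i hi
        have := h hi
        simp at this
    rw [this]
    have h3 := Finset.sum_powerset_neg_one_pow_card (x := (Finset.univ.image p)ᶜ)
    have h4 : (∑ m ∈ (Finset.univ.image p)ᶜ.powerset, (-1 : ℂ) ^ m.card) =
        ((∑ m ∈ (Finset.univ.image p)ᶜ.powerset, (-1 : ℤ) ^ m.card : ℤ) : ℂ) := by
      push_cast; rfl
    rw [h4, h3]
    have h5 : (Finset.univ.image p)ᶜ = ∅ ↔ Function.Bijective p := by
      rw [Finset.compl_eq_empty_iff, ← Finset.coe_eq_univ, Finset.coe_image, Finset.coe_univ,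
        Set.image_univ, Set.range_eq_univ, Finite.surjective_iff_bijective]
    by_cases hp : Function.Bijective p
    · rw [if_pos (h5.mpr hp), if_pos hp, Int.cast_one]
    · rw [if_neg (mt h5.mp hp), if_neg hp, Int.cast_zero]
  simp only [h1]
  rw [Finset.sum_comm]
  have h3 : ∀ p : Fin k → Fin k, ∑ S : Finset (Fin k), (∏ i, b i (p i)) *
      (if ∀ i, p i ∈ S then (-1 : ℂ) ^ (Sᶜ).card else 0) =
        if Function.Bijective p then ∏ i, b i (p i) else 0 := fun p => by
    rw [← Finset.mul_sum, h2, mul_ite, mul_one, mul_zero]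
  rw [Finset.sum_congr rfl fun p _ => h3 p, ← Finset.sum_filter]
  refine Finset.sum_bij (fun σ _ => ⇑σ)
    (fun σ _ => Finset.mem_filter.mpr ⟨Finset.mem_univ _, σ.bijective⟩)
    (fun σ _ τ _ h => Equiv.coe_fn_injective h)
    (fun p hp => ⟨Equiv.ofBijective p (Finset.mem_filter.mp hp).2, Finset.mem_univ _, rfl⟩)
    (fun _ _ => rfl)

/-- The symmetrized product of the `a j` is a signed combination of tensor powers of partial sums of
them, so commuting with tensor powers is enough. -/
theorem commute_sum_perm {k : ℕ} {Z : Type*} [Fintype Z]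
    {M : Matrix (Fin k → Z) (Fin k → Z) ℂ} (a : Fin k → Matrix Z Z ℂ)
    (h : ∀ S : Finset (Fin k),
      M * tensorPow k (∑ j ∈ S, a j) = tensorPow k (∑ j ∈ S, a j) * M) :
    M * Matrix.of (fun x z => ∑ σ : Equiv.Perm (Fin k), ∏ i, a (σ i) (x i) (z i)) =
      Matrix.of (fun x z => ∑ σ : Equiv.Perm (Fin k), ∏ i, a (σ i) (x i) (z i)) * M := by
  have h1 : Matrix.of (fun (x z : Fin k → Z) =>
        ∑ σ : Equiv.Perm (Fin k), ∏ i, a (σ i) (x i) (z i)) =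
      ∑ S : Finset (Fin k), (-1 : ℂ) ^ (Sᶜ).card • tensorPow k (∑ j ∈ S, a j) := by
    ext x z
    rw [Matrix.of_apply, sum_perm_prod_eq_sum_finset (fun i j => a j (x i) (z i))]
    simp [Matrix.sum_apply, tensorPow]
  rw [h1, Matrix.mul_sum, Matrix.sum_mul]
  exact Finset.sum_congr rfl fun S _ => by rw [Matrix.mul_smul, h, Matrix.smul_mul]

/-! ### The commutant theorem for permutation representations -/

section PermutationRep

variable {G : Type*} [Group G] {Z : Type*} [MulAction G Z] {k : ℕ}

/-- The action of `G ≀ S_k` on `Z^k`. -/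
def wreathSMul (w : Wreath G k) (z : Fin k → Z) : Fin k → Z :=
  fun i => w.left i • z (w.right⁻¹ i)

variable [DecidableEq Z]

/-- The permutation representation of an action. -/
def permRep (G : Type*) [Group G] (Z : Type*) [Fintype Z] [DecidableEq Z] [MulAction G Z] :
    G →* Matrix Z Z ℂ where
  toFun g := Matrix.of fun x y => if x = g • y then 1 else 0
  map_one' := by ext x y; simp [Matrix.one_apply]
  map_mul' g h := by
    ext x y
    simp [Matrix.mul_apply, mul_smul]

variable [Fintype Z]

theorem permRep_apply (g : G) (x y : Z) :
    permRep G Z g x y = if x = g • y then 1 else 0 := rfl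

theorem permRep_conjTranspose (g : G) : (permRep G Z g)ᴴ = permRep G Z g⁻¹ := by
  ext x y
  rw [conjTranspose_apply, permRep_apply, permRep_apply]
  have : y = g • x ↔ x = g⁻¹ • y := by rw [eq_inv_smul_iff, eq_comm]
  by_cases h : y = g • x
  · rw [if_pos h, if_pos (this.mp h), star_one]
  · rw [if_neg h, if_neg (mt this.mpr h), star_zero]

theorem wreathRep_permRep_apply (w : Wreath G k) (x y : Fin k → Z) :
    wreathRep k (permRep G Z) w x y = if x = wreathSMul w y then 1 else 0 := by
  simp only [wreathRep_apply, twTensor, permRep_apply, Finset.prod_ite_zero,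
    Finset.prod_const_one, funext_iff, Finset.mem_univ, forall_true_left, wreathSMul]

variable [Fintype G]

/-- Expanding the product of sums over `G` yields one term per permutation and tuple of group
elements, that is, per element of the wreath product. -/
theorem sum_perm_orbit (y z₀ : Fin k → Z) (x z : Fin k → Z) :
    ∑ σ : Equiv.Perm (Fin k), ∏ i, (∑ g : G,
        (if x i = g • y (σ i) then (1 : ℂ) else 0) * if z i = g • z₀ (σ i) then 1 else 0) =
      ∑ w : Wreath G k, if x = wreathSMul w y ∧ z = wreathSMul w z₀ then (1 : ℂ) else 0 := by
  rw [← Equiv.sum_comp (SemidirectProduct.equivProd (φ := mulAutArrow)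
    (N := Fin k → G) (G := Equiv.Perm (Fin k))).symm, Fintype.sum_prod_type_right,
    ← Equiv.sum_comp (Equiv.inv (Equiv.Perm (Fin k)))]
  refine Finset.sum_congr rfl fun σ _ => ?_
  rw [Finset.prod_univ_sum, Fintype.piFinset_univ]
  refine Finset.sum_congr rfl fun g _ => ?_
  simp only [← ite_and, mul_ite, mul_one, mul_zero, Finset.prod_ite_zero, Finset.prod_const_one,
    Finset.mem_univ, forall_true_left, funext_iff, wreathSMul, forall_and,
    SemidirectProduct.equivProd, Equiv.coe_fn_symm_mk, Equiv.inv_apply, and_comm]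

/-- `M` commutes with `T = ∑_w |w y⟩⟨w z₀|`, a symmetrized product of operators commuting with `G`.
Comparing the entries `(x, z₀)` of `M T` and `T M` recovers the full matrix `M` from its column
`z₀`. -/
theorem mem_span_of_commute_permRep {z₀ : Fin k → Z}
    (hz₀ : ∀ w : Wreath G k, wreathSMul w z₀ = z₀ → w = 1)
    {M : Matrix (Fin k → Z) (Fin k → Z) ℂ}
    (hM : ∀ b : Matrix Z Z ℂ, (∀ g, b * permRep G Z g = permRep G Z g * b) →
      M * tensorPow k b = tensorPow k b * M) :
    M = ∑ w : Wreath G k, M (wreathSMul w z₀) z₀ • wreathRep k (permRep G Z) w := by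
  classical
  ext x y
  let a : Fin k → Matrix Z Z ℂ := fun j => Matrix.of fun u v =>
    ∑ g : G, (if u = g • y j then (1 : ℂ) else 0) * if v = g • z₀ j then 1 else 0
  have ha : ∀ j g, a j * permRep G Z g = permRep G Z g * a j := fun j g => by
    ext u v
    simp only [a, Matrix.mul_apply, Matrix.of_apply, permRep_apply, mul_ite, mul_one, mul_zero,
      ite_mul, one_mul, zero_mul, Finset.sum_ite_eq', Finset.mem_univ, if_true]
    have e2 : ∀ t : Z, (u = g • t) ↔ (t = g⁻¹ • u) := fun t => by
      rw [eq_inv_smul_iff, eq_comm]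
    simp only [e2, Finset.sum_ite_eq', Finset.mem_univ, if_true]
    rw [← Equiv.sum_comp (Equiv.mulLeft g)]
    refine Finset.sum_congr rfl fun h _ => ?_
    have e3 : u = (g * h) • y j ↔ g⁻¹ • u = h • y j := by rw [mul_smul, inv_smul_eq_iff]
    have e4 : g • v = (g * h) • z₀ j ↔ v = h • z₀ j := by rw [mul_smul, smul_left_cancel_iff]
    simp only [Equiv.coe_mulLeft, e3, e4]
  have h := commute_sum_perm (M := M) a fun S => hM _ fun g => by
    rw [Matrix.sum_mul, Matrix.mul_sum]; exact Finset.sum_congr rfl fun j _ => ha j g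
  have hT : Matrix.of (fun (x z : Fin k → Z) =>
      ∑ σ : Equiv.Perm (Fin k), ∏ i, a (σ i) (x i) (z i)) =
      Matrix.of fun x z => ∑ w : Wreath G k,
        if x = wreathSMul w y ∧ z = wreathSMul w z₀ then (1 : ℂ) else 0 := by
    ext x z
    exact sum_perm_orbit y z₀ x z
  rw [hT] at h
  -- Only `w = 1` contributes to the column `z₀` of `M T`, because `z₀` has trivial stabilizer.
  have hl : ∀ w : Wreath G k, (∑ u, M x u *
      if u = wreathSMul w y ∧ z₀ = wreathSMul w z₀ then (1 : ℂ) else 0) =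
      if w = 1 then M x y else 0 := fun w => by
    by_cases hw : w = 1
    · subst hw
      have e : ∀ t : Fin k → Z, wreathSMul (1 : Wreath G k) t = t := fun t => by
        funext i; simp [wreathSMul]
      simp [e]
    · have : ¬ z₀ = wreathSMul w z₀ := fun e => hw (hz₀ w e.symm)
      simp [this, hw]
  have hl' : M x y = ∑ u, (∑ w : Wreath G k,
      if x = wreathSMul w y ∧ u = wreathSMul w z₀ then (1 : ℂ) else 0) * M u z₀ := by
    have := congrArg (fun A : Matrix (Fin k → Z) (Fin k → Z) ℂ => A x z₀) h
    simp only [Matrix.mul_apply, Matrix.of_apply, Finset.mul_sum] at this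
    rw [Finset.sum_comm, Finset.sum_congr rfl fun w _ => hl w, Finset.sum_ite_eq'] at this
    simpa using this
  have hxz : M x y = ∑ w : Wreath G k, ∑ u,
      (if x = wreathSMul w y ∧ u = wreathSMul w z₀ then (1 : ℂ) else 0) * M u z₀ := by
    rw [hl', Finset.sum_comm]
    exact Finset.sum_congr rfl fun u _ => Finset.sum_mul _ _ _
  have hr : (∑ w : Wreath G k, M (wreathSMul w z₀) z₀ • wreathRep k (permRep G Z) w) x y =
      ∑ w : Wreath G k, M (wreathSMul w z₀) z₀ *
        if x = wreathSMul w y then (1 : ℂ) else 0 := by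
    rw [Matrix.sum_apply]
    exact Finset.sum_congr rfl fun w _ => by
      rw [Matrix.smul_apply, wreathRep_permRep_apply, smul_eq_mul]
  rw [hr, hxz]
  refine Finset.sum_congr rfl fun w _ => ?_
  by_cases hx : x = wreathSMul w y <;> simp [hx]

end PermutationRep

/-! ### Counting orbits, stabilizers and fixed tuples -/

section Counting

variable {G : Type*} [Group G] {Z : Type*} [MulAction G Z] {k : ℕ}

theorem wreathSMul_one (z : Fin k → Z) : wreathSMul (1 : Wreath G k) z = z := by
  funext i; simp [wreathSMul]

theorem wreathSMul_mul (v w : Wreath G k) (z : Fin k → Z) :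
    wreathSMul (v * w) z = wreathSMul v (wreathSMul w z) := by
  funext i
  simp only [wreathSMul, SemidirectProduct.mul_left, SemidirectProduct.mul_right, Pi.mul_apply,
    mul_smul, _root_.mul_inv_rev]
  rfl

/-- The stabilizer of a point of `Z^k` in the wreath product. -/
def wreathStab (G : Type*) [Group G] [MulAction G Z] (z : Fin k → Z) :
    Subgroup (Wreath G k) where
  carrier := {w | wreathSMul w z = z}
  one_mem' := wreathSMul_one z
  mul_mem' := fun {v w} hv hw => by
    rw [Set.mem_ofPred_eq] at *
    rw [wreathSMul_mul, hw, hv]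
  inv_mem' := fun {w} hw => by
    rw [Set.mem_ofPred_eq] at *
    conv_lhs => rw [← hw]
    rw [← wreathSMul_mul, inv_mul_cancel, wreathSMul_one]

theorem mem_wreathStab {z : Fin k → Z} {w : Wreath G k} :
    w ∈ wreathStab G z ↔ wreathSMul w z = z := Iff.rfl

/-- The orbit of a point. -/
def orb (G : Type*) [Group G] [MulAction G Z] (z : Z) : MulAction.orbitRel.Quotient G Z :=
  Quotient.mk'' z

theorem orb_eq_iff {y z : Z} : orb G y = orb G z ↔ ∃ g : G, g • z = y := by
  unfold orb
  rw [Quotient.eq'']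
  rfl

/-- Coordinates in distinct orbits rule out any permutation; freeness then rules out the group
elements. -/
theorem eq_one_of_wreathSMul_eq (hfree : ∀ (g : G) (z : Z), g • z = z → g = 1) {z : Fin k → Z}
    (hz : Function.Injective fun i => orb G (z i)) {w : Wreath G k} (hw : wreathSMul w z = z) :
    w = 1 := by
  have h1 : ∀ i, w.left i • z (w.right⁻¹ i) = z i := fun i => congrFun hw i
  have h2 : ∀ i, w.right⁻¹ i = i := fun i =>
    hz ((orb_eq_iff.mpr ⟨w.left i, h1 i⟩).symm)
  refine SemidirectProduct.ext (funext fun i => ?_) ?_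
  · have := h1 i
    rw [h2] at this
    exact hfree _ _ this
  · have : w.right⁻¹ = 1 := Equiv.ext h2
    rw [inv_eq_one] at this
    simpa using this

variable [Fintype G] [Fintype Z] [DecidableEq Z]

/-- Orbits have at most `|G|` points, so there are at least `k` of them. Such a tuple is the point
with trivial stabilizer that the commutant theorem needs. -/
theorem exists_orb_injective [DecidableEq (MulAction.orbitRel.Quotient G Z)]
    (h : k * Fintype.card G ≤ Fintype.card Z) (hG : 0 < Fintype.card G) :
    ∃ z : Fin k → Z, Function.Injective fun i => orb G (z i) := by
  classical
  have : Fintype (MulAction.orbitRel.Quotient G Z) := Quotient.fintype _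
  have hs : Function.Surjective
      (fun p : G × MulAction.orbitRel.Quotient G Z => p.1 • p.2.out) := fun z => by
    have : orb G z = orb G (orb G z).out := (Quotient.out_eq _).symm
    obtain ⟨g, hg⟩ := orb_eq_iff.mp this
    exact ⟨(g, orb G z), hg⟩
  have h1 := Fintype.card_le_of_surjective _ hs
  rw [Fintype.card_prod] at h1
  have h2 : k ≤ Fintype.card (MulAction.orbitRel.Quotient G Z) := by
    by_contra hk
    push Not at hk
    have := Nat.mul_lt_mul_of_pos_right hk hG
    linarith [mul_comm (Fintype.card G) (Fintype.card (MulAction.orbitRel.Quotient G Z))]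
  obtain ⟨e⟩ := Function.Embedding.nonempty_of_card_le
    (α := Fin k) (β := MulAction.orbitRel.Quotient G Z) (by simpa using h2)
  refine ⟨fun i => (e i).out, fun i j hij => e.injective ?_⟩
  have h3 : ∀ i, orb G (e i).out = e i := fun i => Quotient.out_eq _
  simpa only [h3] using hij

theorem card_orb_fiber_le [DecidableEq (MulAction.orbitRel.Quotient G Z)] (y : Z) :
    (Finset.univ.filter fun z : Z => orb G z = orb G y).card ≤ Fintype.card G := by
  classical
  refine (Finset.card_le_card (t := Finset.univ.image fun g : G => g • y) fun z hz => ?_).trans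
    Finset.card_image_le
  obtain ⟨g, hg⟩ := orb_eq_iff.mp (Finset.mem_filter.mp hz).2
  exact Finset.mem_image.mpr ⟨g, Finset.mem_univ _, hg⟩

/-- The number of points of `Z^k` with coinciding orbits, by the union bound. -/
theorem card_not_orb_injective_le [DecidableEq (MulAction.orbitRel.Quotient G Z)] (k : ℕ) :
    2 * ((Finset.univ.filter fun z : Fin k → Z =>
        ¬ Function.Injective fun i => orb G (z i)).card : ℝ) * Fintype.card Z ≤
      k * (k - 1) * Fintype.card G * (Fintype.card Z : ℝ) ^ k := by
  classical
  induction k with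
  | zero =>
    have : (Finset.univ.filter fun z : Fin 0 → Z =>
        ¬ Function.Injective fun i => orb G (z i)) = ∅ := by
      refine Finset.filter_eq_empty_iff.mpr fun z _ => ?_
      rw [not_not]; exact Function.injective_of_subsingleton _
    rw [this]; simp
  | succ k ih =>
    set D : ℝ := ((Fintype.card Z : ℕ) : ℝ) with hD
    set Γ : ℝ := ((Fintype.card G : ℕ) : ℝ) with hΓ
    set B := (Finset.univ.filter fun z : Fin k → Z =>
        ¬ Function.Injective fun i => orb G (z i)).card with hB
    -- A tuple with one more coordinate is bad only if the old tuple was bad or the new point falls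
    -- into one of the `k` old orbits, each of at most `|G|` points.
    have key : (Finset.univ.filter fun z : Fin (k + 1) → Z =>
        ¬ Function.Injective fun i => orb G (z i)).card ≤
        B * Fintype.card Z + Fintype.card Z ^ k * (k * Fintype.card G) := by
      rw [Finset.card_filter, ← Equiv.sum_comp (Fin.consEquiv fun _ => Z),
        Fintype.sum_prod_type_right]
      have h1 : ∀ z' : Fin k → Z, (∑ z₀ : Z, if ¬ Function.Injective fun i =>
            orb G (Fin.consEquiv (fun _ => Z) (z₀, z') i) then 1 else 0) ≤
          (if ¬ Function.Injective fun i => orb G (z' i) then 1 else 0) * Fintype.card Z +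
            k * Fintype.card G := fun z' => by
        by_cases hz : Function.Injective fun i => orb G (z' i)
        · have h2 : ∀ z₀ : Z, (if ¬ Function.Injective fun i =>
              orb G (Fin.consEquiv (fun _ => Z) (z₀, z') i) then 1 else 0) ≤
              ∑ i, if orb G z₀ = orb G (z' i) then 1 else 0 := fun z₀ => by
            by_cases h : Function.Injective fun i =>
                orb G (Fin.consEquiv (fun _ => Z) (z₀, z') i)
            · rw [if_neg (not_not.mpr h)]; exact Nat.zero_le _
            · rw [if_pos h]
              by_contra hlt
              have h0 : ∀ i, orb G z₀ ≠ orb G (z' i) := fun i hi => hlt <| by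
                calc 1 = (if orb G z₀ = orb G (z' i) then 1 else 0) := by rw [if_pos hi]
                  _ ≤ _ := Finset.single_le_sum
                    (f := fun i => if orb G z₀ = orb G (z' i) then 1 else 0)
                    (fun _ _ => Nat.zero_le _) (Finset.mem_univ i)
              apply h
              have : (fun i => orb G (Fin.consEquiv (fun _ => Z) (z₀, z') i)) =
                  Fin.cons (orb G z₀) (fun i => orb G (z' i)) := by
                funext i
                refine Fin.cases ?_ (fun j => ?_) i <;> simp [Fin.consEquiv]
              rw [this, Fin.cons_injective_iff]
              exact ⟨fun ⟨i, hi⟩ => h0 i hi.symm, hz⟩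
          refine (Finset.sum_le_sum fun z₀ _ => h2 z₀).trans ?_
          rw [Finset.sum_comm]
          simp only [← Finset.card_filter]
          refine (Finset.sum_le_sum fun i _ => card_orb_fiber_le (G := G) (z' i)).trans ?_
          simp
        · rw [if_pos hz, one_mul]
          refine le_trans ?_ (Nat.le_add_right _ _)
          rw [← Finset.card_filter]
          exact Finset.card_le_univ _
      refine (Finset.sum_le_sum fun z' _ => h1 z').trans ?_
      rw [Finset.sum_add_distrib, ← Finset.sum_mul, ← Finset.card_filter]
      refine le_of_eq (congrArg₂ _ (congrArg₂ _ ?_ rfl) ?_)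
      · rw [hB]
      · simp
    have key' : ((Finset.univ.filter fun z : Fin (k + 1) → Z =>
        ¬ Function.Injective fun i => orb G (z i)).card : ℝ) ≤ B * D + D ^ k * (k * Γ) := by
      exact (Nat.cast_le.mpr key).trans (le_of_eq (by push_cast; rfl))
    have hD0 : 0 ≤ D := Nat.cast_nonneg _
    have h5 := mul_le_mul_of_nonneg_right key' hD0
    have h6 := mul_le_mul_of_nonneg_right ih hD0
    push_cast
    rw [pow_succ]
    nlinarith [h5, h6]

/-- Recursive bound of the orders of the stabilizers in the symmetric group. -/
theorem sum_prod_factorial_le [Fintype (MulAction.orbitRel.Quotient G Z)]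
    [DecidableEq (MulAction.orbitRel.Quotient G Z)] (k : ℕ) :
    ∑ z : Fin k → Z, ∏ c : MulAction.orbitRel.Quotient G Z,
        (Finset.univ.filter fun a => orb G (z a) = c).card.factorial ≤
      ∏ j ∈ Finset.range k, (Fintype.card Z + j * Fintype.card G) := by
  classical
  induction k with
  | zero => simp
  | succ k ih =>
    rw [← Equiv.sum_comp (Fin.consEquiv fun _ => Z), Fintype.sum_prod_type_right,
      Finset.prod_range_succ]
    refine le_trans (Finset.sum_le_sum (g := fun z' => (∏ c : MulAction.orbitRel.Quotient G Z,
        (Finset.univ.filter fun a => orb G (z' a) = c).card.factorial) *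
          (Fintype.card Z + k * Fintype.card G)) fun z' _ => ?_) ?_
    · have h1 : ∀ z₀ : Z, (∏ c : MulAction.orbitRel.Quotient G Z, (Finset.univ.filter fun a =>
          orb G (Fin.consEquiv (fun _ => Z) (z₀, z') a) = c).card.factorial) =
          (∏ c : MulAction.orbitRel.Quotient G Z,
            (Finset.univ.filter fun a => orb G (z' a) = c).card.factorial) *
          ((Finset.univ.filter fun a => orb G (z' a) = orb G z₀).card + 1) := fun z₀ => by
        have h2 : ∀ c : MulAction.orbitRel.Quotient G Z, (Finset.univ.filter fun a =>
            orb G (Fin.consEquiv (fun _ => Z) (z₀, z') a) = c).card.factorial =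
            (Finset.univ.filter fun a => orb G (z' a) = c).card.factorial *
              if orb G z₀ = c then (Finset.univ.filter fun a => orb G (z' a) = c).card + 1
                else 1 := fun c => by
          rw [Fin.card_filter_univ_succ]
          have e0 : Fin.consEquiv (fun _ => Z) (z₀, z') 0 = z₀ := rfl
          have e1 : ∀ i : Fin k, Fin.consEquiv (fun _ => Z) (z₀, z') i.succ = z' i :=
            fun i => rfl
          simp only [e0, e1]
          split_ifs with h
          · rw [Nat.factorial_succ, mul_comm]
          · rw [mul_one]
        simp only [h2, Finset.prod_mul_distrib, Finset.prod_ite_eq, Finset.mem_univ, if_true]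
      simp only [h1]
      rw [← Finset.mul_sum]
      refine Nat.mul_le_mul_left _ ?_
      rw [Finset.sum_add_distrib, Finset.sum_const, smul_eq_mul, mul_one, Finset.card_univ,
        add_comm]
      refine Nat.add_le_add_left ?_ _
      simp only [Finset.card_filter]
      rw [Finset.sum_comm]
      simp only [← Finset.card_filter]
      simp only [eq_comm (a := orb G (z' _))]
      refine (Finset.sum_le_sum fun i _ => card_orb_fiber_le (G := G) (z' i)).trans ?_
      simp
    · rw [← Finset.sum_mul]
      exact Nat.mul_le_mul_right _ ih

/-- Double counting turns the left side into a sum of stabilizer orders. By freeness a stabilizing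
element is determined by its permutation, which preserves the partition of the coordinates into
orbits; hence the product of factorials. -/
theorem sum_card_wreath_fixed_le (hfree : ∀ (g : G) (z : Z), g • z = z → g = 1) (k : ℕ) :
    ∑ w : Wreath G k, (Finset.univ.filter fun z : Fin k → Z => wreathSMul w z = z).card ≤
      ∏ j ∈ Finset.range k, (Fintype.card Z + j * Fintype.card G) := by
  classical
  have : Fintype (MulAction.orbitRel.Quotient G Z) := Quotient.fintype _
  refine le_trans ?_ (sum_prod_factorial_le (G := G) (Z := Z) k)
  have hcard : ∀ w : Wreath G k, (Finset.univ.filter fun z : Fin k → Z =>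
      wreathSMul w z = z).card = ∑ z : Fin k → Z, if wreathSMul w z = z then 1 else 0 :=
    fun w => Finset.card_filter _ _
  simp only [hcard]
  rw [Finset.sum_comm]
  refine Finset.sum_le_sum fun z _ => ?_
  rw [← Finset.card_filter]
  have h := DomMulAct.stabilizer_card (fun a => orb G (z a))
  simp only [Fintype.card_subtype] at h
  rw [← h]
  refine Finset.card_le_card_of_injOn (fun w => w.right⁻¹) (fun w hw => ?_) ?_
  · have hw' : wreathSMul w z = z := by simpa using hw
    simp only [Finset.coe_filter, Finset.mem_univ, true_and, Set.mem_ofPred_eq]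
    funext i
    exact (orb_eq_iff.mpr ⟨w.left i, congrFun hw' i⟩).symm
  · intro v hv w hw hvw
    have hv' : wreathSMul v z = z := by simpa using hv
    have hw' : wreathSMul w z = z := by simpa using hw
    have hr : v.right = w.right := by simpa using hvw
    refine SemidirectProduct.ext (funext fun i => ?_) hr
    have h1 : v.left i • z (v.right⁻¹ i) = z i := congrFun hv' i
    have h2 : w.left i • z (w.right⁻¹ i) = z i := congrFun hw' i
    rw [← hr] at h2
    have h3 := hfree ((w.left i)⁻¹ * v.left i) (z (v.right⁻¹ i)) (by
      rw [mul_smul, h1, inv_smul_eq_iff, h2])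
    exact (inv_mul_eq_one.mp h3).symm

end Counting

/-! ### Positivity of sums over a group -/

section GroupSums

variable {N : Type*} [Group N] {Y : Type*} [Fintype Y] [DecidableEq Y]

/-- The sum of a unitary representation over a finite subgroup is positive. -/
theorem posSemidef_sum_subgroup [Fintype N] {W : N →* Matrix Y Y ℂ} (hW : ∀ w, (W w)ᴴ = W w⁻¹)
    (H : Subgroup N) [DecidablePred (· ∈ H)] :
    (∑ w ∈ Finset.univ.filter (· ∈ H), W w).PosSemidef := by
  set S := ∑ w ∈ Finset.univ.filter (· ∈ H), W w with hS
  have h1 : Sᴴ = S := by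
    rw [hS, conjTranspose_sum]
    refine Finset.sum_bij (fun w _ => w⁻¹) (fun w hw => ?_) (fun _ _ _ _ h => inv_injective h)
      (fun w hw => ⟨w⁻¹, ?_, inv_inv w⟩) (fun w _ => hW w)
    · simpa using hw
    · simpa using hw
  have h2 : ∀ v ∈ H, W v * S = S := fun v hv => by
    rw [hS, Finset.mul_sum]
    refine Finset.sum_bij (fun w _ => v * w) (fun w hw => ?_)
      (fun _ _ _ _ h => mul_left_cancel h) (fun w hw => ⟨v⁻¹ * w, ?_, mul_inv_cancel_left v w⟩)
      (fun w _ => (map_mul W v w).symm)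
    · simp only [Finset.mem_filter, Finset.mem_univ, true_and] at hw ⊢
      exact H.mul_mem hv hw
    · simp only [Finset.mem_filter, Finset.mem_univ, true_and] at hw ⊢
      exact H.mul_mem (H.inv_mem hv) hw
  set c := (Finset.univ.filter (· ∈ H)).card with hc
  have hc0 : 0 < c := Finset.card_pos.mpr ⟨1, by simp [H.one_mem]⟩
  -- `S` is `c` times the projection onto the invariant vectors of the subgroup.
  have h3 : Sᴴ * S = (c : ℂ) • S := by
    rw [h1]
    conv_lhs => enter [1]; rw [hS]
    rw [Finset.sum_mul, Finset.sum_congr rfl fun v hv => h2 v (Finset.mem_filter.mp hv).2,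
      Finset.sum_const, Nat.cast_smul_eq_nsmul]
  have h4 : S = ((c : ℝ)⁻¹ : ℝ) • (Sᴴ * S) := by
    rw [h3, ← Complex.coe_smul, smul_smul]
    have : (((c : ℝ)⁻¹ : ℝ) : ℂ) * (c : ℂ) = 1 := by
      rw [Complex.ofReal_inv, Complex.ofReal_natCast,
        inv_mul_cancel₀ (Nat.cast_ne_zero.mpr hc0.ne')]
    rw [this, one_smul]
  rw [h4]
  exact (posSemidef_conjTranspose_mul_self S).smul (inv_nonneg.mpr (Nat.cast_nonneg _))

/-- Symmetrizing under `w ↦ w⁻¹` turns each pair of terms into a square: `(1 + s W_w)†(1 + s W_w) =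
(1 + s W_w) + (1 + s W_{w⁻¹})` for `s = ±1`. -/
theorem posSemidef_sum_one_add_smul [Fintype N] {W : N →* Matrix Y Y ℂ}
    (hW : ∀ w, (W w)ᴴ = W w⁻¹) {f : N → ℝ} (hf : ∀ w, 0 ≤ f w) (hinv : ∀ w, f w⁻¹ = f w)
    {s : ℝ} (hs : s = 1 ∨ s = -1) :
    (∑ w, f w • ((1 : Matrix Y Y ℂ) + s • W w)).PosSemidef := by
  have hss : s * s = 1 := by rcases hs with rfl | rfl <;> norm_num
  have h1 : ∀ w, (1 + s • W w)ᴴ * (1 + s • W w) = (1 + s • W w) + (1 + s • W w⁻¹) := fun w => by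
    have h2 : W w⁻¹ * W w = 1 := by rw [← map_mul, inv_mul_cancel, map_one]
    rw [conjTranspose_add, conjTranspose_smul, conjTranspose_one, hW, star_trivial,
      Matrix.add_mul, Matrix.mul_add, Matrix.mul_add]
    simp only [Matrix.smul_mul, Matrix.mul_smul, h2, smul_smul, hss, Matrix.one_mul,
      Matrix.mul_one, one_smul]
    abel
  have h2 : (∑ w, f w • ((1 : Matrix Y Y ℂ) + s • W w)) =
      ∑ w, (f w / 2) • ((1 + s • W w)ᴴ * (1 + s • W w)) := by
    simp only [h1, smul_add (_ / 2 : ℝ) (_ + _) (_ + _), Finset.sum_add_distrib]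
    have h3 : ∑ w, (f w / 2) • ((1 : Matrix Y Y ℂ) + s • W w⁻¹) =
        ∑ w, (f w / 2) • ((1 : Matrix Y Y ℂ) + s • W w) := by
      rw [← Equiv.sum_comp (Equiv.inv N)]
      simp [hinv]
    rw [h3, ← Finset.sum_add_distrib]
    refine Finset.sum_congr rfl fun w _ => ?_
    rw [← add_smul, add_halves]
  rw [h2]
  exact posSemidef_sum _ fun w _ =>
    (posSemidef_conjTranspose_mul_self _).smul (div_nonneg (hf w) two_pos.le)

end GroupSums

/-! ### Free permutation representations and their normalized character -/

section FreePermRep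

variable {G : Type*} [Group G] {X : Type*} [Fintype X] [DecidableEq X]

/-- A unitary representation that is, in some orthonormal basis, the permutation representation
of a free action. -/
def IsFreePermRep (ρ : G →* Matrix X X ℂ) : Prop :=
  ∃ (Z : Type w) (_ : Fintype Z) (_ : DecidableEq Z) (_ : MulAction G Z) (T : Matrix X Z ℂ),
    T * Tᴴ = 1 ∧ Tᴴ * T = 1 ∧ (∀ (g : G) (z : Z), g • z = z → g = 1) ∧
      ∀ g, ρ g = T * permRep G Z g * Tᴴ

variable {ρ : G →* Matrix X X ℂ}

theorem IsFreePermRep.conjTranspose (h : IsFreePermRep.{w} ρ) (g : G) : (ρ g)ᴴ = ρ g⁻¹ := by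
  obtain ⟨Z, _, _, _, T, -, -, -, hT⟩ := h
  rw [hT, hT, conjTranspose_mul, conjTranspose_mul, conjTranspose_conjTranspose,
    permRep_conjTranspose, Matrix.mul_assoc]

theorem card_eq_of_unitary {Z : Type*} [Fintype Z] [DecidableEq Z] {T : Matrix X Z ℂ}
    (h1 : T * Tᴴ = 1) (h2 : Tᴴ * T = 1) : Fintype.card X = Fintype.card Z := by
  have := Matrix.trace_mul_comm T Tᴴ
  rw [h1, h2, trace_one, trace_one] at this
  exact_mod_cast this

theorem twTensor_unitary {Z : Type*} [Fintype Z] {T : Matrix X Z ℂ}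
    (h1 : T * Tᴴ = 1) (k : ℕ) :
    twTensor (fun _ : Fin k => T) 1 * (twTensor (fun _ : Fin k => T) 1)ᴴ = 1 := by
  rw [twTensor_conjTranspose, twTensor_mul]
  simp [h1, twTensor_one]

theorem twTensor_unitary' {Z : Type*} [Fintype Z] [DecidableEq Z] {T : Matrix X Z ℂ}
    (h2 : Tᴴ * T = 1) (k : ℕ) :
    (twTensor (fun _ : Fin k => T) 1)ᴴ * twTensor (fun _ : Fin k => T) 1 = 1 := by
  rw [twTensor_conjTranspose, twTensor_mul]
  simp [h2, twTensor_one]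

variable [Fintype G] {k : ℕ}

theorem IsFreePermRep.mem_span_of_commute (h : IsFreePermRep.{w} ρ)
    (hk : k * Fintype.card G ≤ Fintype.card X) {M : Matrix (Fin k → X) (Fin k → X) ℂ}
    (hM : ∀ U ∈ unitaryGroup X ℂ, (∀ g, U * ρ g = ρ g * U) →
      M * tensorPow k U = tensorPow k U * M) :
    ∃ c : Wreath G k → ℂ, M = ∑ w, c w • wreathRep k ρ w := by
  classical
  have hρ : ∀ g, ∃ g', (ρ g)ᴴ = ρ g' := fun g => ⟨g⁻¹, h.conjTranspose g⟩
  obtain ⟨Z, _, _, _, T, h1, h2, hfree, hT⟩ := h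
  rw [card_eq_of_unitary h1 h2] at hk
  obtain ⟨z₀, hz₀⟩ := exists_orb_injective hk Fintype.card_pos
  set V : Matrix (Fin k → X) (Fin k → Z) ℂ := twTensor (fun _ : Fin k => T) 1 with hV
  have hV1 : V * Vᴴ = 1 := twTensor_unitary h1 k
  have hV2 : Vᴴ * V = 1 := twTensor_unitary' h2 k
  have hTρ : ∀ g, ρ g * T = T * permRep G Z g := fun g => by
    rw [hT, Matrix.mul_assoc, h2, Matrix.mul_one]
  have hTρ' : ∀ g, Tᴴ * ρ g = permRep G Z g * Tᴴ := fun g => by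
    rw [hT, ← Matrix.mul_assoc, ← Matrix.mul_assoc, h2, Matrix.one_mul]
  have key := mem_span_of_commute_permRep (G := G) (z₀ := z₀)
    (fun w hw => eq_one_of_wreathSMul_eq hfree hz₀ hw) (M := Vᴴ * M * V) (fun b hb => by
      have hb' : ∀ g, (T * b * Tᴴ) * ρ g = ρ g * (T * b * Tᴴ) := fun g => by
        rw [Matrix.mul_assoc, hTρ', ← Matrix.mul_assoc, Matrix.mul_assoc T b, hb,
          ← Matrix.mul_assoc, ← hTρ, Matrix.mul_assoc, Matrix.mul_assoc, Matrix.mul_assoc]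
      have h3 := commute_tensorPow_of_unitary hρ hM hb'
      have h4 : tensorPow k (T * b * Tᴴ) = V * tensorPow k b * Vᴴ := by
        rw [hV, tensorPow_eq_twTensor, tensorPow_eq_twTensor, twTensor_conjTranspose,
          twTensor_mul, twTensor_mul]
        simp
      rw [h4] at h3
      calc Vᴴ * M * V * tensorPow k b
          = Vᴴ * (M * (V * tensorPow k b * Vᴴ)) * V := by
            simp only [Matrix.mul_assoc, hV2, Matrix.mul_one]
        _ = (Vᴴ * V) * tensorPow k b * (Vᴴ * M * V) := by
            rw [h3]; simp only [Matrix.mul_assoc]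
        _ = _ := by rw [hV2, Matrix.one_mul])
  obtain ⟨c, hc⟩ : ∃ c : Wreath G k → ℂ, Vᴴ * M * V =
      ∑ w, c w • wreathRep k (permRep G Z) w := ⟨_, key⟩
  refine ⟨c, ?_⟩
  calc M = V * (Vᴴ * M * V) * Vᴴ := by
        simp only [Matrix.mul_assoc, hV1, Matrix.mul_one]
        rw [← Matrix.mul_assoc, hV1, Matrix.one_mul]
    _ = _ := by
        rw [hc]
        rw [Matrix.mul_sum, Matrix.sum_mul]
        refine Finset.sum_congr rfl fun w _ => ?_
        rw [Matrix.mul_smul, Matrix.smul_mul, ← wreathRep_intertwine hTρ w, Matrix.mul_assoc,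
          ← hV, hV1, Matrix.mul_one]

/-- The normalized character of the wreath product on the `k`-th tensor power. -/
noncomputable def wreathChar (k : ℕ) (ρ : G →* Matrix X X ℂ) (w : Wreath G k) : ℝ :=
  (trace (wreathRep k ρ w)).re / (Fintype.card X : ℝ) ^ k

-- The trace does not depend on the basis, and a permutation matrix has as many ones on its diagonal
-- as fixed points. This turns all estimates of characters into counting.
omit [Fintype G] in
theorem trace_wreathRep_eq {Z : Type*} [Fintype Z] [DecidableEq Z] [MulAction G Z]
    {T : Matrix X Z ℂ} (h1 : T * Tᴴ = 1) (h2 : Tᴴ * T = 1)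
    (hT : ∀ g, ρ g = T * permRep G Z g * Tᴴ) (w : Wreath G k) :
    trace (wreathRep k ρ w) =
      ((Finset.univ.filter fun z : Fin k → Z => wreathSMul w z = z).card : ℂ) := by
  have hTρ : ∀ g, ρ g * T = T * permRep G Z g := fun g => by
    rw [hT, Matrix.mul_assoc, h2, Matrix.mul_one]
  calc trace (wreathRep k ρ w)
      = trace (wreathRep k ρ w *
          (twTensor (fun _ : Fin k => T) 1 * (twTensor (fun _ : Fin k => T) 1)ᴴ)) := by
        rw [twTensor_unitary h1, Matrix.mul_one]
    _ = trace (wreathRep k (permRep G Z) w) := by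
        rw [← Matrix.mul_assoc, wreathRep_intertwine hTρ, Matrix.trace_mul_comm,
          ← Matrix.mul_assoc, twTensor_unitary' h2, Matrix.one_mul]
    _ = _ := by
        simp only [trace, diag_apply, wreathRep_permRep_apply, Finset.sum_boole, eq_comm]

theorem IsFreePermRep.trace_wreathRep [Nonempty X] (h : IsFreePermRep.{w} ρ) (w : Wreath G k) :
    trace (wreathRep k ρ w) = ((Fintype.card X : ℝ) ^ k * wreathChar k ρ w : ℝ) := by
  obtain ⟨Z, _, _, _, T, h1, h2, hfree, hT⟩ := h
  have hD : (Fintype.card X : ℝ) ^ k ≠ 0 :=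
    pow_ne_zero _ (Nat.cast_ne_zero.mpr Fintype.card_ne_zero)
  rw [wreathChar, mul_div_cancel₀ _ hD, trace_wreathRep_eq h1 h2 hT]
  simp

theorem IsFreePermRep.wreathChar_nonneg (h : IsFreePermRep.{w} ρ) (w : Wreath G k) :
    0 ≤ wreathChar k ρ w := by
  obtain ⟨Z, _, _, _, T, h1, h2, hfree, hT⟩ := h
  rw [wreathChar, trace_wreathRep_eq h1 h2 hT, Complex.natCast_re]
  positivity

omit [Fintype G] in
theorem wreathChar_one [Nonempty X] : wreathChar k ρ 1 = 1 := by
  have hD : (Fintype.card X : ℝ) ^ k ≠ 0 :=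
    pow_ne_zero _ (Nat.cast_ne_zero.mpr Fintype.card_ne_zero)
  rw [wreathChar, map_one, trace_one, Complex.natCast_re, Fintype.card_fun, Fintype.card_fin,
    Nat.cast_pow, div_self hD]

omit [Fintype G] in
theorem wreathChar_conj (v w : Wreath G k) :
    wreathChar k ρ (v * w * v⁻¹) = wreathChar k ρ w := by
  rw [wreathChar, wreathChar, map_mul, Matrix.trace_mul_comm, ← map_mul, ← mul_assoc,
    inv_mul_cancel, one_mul]

omit [Fintype G] in
theorem IsFreePermRep.wreathChar_inv (h : IsFreePermRep.{w} ρ) (w : Wreath G k) :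
    wreathChar k ρ w⁻¹ = wreathChar k ρ w := by
  rw [wreathChar, wreathChar, ← wreathRep_conjTranspose h.conjTranspose, trace_conjTranspose,
    Complex.star_def, Complex.conj_re]

theorem prod_add_le_exp {D Γ : ℝ} (hD : 0 < D) (hΓ : 0 ≤ Γ) (k : ℕ) :
    (∏ j ∈ Finset.range k, (D + j * Γ)) / D ^ k ≤ Real.exp (k * (k - 1) * Γ / (2 * D)) := by
  induction k with
  | zero => simp
  | succ k ih =>
    rw [Finset.prod_range_succ, pow_succ, mul_div_mul_comm]
    have h1 : (D + k * Γ) / D ≤ Real.exp (k * Γ / D) := by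
      rw [add_div, div_self hD.ne', add_comm]
      exact Real.add_one_le_exp _
    refine (mul_le_mul ih h1 (by positivity) (Real.exp_pos _).le).trans ?_
    rw [← Real.exp_add]
    refine le_of_eq (congrArg _ ?_)
    push_cast
    field_simp
    ring

theorem IsFreePermRep.sum_wreathChar_le [Nonempty X] (h : IsFreePermRep.{w} ρ) (k : ℕ) :
    ∑ w, wreathChar k ρ w ≤
      Real.exp ((k : ℝ) * (k - 1) * Fintype.card G / (2 * Fintype.card X)) := by
  obtain ⟨Z, _, _, _, T, h1, h2, hfree, hT⟩ := h
  refine le_trans ?_ (prod_add_le_exp (D := Fintype.card X) (Γ := Fintype.card G)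
    (Nat.cast_pos.mpr Fintype.card_pos) (Nat.cast_nonneg _) k)
  simp only [wreathChar, trace_wreathRep_eq h1 h2 hT, Complex.natCast_re]
  rw [← Finset.sum_div]
  refine div_le_div_of_nonneg_right ?_ (by positivity)
  rw [card_eq_of_unitary h1 h2]
  exact_mod_cast sum_card_wreath_fixed_le hfree k

/-- The normalized sum of `tr(W_w) W_w` over the wreath product is bounded below. -/
theorem IsFreePermRep.posSemidef_sum_wreathChar_sub [Nonempty X] (h : IsFreePermRep.{w} ρ)
    (k : ℕ) :
    ((∑ w, wreathChar k ρ w • wreathRep k ρ w) -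
      (1 - (k : ℝ) * (k - 1) * Fintype.card G / (2 * Fintype.card X)) •
        (1 : Matrix (Fin k → X) (Fin k → X) ℂ)).PosSemidef := by
  classical
  have hct := fun w => wreathRep_conjTranspose (k := k) h.conjTranspose w
  obtain ⟨Z, _, _, _, T, h1, h2, hfree, hT⟩ := h
  have hcard := card_eq_of_unitary h1 h2
  set D : ℝ := ((Fintype.card X : ℕ) : ℝ) with hD
  have hD0 : 0 < D := Nat.cast_pos.mpr Fintype.card_pos
  have hDk : 0 < D ^ k := pow_pos hD0 k
  -- Exchanging sums, `∑_w tr(W_w) W_w` is the sum over all tuples of the stabilizer sums `F z`.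
  -- Each is positive, and it is `1` when the coordinates lie in distinct orbits, so the lower bound
  -- loses only the proportion of colliding tuples.
  let F : (Fin k → Z) → Matrix (Fin k → X) (Fin k → X) ℂ := fun z =>
    ∑ w ∈ Finset.univ.filter (· ∈ wreathStab G z), wreathRep k ρ w
  have hF : ∀ z, (F z).PosSemidef := fun z => posSemidef_sum_subgroup hct _
  have hF1 : ∀ z : Fin k → Z, (Function.Injective fun i => orb G (z i)) → F z = 1 := fun z hz => by
    have : (Finset.univ.filter (· ∈ wreathStab G z)) = {1} := by
      ext w
      simp only [Finset.mem_filter, Finset.mem_univ, true_and, Finset.mem_singleton]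
      exact ⟨fun hw => eq_one_of_wreathSMul_eq hfree hz hw, fun hw => hw ▸ one_mem _⟩
    simp only [F, this, Finset.sum_singleton, map_one]
  have hsum : (∑ w, wreathChar k ρ w • wreathRep k ρ w) = (D ^ k)⁻¹ • ∑ z, F z := by
    simp only [F, Finset.sum_filter]
    rw [Finset.sum_comm, Finset.smul_sum]
    refine Finset.sum_congr rfl fun w _ => ?_
    rw [← Finset.sum_filter, Finset.sum_const, ← Nat.cast_smul_eq_nsmul ℝ, smul_smul, wreathChar,
      trace_wreathRep_eq h1 h2 hT, Complex.natCast_re, div_eq_inv_mul]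
    congr! 4
    ext z
    simp [mem_wreathStab]
  set P : (Fin k → Z) → Prop := fun z => Function.Injective fun i => orb G (z i) with hP
  set B := (Finset.univ.filter fun z => ¬ P z).card with hB
  have hBle : 2 * (B : ℝ) * D ≤ k * (k - 1) * Fintype.card G * D ^ k := by
    rw [hD, hcard]
    convert card_not_orb_injective_le (G := G) (Z := Z) k
  have hgood : ((Finset.univ.filter P).card : ℝ) = D ^ k - B := by
    have := Finset.card_filter_add_card_filter_not (s := (Finset.univ : Finset (Fin k → Z))) P
    rw [Finset.card_univ, Fintype.card_fun, Fintype.card_fin, ← hcard] at this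
    rw [eq_sub_iff_add_eq, hD]
    exact_mod_cast this
  have hsplit : ∑ z, F z = (D ^ k - B) • (1 : Matrix (Fin k → X) (Fin k → X) ℂ) +
      ∑ z ∈ Finset.univ.filter (fun z => ¬ P z), F z := by
    rw [← Finset.sum_filter_add_sum_filter_not Finset.univ P]
    congr 1
    rw [Finset.sum_congr rfl fun z hz => hF1 z (Finset.mem_filter.mp hz).2, Finset.sum_const,
      ← Nat.cast_smul_eq_nsmul ℝ, hgood]
  have hfinal : (∑ w, wreathChar k ρ w • wreathRep k ρ w) -
      (1 - (k : ℝ) * (k - 1) * Fintype.card G / (2 * D)) •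
        (1 : Matrix (Fin k → X) (Fin k → X) ℂ) =
      ((k : ℝ) * (k - 1) * Fintype.card G / (2 * D) - (D ^ k)⁻¹ * B) •
        (1 : Matrix (Fin k → X) (Fin k → X) ℂ) +
      (D ^ k)⁻¹ • ∑ z ∈ Finset.univ.filter (fun z => ¬ P z), F z := by
    rw [hsum, hsplit, smul_add, smul_smul, mul_sub, inv_mul_cancel₀ hDk.ne']
    module
  rw [hfinal]
  refine (PosSemidef.one.smul ?_).add ((posSemidef_sum _ fun z _ => hF z).smul (by positivity))
  rw [sub_nonneg, inv_mul_le_iff₀ hDk, ← mul_div_assoc, le_div_iff₀ (by positivity)]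
  linarith

end FreePermRep

/-! ### Completely positive maps and their order -/

section Maps

variable {Y : Type v} [Fintype Y] {Z : Type*} [Fintype Z]

/-- The map `Φ ⊗ id`. -/
def ampMap {Y : Type*} (Z : Type*) (Φ : Matrix Y Y ℂ → Matrix Y Y ℂ) :
    Matrix (Y × Z) (Y × Z) ℂ → Matrix (Y × Z) (Y × Z) ℂ :=
  fun M => Matrix.of fun a b => Φ (Matrix.of fun x y => M (x, a.2) (y, b.2)) a.1 b.1

/-- A map, transported along a bijection of the basis labels. -/
def conjMap {Y Y' : Type*} (e : Y' ≃ Y) (Φ : Matrix Y Y ℂ → Matrix Y Y ℂ) :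
    Matrix Y' Y' ℂ → Matrix Y' Y' ℂ :=
  fun M => (Φ (M.submatrix e.symm e.symm)).submatrix e e

/-- The linear map with a given Choi matrix. -/
def kernelMap (C : Matrix (Y × Y) (Y × Y) ℂ) : Matrix Y Y ℂ → Matrix Y Y ℂ :=
  fun A => Matrix.of fun x x' => ∑ y, ∑ y', C (x, y) (x', y') * A y y'

theorem IsCompletelyPositive.posSemidef_ampMap {Φ : Matrix Y Y ℂ → Matrix Y Y ℂ}
    (h : IsCompletelyPositive Φ) {M : Matrix (Y × Z) (Y × Z) ℂ} (hM : M.PosSemidef) :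
    (ampMap Z Φ M).PosSemidef := by
  let e := Fintype.equivFin Z
  let e' : Y × Z → Y × Fin (Fintype.card Z) := Prod.map id e
  let f' : Y × Fin (Fintype.card Z) → Y × Z := Prod.map id e.symm
  have h1 := h.2 _ (M.submatrix f' f') (hM.submatrix f')
  have h2 := h1.submatrix e'
  convert h2 using 1
  ext a b
  simp [ampMap, e', f']

theorem IsCompletelyPositive.comp {Φ Ψ : Matrix Y Y ℂ → Matrix Y Y ℂ}
    (hΦ : IsCompletelyPositive Φ) (hΨ : IsCompletelyPositive Ψ) :
    IsCompletelyPositive fun A => Φ (Ψ A) :=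
  ⟨(IsLinearMap.mk' Φ hΦ.1 ∘ₗ IsLinearMap.mk' Ψ hΨ.1).isLinear,
    fun r M hM => hΦ.2 r _ (hΨ.2 r M hM)⟩

theorem IsCompletelyPositive.add {Φ Ψ : Matrix Y Y ℂ → Matrix Y Y ℂ}
    (hΦ : IsCompletelyPositive Φ) (hΨ : IsCompletelyPositive Ψ) :
    IsCompletelyPositive fun A => Φ A + Ψ A :=
  ⟨(IsLinearMap.mk' Φ hΦ.1 + IsLinearMap.mk' Ψ hΨ.1).isLinear,
    fun r M hM => (hΦ.2 r M hM).add (hΨ.2 r M hM)⟩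

theorem IsCompletelyPositive.smul {Φ : Matrix Y Y ℂ → Matrix Y Y ℂ}
    (hΦ : IsCompletelyPositive Φ) {c : ℝ} (hc : 0 ≤ c) :
    IsCompletelyPositive fun A => (c : ℂ) • Φ A :=
  ⟨((c : ℂ) • IsLinearMap.mk' Φ hΦ.1).isLinear,
    fun r M hM => (hΦ.2 r M hM).smul (a := (c : ℂ)) (by exact_mod_cast hc)⟩

theorem isCompletelyPositive_zero :
    IsCompletelyPositive fun _ : Matrix Y Y ℂ => (0 : Matrix Y Y ℂ) :=
  ⟨(0 : Matrix Y Y ℂ →ₗ[ℂ] Matrix Y Y ℂ).isLinear, fun _ _ _ => PosSemidef.zero⟩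

theorem IsCompletelyPositive.ampMap {Φ : Matrix Y Y ℂ → Matrix Y Y ℂ}
    (hΦ : IsCompletelyPositive Φ) (Z : Type*) [Fintype Z] :
    IsCompletelyPositive (ampMap Z Φ) := by
  refine ⟨⟨fun A B => ?_, fun c A => ?_⟩, fun r M hM => ?_⟩
  · ext a b
    simp only [SymDesign.ampMap, Matrix.of_apply, Matrix.add_apply]
    rw [← Matrix.add_apply, ← hΦ.1.map_add]
    rfl
  · ext a b
    simp only [SymDesign.ampMap, Matrix.of_apply, Matrix.smul_apply]
    rw [← Matrix.smul_apply, ← hΦ.1.map_smul]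
    rfl
  · let e : Y × (Z × Fin r) → (Y × Z) × Fin r := fun p => ((p.1, p.2.1), p.2.2)
    let f : (Y × Z) × Fin r → Y × (Z × Fin r) := fun p => (p.1.1, (p.1.2, p.2))
    exact (hΦ.posSemidef_ampMap (hM.submatrix e)).submatrix f

theorem IsCompletelyPositive.conjMap {Y' : Type v'} [Fintype Y'] {Φ : Matrix Y Y ℂ → Matrix Y Y ℂ}
    (hΦ : IsCompletelyPositive Φ) (e : Y' ≃ Y) : IsCompletelyPositive (conjMap e Φ) := by
  refine ⟨⟨fun A B => ?_, fun c A => ?_⟩, fun r M hM => ?_⟩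
  · simp only [SymDesign.conjMap, Matrix.submatrix_add, Pi.add_apply, hΦ.1.map_add]
  · simp only [SymDesign.conjMap, Matrix.submatrix_smul, Pi.smul_apply, hΦ.1.map_smul]
  · exact (hΦ.2 r _ (hM.submatrix (Prod.map e.symm id))).submatrix (Prod.map e id)

/-- One direction of Choi's theorem: the amplified map sends `M` to a compression of the Hadamard
product of `C` and `M`, positive by Schur's product theorem. -/
theorem isCompletelyPositive_kernelMap {C : Matrix (Y × Y) (Y × Y) ℂ} (hC : C.PosSemidef) :
    IsCompletelyPositive (kernelMap C) := by
  classical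
  refine ⟨⟨fun A B => ?_, fun c A => ?_⟩, fun r M hM => ?_⟩
  · ext x x'
    simp [kernelMap, mul_add, Finset.sum_add_distrib]
  · ext x x'
    simp [kernelMap, mul_left_comm, Finset.mul_sum]
  · let N : Matrix (Y × Y × Fin r) (Y × Y × Fin r) ℂ :=
      (C.submatrix (fun p => (p.1, p.2.1)) (fun p => (p.1, p.2.1))).hadamard
        (M.submatrix (fun p => p.2) (fun p => p.2))
    have hN : N.PosSemidef := (hC.submatrix _).hadamard (hM.submatrix _)
    let B : Matrix (Y × Y × Fin r) (Y × Fin r) ℂ :=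
      Matrix.of fun p q => if p.1 = q.1 then (if p.2.2 = q.2 then 1 else 0) else 0
    have h := hN.conjTranspose_mul_mul_same B
    convert h using 1
    ext ⟨x, a⟩ ⟨x', b⟩
    simp only [kernelMap, Matrix.of_apply, Matrix.mul_apply, Fintype.sum_prod_type, B, N,
      conjTranspose_apply, apply_ite star, star_one, star_zero, ite_mul, one_mul, zero_mul,
      mul_ite, mul_one, mul_zero, Finset.sum_ite_eq', Finset.mem_univ, if_true,
      Matrix.hadamard_apply, Matrix.submatrix_apply, Finset.sum_ite_irrel, Finset.sum_const_zero]
    exact Finset.sum_comm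

theorem kernelMap_sub (C C' : Matrix (Y × Y) (Y × Y) ℂ) (A : Matrix Y Y ℂ) :
    kernelMap (C - C') A = kernelMap C A - kernelMap C' A := by
  ext x x'
  simp [kernelMap, sub_mul, Finset.sum_sub_distrib]

theorem kernelMap_smul (c : ℂ) (C : Matrix (Y × Y) (Y × Y) ℂ) (A : Matrix Y Y ℂ) :
    kernelMap (c • C) A = c • kernelMap C A := by
  ext x x'
  simp [kernelMap, mul_assoc, Finset.mul_sum]

theorem CPLE.refl (𝒜 : Matrix Y Y ℂ → Matrix Y Y ℂ) : CPLE 𝒜 𝒜 := by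
  unfold CPLE
  simp only [sub_self]
  exact isCompletelyPositive_zero

theorem CPLE.trans {𝒜 ℬ 𝒞 : Matrix Y Y ℂ → Matrix Y Y ℂ} (h : CPLE 𝒜 ℬ) (h' : CPLE ℬ 𝒞) :
    CPLE 𝒜 𝒞 := by
  have := IsCompletelyPositive.add h h'
  unfold CPLE
  convert this using 2 with M
  abel

theorem CPLE.smul {𝒜 ℬ : Matrix Y Y ℂ → Matrix Y Y ℂ} (h : CPLE 𝒜 ℬ) {c : ℝ} (hc : 0 ≤ c) :
    CPLE (fun A => (c : ℂ) • 𝒜 A) (fun A => (c : ℂ) • ℬ A) := by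
  have := IsCompletelyPositive.smul h hc
  unfold CPLE
  convert this using 2 with M
  rw [smul_sub]

theorem IsCompletelyPositive.cple_smul {Φ : Matrix Y Y ℂ → Matrix Y Y ℂ}
    (h : IsCompletelyPositive Φ) {c d : ℝ} (hcd : c ≤ d) :
    CPLE (fun A => (c : ℂ) • Φ A) (fun A => (d : ℂ) • Φ A) := by
  have := IsCompletelyPositive.smul h (sub_nonneg.mpr hcd)
  unfold CPLE
  convert this using 2 with M
  rw [← sub_smul, Complex.ofReal_sub]

/-- `𝒜'ℬ' - 𝒜ℬ = 𝒜'(ℬ' - ℬ) + (𝒜' - 𝒜)ℬ`, so complete positivity is needed only for `𝒜'` and `ℬ`. -/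
theorem CPLE.comp {𝒜 𝒜' ℬ ℬ' : Matrix Y Y ℂ → Matrix Y Y ℂ} (h : CPLE 𝒜 𝒜') (h' : CPLE ℬ ℬ')
    (hB : IsCompletelyPositive ℬ) (hA : IsCompletelyPositive 𝒜') :
    CPLE (fun M => 𝒜 (ℬ M)) (fun M => 𝒜' (ℬ' M)) := by
  have h1 := hA.comp h'
  have h2 := IsCompletelyPositive.comp h hB
  unfold CPLE
  convert h1.add h2 using 2 with M
  rw [hA.1.map_sub]
  abel

theorem CPLE.ampMap {𝒜 ℬ : Matrix Y Y ℂ → Matrix Y Y ℂ} (h : CPLE 𝒜 ℬ) (Z : Type*) [Fintype Z] :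
    CPLE (SymDesign.ampMap Z 𝒜) (SymDesign.ampMap Z ℬ) :=
  IsCompletelyPositive.ampMap h Z

theorem CPLE.conjMap {Y' : Type v'} [Fintype Y'] {𝒜 ℬ : Matrix Y Y ℂ → Matrix Y Y ℂ}
    (h : CPLE 𝒜 ℬ) (e : Y' ≃ Y) : CPLE (SymDesign.conjMap e 𝒜) (SymDesign.conjMap e ℬ) :=
  IsCompletelyPositive.conjMap h e

end Maps

/-! ### Twirls and their Choi matrices -/

section Twirl

variable {X : Type v} [Fintype X] {Ω : Type*} [MeasurableSpace Ω]

theorem norm_tensorPow_le [DecidableEq X] {k : ℕ} {U : Matrix X X ℂ} (hU : U ∈ unitaryGroup X ℂ)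
    (x y : Fin k → X) : ‖tensorPow k U x y‖ ≤ 1 := by
  rw [tensorPow, norm_prod]
  exact Finset.prod_le_one (fun _ _ => norm_nonneg _) fun _ _ => entry_norm_bound_of_unitary hU _ _

theorem measurable_tensorPow {k : ℕ} {U : Ω → Matrix X X ℂ}
    (hm : ∀ x y, Measurable fun ω => U ω x y)
    (x y : Fin k → X) : Measurable fun ω => tensorPow k (U ω) x y :=
  Finset.measurable_fun_prod _ fun _ _ => hm _ _

variable {P : Measure Ω} [IsProbabilityMeasure P] {U : Ω → Matrix X X ℂ}

theorem integrable_tensorPow_mul [DecidableEq X] (hm : ∀ x y, Measurable fun ω => U ω x y)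
    (hU : ∀ ω, U ω ∈ unitaryGroup X ℂ) (k : ℕ) (x y x' y' : Fin k → X) :
    Integrable (fun ω => tensorPow k (U ω) x y * star (tensorPow k (U ω) x' y')) P := by
  refine Integrable.of_bound (C := 1) ?_ (Filter.Eventually.of_forall fun ω => ?_)
  · exact ((measurable_tensorPow hm x y).mul
      (continuous_star.measurable.comp (measurable_tensorPow hm x' y'))).aestronglyMeasurable
  · rw [norm_mul, norm_star]
    exact mul_le_one₀ (norm_tensorPow_le (hU ω) _ _) (norm_nonneg _) (norm_tensorPow_le (hU ω) _ _)

/-- The Choi matrix of a twirl. -/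
noncomputable def twirlChoi (P : Measure Ω) (U : Ω → Matrix X X ℂ) (k : ℕ) :
    Matrix ((Fin k → X) × (Fin k → X)) ((Fin k → X) × (Fin k → X)) ℂ :=
  Matrix.of fun a b => ∫ ω, tensorPow k (U ω) a.1 a.2 * star (tensorPow k (U ω) b.1 b.2) ∂P

theorem conj_apply {Y : Type*} [Fintype Y] (T A : Matrix Y Y ℂ) (x y : Y) :
    (T * A * Tᴴ) x y = ∑ u, ∑ v, T x u * star (T y v) * A u v := by
  simp only [Matrix.mul_apply, conjTranspose_apply, Finset.sum_mul]
  rw [Finset.sum_comm]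
  exact Finset.sum_congr rfl fun u _ => Finset.sum_congr rfl fun v _ => by ring

theorem twirl_eq_kernelMap [DecidableEq X] (hm : ∀ x y, Measurable fun ω => U ω x y)
    (hU : ∀ ω, U ω ∈ unitaryGroup X ℂ) (k : ℕ) :
    twirl P U k = kernelMap (twirlChoi P U k) := by
  funext A
  ext x y
  simp only [twirl, kernelMap, twirlChoi, Matrix.of_apply, conj_apply]
  refine (integral_finsetSum _ fun u _ => integrable_finsetSum _ fun v _ =>
    (integrable_tensorPow_mul hm hU k x u y v).mul_const _).trans ?_
  refine Finset.sum_congr rfl fun u _ => ?_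
  refine (integral_finsetSum _ fun v _ =>
    (integrable_tensorPow_mul hm hU k x u y v).mul_const _).trans ?_
  exact Finset.sum_congr rfl fun v _ => integral_mul_const _ _

theorem posSemidef_integral {Y : Type*} [Fintype Y] {F : Ω → Matrix Y Y ℂ}
    (hF : ∀ ω, (F ω).PosSemidef) (hint : ∀ x y, Integrable (fun ω => F ω x y) P) :
    (Matrix.of fun x y => ∫ ω, F ω x y ∂P).PosSemidef := by
  rw [posSemidef_iff_dotProduct_mulVec]
  constructor
  · ext x y
    rw [conjTranspose_apply, Matrix.of_apply, Matrix.of_apply, Complex.star_def, ← integral_conj]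
    refine integral_congr_ae (Filter.Eventually.of_forall fun ω => ?_)
    exact (hF ω).1.apply x y
  · intro z
    have h : star z ⬝ᵥ (Matrix.of fun x y => ∫ ω, F ω x y ∂P) *ᵥ z =
        ∫ ω, star z ⬝ᵥ F ω *ᵥ z ∂P := by
      simp only [dotProduct, mulVec, Matrix.of_apply]
      rw [integral_finsetSum _ fun x _ => (integrable_finsetSum _ fun y _ =>
        (hint x y).mul_const _).const_mul _]
      refine Finset.sum_congr rfl fun x _ => ?_
      rw [integral_const_mul, integral_finsetSum _ fun y _ => (hint x y).mul_const _]
      exact congrArg _ (Finset.sum_congr rfl fun y _ => (integral_mul_const _ _).symm)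
    rw [h]
    exact integral_nonneg fun ω => (hF ω).dotProduct_mulVec_nonneg z

/-- The Choi matrix is an average of positive matrices of rank at most one. -/
theorem isCompletelyPositive_twirl [DecidableEq X] (hm : ∀ x y, Measurable fun ω => U ω x y)
    (hU : ∀ ω, U ω ∈ unitaryGroup X ℂ) (k : ℕ) : IsCompletelyPositive (twirl P U k) := by
  rw [twirl_eq_kernelMap hm hU]
  let F : Ω → Matrix ((Fin k → X) × (Fin k → X)) ((Fin k → X) × (Fin k → X)) ℂ := fun ω =>
    vecMulVec (fun a => tensorPow k (U ω) a.1 a.2) (star fun a => tensorPow k (U ω) a.1 a.2)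
  have hF : ∀ ω, (F ω).PosSemidef := fun ω => posSemidef_vecMulVec_self_star _
  have hint : ∀ a b, Integrable (fun ω => F ω a b) P := fun a b =>
    integrable_tensorPow_mul hm hU k a.1 a.2 b.1 b.2
  exact isCompletelyPositive_kernelMap (posSemidef_integral hF hint)

end Twirl

/-! ### The twirl of the symmetric Haar ensemble -/

section Haar

variable {X : Type v} [Fintype X] {Ω : Type*} [MeasurableSpace Ω]
  {P : Measure Ω} [IsProbabilityMeasure P]

theorem mul_integral_mul {Y : Type*} [Fintype Y] {F : Ω → Matrix Y Y ℂ}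
    (hint : ∀ x y, Integrable (fun ω => F ω x y) P) (L R : Matrix Y Y ℂ) :
    L * (Matrix.of fun x y => ∫ ω, F ω x y ∂P) * R =
      Matrix.of fun x y => ∫ ω, (L * F ω * R) x y ∂P := by
  ext x y
  simp only [Matrix.mul_apply, Matrix.of_apply, Finset.sum_mul]
  symm
  refine (integral_finsetSum _ fun v _ => integrable_finsetSum _ fun u _ =>
    ((hint u v).const_mul _).mul_const _).trans ?_
  refine Finset.sum_congr rfl fun v _ => ?_
  refine (integral_finsetSum _ fun u _ => ((hint u v).const_mul _).mul_const _).trans ?_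
  refine Finset.sum_congr rfl fun u _ => ?_
  rw [integral_mul_const, integral_const_mul]

theorem trace_integral {Y : Type*} [Fintype Y] {F : Ω → Matrix Y Y ℂ}
    (hint : ∀ x y, Integrable (fun ω => F ω x y) P) :
    trace (Matrix.of fun x y => ∫ ω, F ω x y ∂P) = ∫ ω, trace (F ω) ∂P :=
  (integral_finsetSum _ fun _ _ => hint _ _).symm

variable [DecidableEq X]

theorem integrable_conj_tensorPow {U : Ω → Matrix X X ℂ}
    (hm : ∀ x y, Measurable fun ω => U ω x y)
    (hU : ∀ ω, U ω ∈ unitaryGroup X ℂ) (k : ℕ) (A : Matrix (Fin k → X) (Fin k → X) ℂ)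
    (x y : Fin k → X) :
    Integrable (fun ω => (tensorPow k (U ω) * A * (tensorPow k (U ω))ᴴ) x y) P := by
  simp only [conj_apply]
  exact integrable_finsetSum _ fun u _ => integrable_finsetSum _ fun v _ =>
    (integrable_tensorPow_mul hm hU k x u y v).mul_const _

theorem tensorPow_unitary {k : ℕ} {U : Matrix X X ℂ} (hU : U ∈ unitaryGroup X ℂ) :
    (tensorPow k U)ᴴ * tensorPow k U = 1 := by
  rw [tensorPow_conjTranspose, ← tensorPow_mul, ← star_eq_conjTranspose,
    mem_unitaryGroup_iff'.mp hU, tensorPow_one]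

theorem tensorPow_unitary' {k : ℕ} {U : Matrix X X ℂ} (hU : U ∈ unitaryGroup X ℂ) :
    tensorPow k U * (tensorPow k U)ᴴ = 1 := by
  rw [tensorPow_conjTranspose, ← tensorPow_mul, ← star_eq_conjTranspose,
    mem_unitaryGroup_iff.mp hU, tensorPow_one]

theorem twirl_one {U : Ω → Matrix X X ℂ} (hU : ∀ ω, U ω ∈ unitaryGroup X ℂ) (k : ℕ) :
    twirl P U k 1 = 1 := by
  ext x y
  simp only [twirl, Matrix.mul_one, tensorPow_unitary' (hU _), integral_const, probReal_univ,
    one_smul]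

theorem twirl_zero_copies {U : Ω → Matrix X X ℂ} (A : Matrix (Fin 0 → X) (Fin 0 → X) ℂ) :
    twirl P U 0 A = A := by
  have h : ∀ M : Matrix X X ℂ, tensorPow 0 M = 1 := fun M => by
    ext x y; rw [Subsingleton.elim x y]; simp [tensorPow]
  ext x y
  simp only [twirl, h, conjTranspose_one, Matrix.mul_one, Matrix.one_mul, integral_const,
    probReal_univ, one_smul]

variable {G : Type u} {ρ : G → Matrix X X ℂ}

theorem symVal_mem (U : symUnitary ρ) : symVal ρ U ∈ unitaryGroup X ℂ :=
  (U : unitaryGroup X ℂ).2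

theorem symVal_commute (U : symUnitary ρ) (g : G) : symVal ρ U * ρ g = ρ g * symVal ρ U := U.2 g

theorem measurable_symVal (x y : X) : Measurable fun U : symUnitary ρ => symVal ρ U x y := by
  have : Continuous fun U : symUnitary ρ => symVal ρ U x y := by
    have h1 : Continuous fun U : symUnitary ρ => symVal ρ U :=
      continuous_subtype_val.comp continuous_subtype_val
    exact (continuous_apply y).comp ((continuous_apply x).comp h1)
  exact this.measurable

/-- The twirl of the symmetric Haar ensemble. -/
noncomputable abbrev haarTwirl (ρ : G → Matrix X X ℂ) (k : ℕ) :
    Matrix (Fin k → X) (Fin k → X) ℂ → Matrix (Fin k → X) (Fin k → X) ℂ :=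
  twirl (symHaar ρ) (symVal ρ) k

theorem isCompletelyPositive_haarTwirl (k : ℕ) : IsCompletelyPositive (haarTwirl ρ k) :=
  isCompletelyPositive_twirl measurable_symVal symVal_mem k

/-- Left invariance of Haar measure: conjugation by `V^{⊗k}` does not change the average. -/
theorem haarTwirl_commute (k : ℕ) (A : Matrix (Fin k → X) (Fin k → X) ℂ) {V : Matrix X X ℂ}
    (hV : V ∈ unitaryGroup X ℂ) (hVρ : ∀ g, V * ρ g = ρ g * V) :
    haarTwirl ρ k A * tensorPow k V = tensorPow k V * haarTwirl ρ k A := by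
  let V' : symUnitary ρ := ⟨⟨V, hV⟩, hVρ⟩
  have h1 : tensorPow k V * haarTwirl ρ k A * (tensorPow k V)ᴴ = haarTwirl ρ k A := by
    have h2 := mul_integral_mul (P := symHaar ρ) (F := fun U => tensorPow k (symVal ρ U) * A *
      (tensorPow k (symVal ρ U))ᴴ) (fun x y =>
        integrable_conj_tensorPow measurable_symVal symVal_mem k A x y) (tensorPow k V)
        (tensorPow k V)ᴴ
    refine Eq.trans h2 ?_
    ext x y
    let g : symUnitary ρ → ℂ := fun U =>
      (tensorPow k (symVal ρ U) * A * (tensorPow k (symVal ρ U))ᴴ) x y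
    have h3 : ∀ U : symUnitary ρ, (tensorPow k V * (tensorPow k (symVal ρ U) * A *
        (tensorPow k (symVal ρ U))ᴴ) * (tensorPow k V)ᴴ) x y = g (V' * U) := fun U => by
      have h4 : symVal ρ (V' * U) = V * symVal ρ U := rfl
      simp only [g, h4, tensorPow_mul, conjTranspose_mul, Matrix.mul_assoc]
    have h5 : ∫ U, g (V' * U) ∂(symHaar ρ) = ∫ U, g U ∂(symHaar ρ) := by
      unfold symHaar
      exact integral_mul_left_eq_self g V'
    simp only [Matrix.of_apply, h3]
    exact h5
  calc haarTwirl ρ k A * tensorPow k V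
      = tensorPow k V * haarTwirl ρ k A * ((tensorPow k V)ᴴ * tensorPow k V) := by
        rw [← Matrix.mul_assoc, h1]
    _ = _ := by rw [tensorPow_unitary hV, Matrix.mul_one]

/-- `B` passes through the tensor powers and the unitaries cancel under the trace. With the span
property, these traces are all that is used about the Haar twirl. -/
theorem trace_haarTwirl_mul (k : ℕ) (A B : Matrix (Fin k → X) (Fin k → X) ℂ)
    (hB : ∀ V ∈ unitaryGroup X ℂ, (∀ g, V * ρ g = ρ g * V) →
      tensorPow k V * B = B * tensorPow k V) :
    trace (haarTwirl ρ k A * B) = trace (A * B) := by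
  have hint := fun x y => integrable_conj_tensorPow (P := symHaar ρ) (U := symVal ρ)
    measurable_symVal symVal_mem k A x y
  have h2 := mul_integral_mul (P := symHaar ρ) hint 1 B
  have h3 : haarTwirl ρ k A * B = Matrix.of fun x y => ∫ U, (1 * (tensorPow k (symVal ρ U) * A *
      (tensorPow k (symVal ρ U))ᴴ) * B : Matrix (Fin k → X) (Fin k → X) ℂ) x y ∂(symHaar ρ) := by
    rw [← h2, Matrix.one_mul]; rfl
  have h4 : ∀ U : symUnitary ρ, 1 * (tensorPow k (symVal ρ U) * A *
      (tensorPow k (symVal ρ U))ᴴ) * B = tensorPow k (symVal ρ U) * (A * B) *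
      (tensorPow k (symVal ρ U))ᴴ := fun U => by
    have h5 : (tensorPow k (symVal ρ U))ᴴ * B = B * (tensorPow k (symVal ρ U))ᴴ := by
      have := hB _ (symVal_mem U) (symVal_commute U)
      calc (tensorPow k (symVal ρ U))ᴴ * B
          = (tensorPow k (symVal ρ U))ᴴ * (B * tensorPow k (symVal ρ U)) *
            (tensorPow k (symVal ρ U))ᴴ := by
            rw [Matrix.mul_assoc, Matrix.mul_assoc, tensorPow_unitary' (symVal_mem U),
              Matrix.mul_one]
        _ = _ := by
            rw [← this, ← Matrix.mul_assoc, tensorPow_unitary (symVal_mem U), Matrix.one_mul]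
    rw [Matrix.one_mul, Matrix.mul_assoc, h5]
    simp only [Matrix.mul_assoc]
  rw [h3]
  simp only [h4]
  rw [trace_integral fun x y =>
    integrable_conj_tensorPow (P := symHaar ρ) measurable_symVal symVal_mem k (A * B) x y]
  have h6 : ∀ U : symUnitary ρ, trace (tensorPow k (symVal ρ U) * (A * B) *
      (tensorPow k (symVal ρ U))ᴴ) = trace (A * B) := fun U => by
    rw [Matrix.trace_mul_comm, ← Matrix.mul_assoc, tensorPow_unitary (symVal_mem U),
      Matrix.one_mul]
  simp only [h6, integral_const, probReal_univ, one_smul]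

end Haar

/-! ### The trace map as the Haar twirl times a class sum -/

section TraceMap

variable {N : Type*} [Group N] [Fintype N] {Y : Type v} [Fintype Y] [DecidableEq Y]

/-- The map `A ↦ (1 / dim) ∑ tr(A W_w†) W_w` of a representation `W` of a finite group. -/
noncomputable def traceMap (W : N →* Matrix Y Y ℂ) (A : Matrix Y Y ℂ) : Matrix Y Y ℂ :=
  (Fintype.card Y : ℂ)⁻¹ • ∑ w, trace (A * (W w)ᴴ) • W w

theorem posSemidef_mul_of_commute {A B : Matrix Y Y ℂ} (hA : A.PosSemidef) (hB : B.PosSemidef)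
    (h : A * B = B * A) : (A * B).PosSemidef := by
  open scoped MatrixOrder in
  exact (Commute.mul_nonneg hA.nonneg hB.nonneg h).posSemidef

theorem IsCompletelyPositive.mul_commuting {Φ : Matrix Y Y ℂ → Matrix Y Y ℂ}
    (hΦ : IsCompletelyPositive Φ) {s : Matrix Y Y ℂ} (hs : s.PosSemidef)
    (hcomm : ∀ A, Φ A * s = s * Φ A) : IsCompletelyPositive fun A => Φ A * s := by
  refine ⟨⟨fun A B => ?_, fun c A => ?_⟩, fun r M hM => ?_⟩
  · rw [hΦ.1.map_add, Matrix.add_mul]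
  · rw [hΦ.1.map_smul, Matrix.smul_mul]
  · let S : Matrix (Y × Fin r) (Y × Fin r) ℂ :=
      kroneckerMap (· * ·) s (1 : Matrix (Fin r) (Fin r) ℂ)
    have hS : S.PosSemidef := hs.kronecker PosSemidef.one
    have h1 : SymDesign.ampMap (Fin r) Φ M * S = S * SymDesign.ampMap (Fin r) Φ M := by
      ext ⟨x, a⟩ ⟨y, b⟩
      have := congrArg (fun A : Matrix Y Y ℂ => A x y)
        (hcomm (Matrix.of fun x y => M (x, a) (y, b)))
      simpa [Matrix.mul_apply, SymDesign.ampMap, S, Matrix.one_apply, Fintype.sum_prod_type]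
        using this
    have h2 := posSemidef_mul_of_commute (hΦ.2 r M hM) hS h1
    convert h2 using 1
    ext ⟨x, a⟩ ⟨y, b⟩
    change _ = (SymDesign.ampMap (Fin r) Φ M * S) _ _
    simp [Matrix.mul_apply, SymDesign.ampMap, S, Matrix.one_apply, Fintype.sum_prod_type]

variable {W : N →* Matrix Y Y ℂ} {f : N → ℝ}

/-- With `B = ∑ c_v W_v` one has `tr(W_v W_w†) = dim · f(v⁻¹w)`. The trace map is thus a convolution
of `c` and `f`, i.e. a product in the group algebra. In the application `B` is the Haar twirl of
`A`. -/
theorem traceMap_eq_mul (hW : ∀ w, (W w)ᴴ = W w⁻¹)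
    (htr : ∀ w, trace (W w) = (Fintype.card Y * f w : ℝ)) (hinv : ∀ w, f w⁻¹ = f w)
    (hconj : ∀ v w, f (v * w * v⁻¹) = f w) [Nonempty Y] {A B : Matrix Y Y ℂ}
    (hspan : ∃ c : N → ℂ, B = ∑ w, c w • W w)
    (hAB : ∀ w, trace (B * (W w)ᴴ) = trace (A * (W w)ᴴ)) :
    traceMap W A = B * ∑ w, f w • W w := by
  obtain ⟨c, hc⟩ := hspan
  have hY : (Fintype.card Y : ℂ) ≠ 0 := Nat.cast_ne_zero.mpr Fintype.card_ne_zero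
  have h1 : ∀ v w, trace (W v * (W w)ᴴ) = (Fintype.card Y : ℂ) * f (v⁻¹ * w) := fun v w => by
    rw [hW, ← map_mul, htr, ← hinv (v * w⁻¹), ← hconj v⁻¹ (v * w⁻¹)⁻¹]
    push_cast
    congr 3
    group
  calc traceMap W A = (Fintype.card Y : ℂ)⁻¹ • ∑ w, trace (B * (W w)ᴴ) • W w := by
        simp only [traceMap, hAB]
    _ = ∑ w, ∑ v, (c v * f (v⁻¹ * w)) • W w := by
        rw [Finset.smul_sum]
        refine Finset.sum_congr rfl fun w _ => ?_
        rw [hc, Finset.sum_mul, trace_sum, Finset.sum_smul, Finset.smul_sum]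
        refine Finset.sum_congr rfl fun v _ => ?_
        rw [Matrix.smul_mul, trace_smul, h1, smul_smul, smul_eq_mul]
        congr 1
        field_simp
    _ = ∑ v, ∑ w, (c v * f w) • W (v * w) := by
        rw [Finset.sum_comm]
        refine Finset.sum_congr rfl fun v _ => ?_
        rw [← Equiv.sum_comp (Equiv.mulLeft v)]
        simp
    _ = _ := by
        rw [hc, Finset.sum_mul]
        refine Finset.sum_congr rfl fun v _ => ?_
        rw [Finset.mul_sum]
        refine Finset.sum_congr rfl fun w _ => ?_
        rw [map_mul, ← Complex.coe_smul, Matrix.mul_smul, Matrix.smul_mul, smul_smul, mul_comm]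

theorem classSum_commute (hconj : ∀ v w, f (v * w * v⁻¹) = f w) (v : N) :
    (∑ w, f w • W w) * W v = W v * ∑ w, f w • W w := by
  rw [Finset.sum_mul, Finset.mul_sum, ← Equiv.sum_comp (MulAut.conj v).toEquiv]
  refine Finset.sum_congr rfl fun w _ => ?_
  simp only [MulEquiv.toEquiv_eq_coe, EquivLike.coe_coe, MulAut.conj_apply, hconj,
    Matrix.smul_mul, Matrix.mul_smul, ← map_mul, inv_mul_cancel_right]

/-- The difference is `(E - ∑ f) 1 + ∑ f(w) (1 - W_w)`, a sum of two positive terms. -/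
theorem posSemidef_smul_one_sub_classSum (hW : ∀ w, (W w)ᴴ = W w⁻¹) (hf : ∀ w, 0 ≤ f w)
    (hinv : ∀ w, f w⁻¹ = f w) {E : ℝ} (hE : ∑ w, f w ≤ E) :
    (E • (1 : Matrix Y Y ℂ) - ∑ w, f w • W w).PosSemidef := by
  have h := posSemidef_sum_one_add_smul hW hf hinv (s := -1) (Or.inr rfl)
  have h2 := ((PosSemidef.one (n := Y) (R := ℂ)).smul (sub_nonneg.mpr hE)).add h
  convert h2 using 1
  simp only [smul_add, Finset.sum_add_distrib, ← Finset.sum_smul, neg_smul, one_smul, smul_neg,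
    Finset.sum_neg_distrib, sub_smul]
  abel

/-- The term `w = 1` is set apart: the difference is `(E - ∑ f) 1 + ∑_{w ≠ 1} f(w) (1 + W_w)`. -/
theorem posSemidef_classSum_sub_smul_one (hW : ∀ w, (W w)ᴴ = W w⁻¹) (hf : ∀ w, 0 ≤ f w)
    (hinv : ∀ w, f w⁻¹ = f w) (hone : f 1 = 1) {E : ℝ} (hE : ∑ w, f w ≤ E) :
    ((∑ w, f w • W w) - (2 - E) • (1 : Matrix Y Y ℂ)).PosSemidef := by
  classical
  let f' : N → ℝ := fun w => if w = 1 then 0 else f w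
  have hf' : ∀ w, f w = f' w + if w = 1 then 1 else 0 := fun w => by
    by_cases hw : w = 1
    · simp [f', hw, hone]
    · simp [f', hw]
  have h := posSemidef_sum_one_add_smul hW (f := f') (fun w => by
      by_cases hw : w = 1
      · simp [f', hw]
      · simpa [f', hw] using hf w) (fun w => by simp [f', hinv]) (s := 1) (Or.inl rfl)
  have h2 := ((PosSemidef.one (n := Y) (R := ℂ)).smul (sub_nonneg.mpr hE)).add h
  convert h2 using 1
  simp only [hf', smul_add, Finset.sum_add_distrib, ← Finset.sum_smul, add_smul, one_smul,
    sub_smul, ite_smul, zero_smul, Finset.sum_ite_eq', Finset.mem_univ, if_true, map_one,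
    two_smul]
  abel

/-- The difference is `Φ(A) (E - q)` with `q` the class sum; since `q` commutes with the image of
`Φ`, multiplying by the positive factor preserves complete positivity. -/
theorem traceMap_cple (hW : ∀ w, (W w)ᴴ = W w⁻¹)
    (htr : ∀ w, trace (W w) = (Fintype.card Y * f w : ℝ)) (hinv : ∀ w, f w⁻¹ = f w)
    (hconj : ∀ v w, f (v * w * v⁻¹) = f w) [Nonempty Y] {Φ : Matrix Y Y ℂ → Matrix Y Y ℂ}
    (hΦ : IsCompletelyPositive Φ) (hspan : ∀ A, ∃ c : N → ℂ, Φ A = ∑ w, c w • W w)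
    (htrace : ∀ A w, trace (Φ A * (W w)ᴴ) = trace (A * (W w)ᴴ)) {E : ℝ}
    (hE : (E • (1 : Matrix Y Y ℂ) - ∑ w, f w • W w).PosSemidef) :
    CPLE (traceMap W) fun A => (E : ℂ) • Φ A := by
  have hq : ∀ A, Φ A * (∑ w, f w • W w) = (∑ w, f w • W w) * Φ A := fun A => by
    obtain ⟨c, hc⟩ := hspan A
    rw [hc, Matrix.sum_mul, Matrix.mul_sum]
    refine Finset.sum_congr rfl fun v _ => ?_
    rw [Matrix.smul_mul, Matrix.mul_smul, classSum_commute hconj]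
  have h := hΦ.mul_commuting hE fun A => by
    rw [Matrix.mul_sub, Matrix.sub_mul, hq]; simp
  unfold CPLE
  convert h using 2 with A
  rw [traceMap_eq_mul hW htr hinv hconj (hspan A) (htrace A), Matrix.mul_sub]
  simp

theorem cple_traceMap (hW : ∀ w, (W w)ᴴ = W w⁻¹)
    (htr : ∀ w, trace (W w) = (Fintype.card Y * f w : ℝ)) (hinv : ∀ w, f w⁻¹ = f w)
    (hconj : ∀ v w, f (v * w * v⁻¹) = f w) [Nonempty Y] {Φ : Matrix Y Y ℂ → Matrix Y Y ℂ}
    (hΦ : IsCompletelyPositive Φ) (hspan : ∀ A, ∃ c : N → ℂ, Φ A = ∑ w, c w • W w)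
    (htrace : ∀ A w, trace (Φ A * (W w)ᴴ) = trace (A * (W w)ᴴ)) {c : ℝ}
    (hc : ((∑ w, f w • W w) - c • (1 : Matrix Y Y ℂ)).PosSemidef) :
    CPLE (fun A => (c : ℂ) • Φ A) (traceMap W) := by
  have hq : ∀ A, Φ A * (∑ w, f w • W w) = (∑ w, f w • W w) * Φ A := fun A => by
    obtain ⟨c, hc⟩ := hspan A
    rw [hc, Matrix.sum_mul, Matrix.mul_sum]
    refine Finset.sum_congr rfl fun v _ => ?_
    rw [Matrix.smul_mul, Matrix.mul_smul, classSum_commute hconj]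
  have h := hΦ.mul_commuting hc fun A => by
    rw [Matrix.mul_sub, Matrix.sub_mul, hq]; simp
  unfold CPLE
  convert h using 2 with A
  rw [traceMap_eq_mul hW htr hinv hconj (hspan A) (htrace A), Matrix.mul_sub]
  simp

end TraceMap

/-! ### Operator bounds between Haar twirl and trace map -/

section FreeHaar

variable {G : Type u} [Group G] [Fintype G] {X : Type v} [Fintype X] [DecidableEq X] [Nonempty X]
  {ρ : G →* Matrix X X ℂ} {k : ℕ}

theorem IsFreePermRep.trace_wreathRep' (h : IsFreePermRep.{w} ρ) (w : Wreath G k) :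
    trace (wreathRep k ρ w) = ((Fintype.card (Fin k → X) : ℝ) * wreathChar k ρ w : ℝ) := by
  rw [h.trace_wreathRep, Fintype.card_fun, Fintype.card_fin, Nat.cast_pow]

omit [Fintype G] [Nonempty X] in
theorem trace_haarTwirl_mul_wreathRep (hρ : ∀ g, (ρ g)ᴴ = ρ g⁻¹)
    (A : Matrix (Fin k → X) (Fin k → X) ℂ) (w : Wreath G k) :
    trace (haarTwirl ρ k A * (wreathRep k ρ w)ᴴ) = trace (A * (wreathRep k ρ w)ᴴ) :=
  trace_haarTwirl_mul k A _ fun V _ hVρ => by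
    rw [wreathRep_conjTranspose hρ]
    exact tensorPow_commute_wreathRep hVρ _

omit [Nonempty X] in
theorem IsFreePermRep.haarTwirl_mem_span (h : IsFreePermRep.{w} ρ)
    (hk : k * Fintype.card G ≤ Fintype.card X) (A : Matrix (Fin k → X) (Fin k → X) ℂ) :
    ∃ c : Wreath G k → ℂ, haarTwirl ρ k A = ∑ w, c w • wreathRep k ρ w :=
  h.mem_span_of_commute hk fun _ hV hVρ => haarTwirl_commute k A hV hVρ

theorem IsFreePermRep.traceMap_cple_haarTwirl (h : IsFreePermRep.{w} ρ)
    (hk : k * Fintype.card G ≤ Fintype.card X) :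
    CPLE (traceMap (wreathRep k ρ)) fun A =>
      ((Real.exp ((k : ℝ) * (k - 1) * Fintype.card G / (2 * Fintype.card X)) : ℝ) : ℂ) •
        haarTwirl ρ k A :=
  traceMap_cple (wreathRep_conjTranspose h.conjTranspose) h.trace_wreathRep' h.wreathChar_inv
    wreathChar_conj (isCompletelyPositive_haarTwirl k) (h.haarTwirl_mem_span hk)
    (trace_haarTwirl_mul_wreathRep h.conjTranspose)
    (posSemidef_smul_one_sub_classSum (wreathRep_conjTranspose h.conjTranspose)
      h.wreathChar_nonneg h.wreathChar_inv (h.sum_wreathChar_le k))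

theorem IsFreePermRep.haarTwirl_cple_traceMap (h : IsFreePermRep.{w} ρ)
    (hk : k * Fintype.card G ≤ Fintype.card X) :
    CPLE (fun A => ((1 - (k : ℝ) * (k - 1) * Fintype.card G / (2 * Fintype.card X) : ℝ) : ℂ) •
        haarTwirl ρ k A) (traceMap (wreathRep k ρ)) :=
  cple_traceMap (wreathRep_conjTranspose h.conjTranspose) h.trace_wreathRep' h.wreathChar_inv
    wreathChar_conj (isCompletelyPositive_haarTwirl k) (h.haarTwirl_mem_span hk)
    (trace_haarTwirl_mul_wreathRep h.conjTranspose)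
    (h.posSemidef_sum_wreathChar_sub k)

end FreeHaar

/-! ### Tensor products and complex conjugates of representations -/

section KronHom

variable {N : Type*} [Group N] {α β γ : Type*} [Fintype α] [DecidableEq α]
  [Fintype β] [DecidableEq β] [Fintype γ] [DecidableEq γ]

/-- The tensor product of two representations. -/
def kronHom (V : N →* Matrix α α ℂ) (W : N →* Matrix β β ℂ) :
    N →* Matrix (α × β) (α × β) ℂ where
  toFun w := V w ⊗ₖ W w
  map_one' := by simp
  map_mul' v w := by rw [map_mul, map_mul, mul_kronecker_mul]

/-- The complex conjugate of a representation. -/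
def conjHom (W : N →* Matrix α α ℂ) : N →* Matrix α α ℂ where
  toFun w := (W w).map (starRingEnd ℂ)
  map_one' := by
    rw [map_one]; exact Matrix.map_one _ (map_zero _) (map_one _)
  map_mul' v w := by rw [map_mul, Matrix.map_mul]

theorem kronHom_apply (V : N →* Matrix α α ℂ) (W : N →* Matrix β β ℂ) (w : N) :
    kronHom V W w = V w ⊗ₖ W w := rfl

theorem conjHom_apply (W : N →* Matrix α α ℂ) (w : N) :
    conjHom W w = (W w).map (starRingEnd ℂ) := rfl

/-- A representation by unitary matrices. -/
def IsUnitaryHom (W : N →* Matrix α α ℂ) : Prop := ∀ w, (W w)ᴴ = W w⁻¹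

theorem IsUnitaryHom.kronHom {V : N →* Matrix α α ℂ} {W : N →* Matrix β β ℂ}
    (hV : IsUnitaryHom V) (hW : IsUnitaryHom W) : IsUnitaryHom (kronHom V W) := fun w => by
  rw [kronHom_apply, kronHom_apply, conjTranspose_kronecker, hV, hW]

theorem IsUnitaryHom.conjHom {W : N →* Matrix α α ℂ} (hW : IsUnitaryHom W) :
    IsUnitaryHom (conjHom W) := fun w => by
  rw [conjHom_apply, conjHom_apply, ← hW w]
  rfl

theorem isUnitaryHom_one : IsUnitaryHom (1 : N →* Matrix α α ℂ) := fun w => by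
  simp

theorem trace_mul_conjTranspose {Y : Type*} [Fintype Y] (A R : Matrix Y Y ℂ) :
    trace (A * Rᴴ) = ∑ y, ∑ y', A y y' * star (R y y') := rfl

theorem trace_mul_kronecker_conjTranspose (M : Matrix (α × β) (α × β) ℂ) (P : Matrix α α ℂ)
    (R : Matrix β β ℂ) :
    trace ((Matrix.of fun a a' => trace ((Matrix.of fun d d' => M (a, d) (a', d')) * Rᴴ)) * Pᴴ) =
      trace (M * (P ⊗ₖ R)ᴴ) := by
  simp only [trace_mul_conjTranspose, Matrix.of_apply, Fintype.sum_prod_type,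
    kronecker_apply, Finset.sum_mul, star_mul']
  refine Finset.sum_congr rfl fun a _ => ?_
  rw [Finset.sum_comm]
  refine Finset.sum_congr rfl fun d _ => Finset.sum_congr rfl fun a' _ =>
    Finset.sum_congr rfl fun d' _ => by ring

end KronHom

/-! ### Choi matrices of elementary maps -/

section Kernel

variable {Y : Type*} [Fintype Y]

theorem kernelMap_kronecker (M R A : Matrix Y Y ℂ) :
    kernelMap (M ⊗ₖ R.map (starRingEnd ℂ)) A = trace (A * Rᴴ) • M := by
  ext x x'
  simp only [kernelMap, Matrix.of_apply, kronecker_apply, Matrix.map_apply, Matrix.smul_apply,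
    trace_mul_conjTranspose, smul_eq_mul, Finset.sum_mul]
  exact Finset.sum_congr rfl fun y _ => Finset.sum_congr rfl fun y' _ => by
    rw [Complex.star_def]; ring

theorem kernelMap_sum {I : Type*} (s : Finset I) (C : I → Matrix (Y × Y) (Y × Y) ℂ)
    (A : Matrix Y Y ℂ) : kernelMap (∑ i ∈ s, C i) A = ∑ i ∈ s, kernelMap (C i) A := by
  classical
  induction s using Finset.induction_on with
  | empty => ext x x'; simp [kernelMap]
  | insert i s hi ih =>
    rw [Finset.sum_insert hi, Finset.sum_insert hi, ← ih]
    ext x x'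
    simp [kernelMap, add_mul, Finset.sum_add_distrib]

end Kernel

/-! ### Composition of two overlapping trace maps -/

section Composition

variable {N : Type*} [Group N] [Fintype N] {α β γ : Type*} [Fintype α] [DecidableEq α]
  [Fintype β] [DecidableEq β] [Fintype γ] [DecidableEq γ]
  {Wa : N →* Matrix α α ℂ} {Wb : N →* Matrix β β ℂ} {Wc : N →* Matrix γ γ ℂ}

/-- The composition of the trace maps on the first two and on the last two of three factors. -/
noncomputable def overlapMap (Wa : N →* Matrix α α ℂ) (Wb : N →* Matrix β β ℂ)
    (Wc : N →* Matrix γ γ ℂ) (A : Matrix (α × β × γ) (α × β × γ) ℂ) :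
    Matrix (α × β × γ) (α × β × γ) ℂ :=
  conjMap (Equiv.prodAssoc α β γ).symm (ampMap γ (traceMap (kronHom Wa Wb)))
    (conjMap (Equiv.prodComm α (β × γ)) (ampMap α (traceMap (kronHom Wb Wc))) A)

theorem traceMap_eq_kernelMap {Y : Type*} [Fintype Y] [DecidableEq Y] (W : N →* Matrix Y Y ℂ)
    (A : Matrix Y Y ℂ) :
    traceMap W A = kernelMap ((Fintype.card Y : ℂ)⁻¹ • ∑ w, kronHom W (conjHom W) w) A := by
  rw [kernelMap_smul, kernelMap_sum]
  simp only [kronHom_apply, conjHom_apply, kernelMap_kronecker]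
  rfl

/-- Each trace map brings its own group element, `τ` for the inner and `σ` for the outer one. On the
shared factor `Wb τ` is traced against `(Wb σ)†`, which leaves the weight `f (τ σ⁻¹)`. -/
theorem overlapMap_apply {f : N → ℝ} (hWb : IsUnitaryHom Wb) [Nonempty β]
    (htr : ∀ w, trace (Wb w) = (Fintype.card β * f w : ℝ))
    (A : Matrix (α × β × γ) (α × β × γ) ℂ) :
    overlapMap Wa Wb Wc A = (Fintype.card (α × β × γ) : ℂ)⁻¹ • ∑ σ, ∑ τ,
      ((f (τ * σ⁻¹) : ℂ) * trace (A * (Wa σ ⊗ₖ (Wb τ ⊗ₖ Wc τ))ᴴ)) •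
        (Wa σ ⊗ₖ (Wb σ ⊗ₖ Wc τ)) := by
  have hβ : (Fintype.card β : ℂ) ≠ 0 := Nat.cast_ne_zero.mpr Fintype.card_ne_zero
  let T : N → Matrix α α ℂ := fun τ => Matrix.of fun a a' =>
    trace ((Matrix.of fun d d' => A (a, d) (a', d')) * (Wb τ ⊗ₖ Wc τ)ᴴ)
  have hB : ∀ c c', (Matrix.of fun (p p' : α × β) =>
      conjMap (Equiv.prodComm α (β × γ)) (ampMap α (traceMap (kronHom Wb Wc))) A
        (p.1, p.2, c) (p'.1, p'.2, c')) =
      (Fintype.card (β × γ) : ℂ)⁻¹ • ∑ τ, Wc τ c c' • (T τ ⊗ₖ Wb τ) := fun c c' => by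
    ext ⟨a, b⟩ ⟨a', b'⟩
    simp only [conjMap, ampMap, traceMap, Matrix.submatrix_apply, Matrix.of_apply,
      Equiv.prodComm_apply, Prod.swap_prod_mk, Equiv.prodComm_symm, Matrix.smul_apply,
      Matrix.sum_apply, kronHom_apply, kronecker_apply, smul_eq_mul, T]
    congr 1
    refine Finset.sum_congr rfl fun τ _ => ?_
    ring
  ext ⟨a, b, c⟩ ⟨a', b', c'⟩
  have h1 : overlapMap Wa Wb Wc A (a, b, c) (a', b', c') =
      traceMap (kronHom Wa Wb) (Matrix.of fun (p p' : α × β) =>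
      conjMap (Equiv.prodComm α (β × γ)) (ampMap α (traceMap (kronHom Wb Wc))) A
        (p.1, p.2, c) (p'.1, p'.2, c')) (a, b) (a', b') := rfl
  rw [h1, hB]
  have h2 : ∀ σ, trace (((Fintype.card (β × γ) : ℂ)⁻¹ • ∑ τ, Wc τ c c' • (T τ ⊗ₖ Wb τ)) *
      (kronHom Wa Wb σ)ᴴ) = (Fintype.card (β × γ) : ℂ)⁻¹ * ∑ τ, Wc τ c c' *
        (trace (A * (Wa σ ⊗ₖ (Wb τ ⊗ₖ Wc τ))ᴴ) * (Fintype.card β * f (τ * σ⁻¹))) := fun σ => by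
    rw [Matrix.smul_mul, trace_smul, smul_eq_mul, Matrix.sum_mul, trace_sum]
    congr 1
    refine Finset.sum_congr rfl fun τ _ => ?_
    rw [Matrix.smul_mul, trace_smul, smul_eq_mul, kronHom_apply, conjTranspose_kronecker,
      ← mul_kronecker_mul, trace_kronecker, hWb, ← map_mul, htr,
      trace_mul_kronecker_conjTranspose]
    push_cast
    rfl
  simp only [traceMap, Matrix.smul_apply, Matrix.sum_apply, h2]
  simp only [kronHom_apply, kronecker_apply, smul_eq_mul]
  rw [Finset.mul_sum, Finset.mul_sum]
  refine Finset.sum_congr rfl fun σ _ => ?_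
  rw [Finset.mul_sum, Finset.mul_sum, Finset.sum_mul, Finset.mul_sum]
  refine Finset.sum_congr rfl fun τ _ => ?_
  simp only [Fintype.card_prod, Nat.cast_mul, mul_inv]
  field_simp

/-- The representation measuring the mismatch of the two permutations in the composition. -/
def mismatchHom (α : Type*) [Fintype α] [DecidableEq α] (Wb : N →* Matrix β β ℂ)
    (Wc : N →* Matrix γ γ ℂ) :
    N →* Matrix ((α × β × γ) × (α × β × γ)) ((α × β × γ) × (α × β × γ)) ℂ :=
  kronHom (kronHom (1 : N →* Matrix α α ℂ) (kronHom (1 : N →* Matrix β β ℂ) Wc))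
    (conjHom (kronHom (1 : N →* Matrix α α ℂ) (kronHom Wb Wc)))

/-- After the substitution `τ = σπ` the weight is `f π`, as `f` is a class function, and the double
sum factors: the Choi matrix of the trace map on all three factors, times a class sum over the
mismatch `π`. -/
theorem overlapMap_eq_kernelMap {f : N → ℝ} (hWb : IsUnitaryHom Wb) [Nonempty β]
    (htr : ∀ w, trace (Wb w) = (Fintype.card β * f w : ℝ)) (hconj : ∀ v w, f (v * w * v⁻¹) = f w)
    (A : Matrix (α × β × γ) (α × β × γ) ℂ) :
    overlapMap Wa Wb Wc A = kernelMap (((Fintype.card (α × β × γ) : ℂ)⁻¹ •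
      ∑ w, kronHom (kronHom Wa (kronHom Wb Wc)) (conjHom (kronHom Wa (kronHom Wb Wc))) w) *
        ∑ w, f w • mismatchHom α Wb Wc w) A := by
  rw [overlapMap_apply hWb htr, Matrix.smul_mul, kernelMap_smul, Matrix.sum_mul, kernelMap_sum]
  congr 1
  refine Finset.sum_congr rfl fun σ _ => ?_
  rw [Matrix.mul_sum, kernelMap_sum, ← Equiv.sum_comp (Equiv.mulLeft σ)]
  refine Finset.sum_congr rfl fun π _ => ?_
  have h : kronHom (kronHom Wa (kronHom Wb Wc)) (conjHom (kronHom Wa (kronHom Wb Wc))) σ *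
      mismatchHom α Wb Wc π = (Wa σ ⊗ₖ (Wb σ ⊗ₖ Wc (σ * π))) ⊗ₖ
        ((Wa σ ⊗ₖ (Wb (σ * π) ⊗ₖ Wc (σ * π))).map (starRingEnd ℂ)) := by
    change (_ ⊗ₖ (_ : Matrix (α × β × γ) (α × β × γ) ℂ).map (starRingEnd ℂ)) *
      (_ ⊗ₖ (_ : Matrix (α × β × γ) (α × β × γ) ℂ).map (starRingEnd ℂ)) = _
    rw [← mul_kronecker_mul, ← Matrix.map_mul]
    simp only [kronHom_apply, ← mul_kronecker_mul, MonoidHom.one_apply, Matrix.mul_one, map_mul]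
  rw [Matrix.mul_smul, ← Complex.coe_smul, kernelMap_smul, h, kernelMap_kronecker, smul_smul,
    Equiv.coe_mulLeft, hconj]

theorem isUnitaryHom_mismatchHom (hWb : IsUnitaryHom Wb) (hWc : IsUnitaryHom Wc) :
    IsUnitaryHom (mismatchHom α Wb Wc) :=
  (isUnitaryHom_one.kronHom (isUnitaryHom_one.kronHom hWc)).kronHom
    (isUnitaryHom_one.kronHom (hWb.kronHom hWc)).conjHom

theorem kronHom_mul_mismatchHom_commute {f : N → ℝ} (hconj : ∀ v w, f (v * w * v⁻¹) = f w) (σ : N) :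
    kronHom (kronHom Wa (kronHom Wb Wc)) (conjHom (kronHom Wa (kronHom Wb Wc))) σ *
      (∑ w, f w • mismatchHom α Wb Wc w) = (∑ w, f w • mismatchHom α Wb Wc w) *
        kronHom (kronHom Wa (kronHom Wb Wc)) (conjHom (kronHom Wa (kronHom Wb Wc))) σ := by
  rw [Matrix.mul_sum, Matrix.sum_mul, ← Equiv.sum_comp (MulAut.conj σ).toEquiv
    (fun w => f w • mismatchHom α Wb Wc w * _)]
  refine Finset.sum_congr rfl fun w _ => ?_
  simp only [MulEquiv.toEquiv_eq_coe, EquivLike.coe_coe, MulAut.conj_apply, hconj,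
    Matrix.smul_mul, Matrix.mul_smul]
  congr 1
  have h : ∀ σ π : N, kronHom (kronHom Wa (kronHom Wb Wc))
      (conjHom (kronHom Wa (kronHom Wb Wc))) σ * mismatchHom α Wb Wc π =
      mismatchHom α Wb Wc (σ * π * σ⁻¹) * kronHom (kronHom Wa (kronHom Wb Wc))
        (conjHom (kronHom Wa (kronHom Wb Wc))) σ := fun σ π => by
    simp only [mismatchHom, kronHom_apply, ← mul_kronecker_mul, conjHom_apply,
      ← Matrix.map_mul, MonoidHom.one_apply, Matrix.mul_one, Matrix.one_mul, ← map_mul,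
      inv_mul_cancel_right]
  exact h σ w

theorem smul_sum_mul_mismatchHom_commute {f : N → ℝ} (hconj : ∀ v w, f (v * w * v⁻¹) = f w)
    (c : ℂ) :
    (c • ∑ w, kronHom (kronHom Wa (kronHom Wb Wc)) (conjHom (kronHom Wa (kronHom Wb Wc))) w) *
      (∑ w, f w • mismatchHom α Wb Wc w) = (∑ w, f w • mismatchHom α Wb Wc w) *
        (c • ∑ w, kronHom (kronHom Wa (kronHom Wb Wc))
          (conjHom (kronHom Wa (kronHom Wb Wc))) w) := by
  rw [Matrix.smul_mul, Matrix.mul_smul, Matrix.sum_mul, Matrix.mul_sum _ _ (∑ w, f w • _)]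
  exact congrArg _ (Finset.sum_congr rfl fun σ _ => kronHom_mul_mismatchHom_commute hconj σ)

theorem posSemidef_sum_hom {Y : Type*} [Fintype Y] [DecidableEq Y] {W : N →* Matrix Y Y ℂ}
    (hW : IsUnitaryHom W) : (∑ w, W w).PosSemidef := by
  classical
  have := posSemidef_sum_subgroup hW ⊤
  simpa using this

/-- The Choi matrix of the difference is a product of two commuting positive matrices: that of the
full trace map, and `E` minus the class sum of the mismatch representation. -/
theorem overlapMap_cple {f : N → ℝ} (hWa : IsUnitaryHom Wa) (hWb : IsUnitaryHom Wb)
    (hWc : IsUnitaryHom Wc) [Nonempty β] (hf : ∀ w, 0 ≤ f w)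
    (htr : ∀ w, trace (Wb w) = (Fintype.card β * f w : ℝ)) (hinv : ∀ w, f w⁻¹ = f w)
    (hconj : ∀ v w, f (v * w * v⁻¹) = f w) {E : ℝ} (hE : ∑ w, f w ≤ E) :
    CPLE (overlapMap Wa Wb Wc)
      fun A => (E : ℂ) • traceMap (kronHom Wa (kronHom Wb Wc)) A := by
  have hW : IsUnitaryHom (kronHom Wa (kronHom Wb Wc)) := hWa.kronHom (hWb.kronHom hWc)
  have hC := (posSemidef_sum_hom (hW.kronHom hW.conjHom)).smul
    (a := (Fintype.card (α × β × γ) : ℂ)⁻¹) (by positivity)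
  have hR := posSemidef_smul_one_sub_classSum (isUnitaryHom_mismatchHom (α := α) hWb hWc) hf
    hinv hE
  have h := isCompletelyPositive_kernelMap (posSemidef_mul_of_commute hC hR (by
    rw [Matrix.mul_sub, Matrix.sub_mul, smul_sum_mul_mismatchHom_commute hconj,
      Matrix.mul_smul _ _ (1 : Matrix ((α × β × γ) × (α × β × γ)) _ ℂ),
      Matrix.smul_mul _ (1 : Matrix ((α × β × γ) × (α × β × γ)) _ ℂ), Matrix.mul_one,
      Matrix.one_mul]))
  have h2 : ∀ A, (E : ℂ) • traceMap (kronHom Wa (kronHom Wb Wc)) A - overlapMap Wa Wb Wc A =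
      kernelMap (((Fintype.card (α × β × γ) : ℂ)⁻¹ • ∑ w, kronHom (kronHom Wa (kronHom Wb Wc))
        (conjHom (kronHom Wa (kronHom Wb Wc))) w) * (E • 1 - ∑ w, f w • mismatchHom α Wb Wc w)) A :=
    fun A => by
      rw [Matrix.mul_sub, kernelMap_sub, overlapMap_eq_kernelMap hWb htr hconj,
        traceMap_eq_kernelMap, Matrix.mul_smul, Matrix.mul_one, ← Complex.coe_smul E]
      simp only [kernelMap_smul]
  unfold CPLE
  simp only [h2]
  exact h

theorem cple_overlapMap {f : N → ℝ} (hWa : IsUnitaryHom Wa) (hWb : IsUnitaryHom Wb)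
    (hWc : IsUnitaryHom Wc) [Nonempty β] (hf : ∀ w, 0 ≤ f w) (hone : f 1 = 1)
    (htr : ∀ w, trace (Wb w) = (Fintype.card β * f w : ℝ)) (hinv : ∀ w, f w⁻¹ = f w)
    (hconj : ∀ v w, f (v * w * v⁻¹) = f w) {E : ℝ} (hE : ∑ w, f w ≤ E) :
    CPLE (fun A => ((2 - E : ℝ) : ℂ) • traceMap (kronHom Wa (kronHom Wb Wc)) A)
      (overlapMap Wa Wb Wc) := by
  have hW : IsUnitaryHom (kronHom Wa (kronHom Wb Wc)) := hWa.kronHom (hWb.kronHom hWc)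
  have hC := (posSemidef_sum_hom (hW.kronHom hW.conjHom)).smul
    (a := (Fintype.card (α × β × γ) : ℂ)⁻¹) (by positivity)
  have hR := posSemidef_classSum_sub_smul_one (isUnitaryHom_mismatchHom (α := α) hWb hWc) hf
    hinv hone hE
  have h := isCompletelyPositive_kernelMap (posSemidef_mul_of_commute hC hR (by
    rw [Matrix.mul_sub, Matrix.sub_mul, smul_sum_mul_mismatchHom_commute hconj,
      Matrix.mul_smul _ _ (1 : Matrix ((α × β × γ) × (α × β × γ)) _ ℂ),
      Matrix.smul_mul _ (1 : Matrix ((α × β × γ) × (α × β × γ)) _ ℂ), Matrix.mul_one,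
      Matrix.one_mul]))
  have h2 : ∀ A, overlapMap Wa Wb Wc A -
      ((2 - E : ℝ) : ℂ) • traceMap (kronHom Wa (kronHom Wb Wc)) A =
      kernelMap (((Fintype.card (α × β × γ) : ℂ)⁻¹ • ∑ w, kronHom (kronHom Wa (kronHom Wb Wc))
        (conjHom (kronHom Wa (kronHom Wb Wc))) w) *
          ((∑ w, f w • mismatchHom α Wb Wc w) - (2 - E) • 1)) A :=
    fun A => by
      rw [Matrix.mul_sub, kernelMap_sub, overlapMap_eq_kernelMap hWb htr hconj,
        traceMap_eq_kernelMap, Matrix.mul_smul, Matrix.mul_one, ← Complex.coe_smul (2 - E)]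
      simp only [kernelMap_smul]
  unfold CPLE
  simp only [h2]
  exact h

end Composition

/-! ### Tensor products of families of matrices -/

section PiKron

variable {I : Type*} [Fintype I] {X Y Z : I → Type*}

/-- The tensor product of a finite family of matrices. -/
def piKron (M : ∀ i, Matrix (X i) (Y i) ℂ) : Matrix (∀ i, X i) (∀ i, Y i) ℂ :=
  Matrix.of fun x y => ∏ i, M i (x i) (y i)

theorem piKron_mul [DecidableEq I] [∀ i, Fintype (Y i)] (M : ∀ i, Matrix (X i) (Y i) ℂ)
    (N : ∀ i, Matrix (Y i) (Z i) ℂ) :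
    piKron M * piKron N = piKron fun i => M i * N i := by
  ext x z
  simp only [piKron, Matrix.mul_apply, Matrix.of_apply, ← Finset.prod_mul_distrib]
  rw [Finset.prod_univ_sum, Fintype.piFinset_univ]

theorem piKron_one [∀ i, DecidableEq (X i)] [DecidableEq (∀ i, X i)] :
    piKron (fun i => (1 : Matrix (X i) (X i) ℂ)) = 1 := by
  ext x y
  simp only [piKron, Matrix.of_apply, Matrix.one_apply, Finset.prod_ite_zero,
    Finset.prod_const_one, funext_iff, Finset.mem_univ, forall_true_left]

theorem piKron_conjTranspose (M : ∀ i, Matrix (X i) (Y i) ℂ) :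
    (piKron M)ᴴ = piKron fun i => (M i)ᴴ := by
  ext y x
  simp only [piKron, conjTranspose_apply, Matrix.of_apply, star_prod]

end PiKron

/-! ### Products of regular bases -/

section RegularBasis

variable {G : Type*} [Group G] {I : Type*}

/-- Labels of a product of regular bases, with the diagonal action of the group. -/
def RegBasis (G : Type*) {I : Type*} (d : I → ℕ) : Type _ := ∀ i, G × Fin (d i)

instance instFintypeRegBasis [Fintype I] [DecidableEq I] [Fintype G] (d : I → ℕ) :
    Fintype (RegBasis G d) :=
  inferInstanceAs (Fintype (∀ i, G × Fin (d i)))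

instance instDecidableEqRegBasis [Fintype I] [DecidableEq G] (d : I → ℕ) :
    DecidableEq (RegBasis G d) :=
  inferInstanceAs (DecidableEq (∀ i, G × Fin (d i)))

instance instMulActionRegBasis (d : I → ℕ) : MulAction G (RegBasis G d) where
  smul g z := fun i => (g * (z i).1, (z i).2)
  one_smul _ := funext fun _ => Prod.ext (one_mul _) rfl
  mul_smul _ _ _ := funext fun _ => Prod.ext (mul_assoc _ _ _) rfl

theorem regBasis_smul_apply (d : I → ℕ) (g : G) (z : RegBasis G d) (i : I) :
    (g • z) i = (g * (z i).1, (z i).2) := rfl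

end RegularBasis

/-! ### The on-site symmetry of a region -/

section Region

variable {G : Type u} [Group G] {ι : Type v} [DecidableEq ι] {q : ι → Type*}
  [∀ i, Fintype (q i)] [∀ i, DecidableEq (q i)]

/-- The on-site symmetry of a region as a representation. -/
def regionHom (R : ∀ i, G →* unitaryGroup (q i) ℂ) (S : Finset ι) :
    G →* Matrix (Conf q S) (Conf q S) ℂ where
  toFun g := regionRep R S g
  map_one' := by
    have h : regionRep R S 1 =
      piKron fun i : S => ((R i 1 : unitaryGroup (q i) ℂ) : Matrix _ _ ℂ) := rfl
    rw [h]
    simp only [map_one, UnitaryGroup.one_val, piKron_one]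
  map_mul' g h := by
    have e : ∀ g, regionRep R S g =
      piKron fun i : S => ((R i g : unitaryGroup (q i) ℂ) : Matrix _ _ ℂ) := fun _ => rfl
    simp only [e, piKron_mul, map_mul, UnitaryGroup.mul_val]

/-- In the product of the regular bases `G` acts diagonally by permutations, and one site already
makes the action free. The empty region carries the trivial representation, free only for trivial
`G`. -/
theorem isFreePermRep_regionHom [Fintype G] [DecidableEq G] {R : ∀ i, G →* unitaryGroup (q i) ℂ}
    (hR : ∀ i, IsRegularRep (R i)) {S : Finset ι} (hS : S.Nonempty ∨ Subsingleton G) :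
    IsFreePermRep.{max u v} (regionHom R S) := by
  choose d W hd hW hW' hRW using hR
  let T : Matrix (Conf q S) (RegBasis G fun i : S => d i) ℂ := piKron fun i : S => W i
  have hT : Tᴴ = piKron fun i : S => (W i)ᴴ := piKron_conjTranspose _
  refine ⟨RegBasis G fun i : S => d i, inferInstance, inferInstance, inferInstance, T, ?_, ?_, ?_,
    fun g => ?_⟩
  · rw [hT]
    exact (piKron_mul _ _).trans (by simp only [hW, piKron_one])
  · rw [hT]
    refine (piKron_mul _ _).trans ?_
    simp only [hW']
    exact piKron_one
  · intro g z hz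
    rcases hS with ⟨i, hi⟩ | hG
    · have := congrArg (fun z : RegBasis G fun i : S => d i => (z ⟨i, hi⟩).1) hz
      simpa [regBasis_smul_apply] using this
    · exact Subsingleton.elim _ _
  · have h1 : regionHom R S g = piKron fun i : S =>
        W i * kroneckerMap (· * ·) (regRep g) (1 : Matrix (Fin (d i)) (Fin (d i)) ℂ) * (W i)ᴴ := by
      simp only [← hRW]; rfl
    have h2 : permRep G (RegBasis G fun i : S => d i) g = piKron fun i : S =>
        kroneckerMap (· * ·) (regRep g) (1 : Matrix (Fin (d i)) (Fin (d i)) ℂ) := by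
      ext x y
      rw [permRep_apply]
      simp only [piKron, kroneckerMap_apply, regRep, Matrix.one_apply, mul_ite,
        mul_one, mul_zero, ← ite_and, Finset.prod_ite_zero, Finset.prod_const_one]
      refine if_congr ?_ rfl rfl
      refine (funext_iff (f := x) (g := g • y)).trans ?_
      simp only [regBasis_smul_apply, Prod.ext_iff, Finset.mem_univ, forall_true_left, and_comm]
    rw [h1, h2, hT]
    exact (piKron_mul _ _).symm.trans (congrArg (· * _) (piKron_mul _ _).symm)

theorem card_regular [Fintype G] [DecidableEq G] {X : Type*} [Fintype X] [DecidableEq X]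
    {R : G →* unitaryGroup X ℂ} (hR : IsRegularRep R) : Fintype.card G ≤ Fintype.card X := by
  obtain ⟨d, W, hd, hW, hW', -⟩ := hR
  rw [card_eq_of_unitary hW hW', Fintype.card_prod, Fintype.card_fin]
  exact Nat.le_mul_of_pos_right _ hd

theorem nonempty_conf [Fintype G] [DecidableEq G] {R : ∀ i, G →* unitaryGroup (q i) ℂ}
    (hR : ∀ i, IsRegularRep (R i)) (S : Finset ι) : Nonempty (Conf q S) := by
  have : ∀ i, Nonempty (q i) := fun i =>
    Fintype.card_pos_iff.mp (Fintype.card_pos.trans_le (card_regular (hR i)))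
  infer_instance

end Region

/-! ### Splitting a region into two parts -/

section Split

variable {G : Type*} [Group G] {ι : Type*} [DecidableEq ι] {q : ι → Type*}

/-- The restriction of configurations to a smaller region. -/
def restr {A S : Finset ι} (h : A ⊆ S) (x : Conf q S) : Conf q A := fun i => x ⟨i, h i.2⟩

/-- A region is the disjoint union of two others. -/
structure IsSplit (S A B : Finset ι) : Prop where
  disjoint : Disjoint A B
  union : A ∪ B = S

theorem IsSplit.left {S A B : Finset ι} (h : IsSplit S A B) : A ⊆ S :=
  h.union ▸ Finset.subset_union_left

theorem IsSplit.right {S A B : Finset ι} (h : IsSplit S A B) : B ⊆ S :=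
  h.union ▸ Finset.subset_union_right

theorem IsSplit.mem_right {S A B : Finset ι} (h : IsSplit S A B) {i : ι} (hi : i ∈ S)
    (hA : i ∉ A) : i ∈ B :=
  (Finset.mem_union.mp (h.union.symm ▸ hi)).resolve_left hA

/-- Splitting `k` copies of a region into `k` copies of two parts. -/
def splitEquiv {S A B : Finset ι} (h : IsSplit S A B) (k : ℕ) :
    (Fin k → Conf q S) ≃ (Fin k → Conf q A) × (Fin k → Conf q B) where
  toFun x := (fun i => restr h.left (x i), fun i => restr h.right (x i))
  invFun p i j := if hj : (j : ι) ∈ A then p.1 i ⟨j, hj⟩ else p.2 i ⟨j, h.mem_right j.2 hj⟩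
  left_inv x := by
    funext i j
    by_cases hj : (j : ι) ∈ A <;> simp [hj, restr]
  right_inv p := by
    refine Prod.ext (funext fun i => funext fun j => ?_) (funext fun i => funext fun j => ?_)
    · simp [restr]
    · have : (j : ι) ∉ A := fun hj => Finset.disjoint_left.mp h.disjoint hj j.2
      simp [restr, this]

variable [∀ i, Fintype (q i)] [∀ i, DecidableEq (q i)]

theorem IsSplit.prod_eq {S A B : Finset ι} (h : IsSplit S A B) (f : S → ℂ) :
    ∏ i, f i = (∏ i : A, f ⟨i, h.left i.2⟩) * ∏ i : B, f ⟨i, h.right i.2⟩ := by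
  let e : A ⊕ B → S := Sum.elim (fun i => ⟨i, h.left i.2⟩) (fun i => ⟨i, h.right i.2⟩)
  have he : Function.Bijective e := by
    constructor
    · rintro (⟨i, hi⟩ | ⟨i, hi⟩) (⟨j, hj⟩ | ⟨j, hj⟩) hij <;>
        simp only [e, Sum.elim_inl, Sum.elim_inr, Subtype.mk.injEq] at hij <;> subst hij
      · rfl
      · exact (Finset.disjoint_left.mp h.disjoint hi hj).elim
      · exact (Finset.disjoint_left.mp h.disjoint hj hi).elim
      · rfl
    · rintro ⟨i, hi⟩
      by_cases hA : i ∈ A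
      · exact ⟨Sum.inl ⟨i, hA⟩, rfl⟩
      · exact ⟨Sum.inr ⟨i, h.mem_right hi hA⟩, rfl⟩
  rw [← he.prod_comp, Fintype.prod_sum_type]
  rfl

theorem wreathRep_regionHom_split {S A B : Finset ι} (h : IsSplit S A B) (k : ℕ)
    (R : ∀ i, G →* unitaryGroup (q i) ℂ) (w : Wreath G k) :
    wreathRep k (regionHom R S) w = (kronHom (wreathRep k (regionHom R A))
      (wreathRep k (regionHom R B)) w).submatrix (splitEquiv h k) (splitEquiv h k) := by
  ext x y
  have h1 : ∀ T : Finset ι, ∀ x y : Fin k → Conf q T, wreathRep k (regionHom R T) w x y =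
      ∏ i, ∏ j : T, (R j (w.left i) : Matrix (q j) (q j) ℂ) (x i j) (y (w.right⁻¹ i) j) :=
    fun _ _ _ => rfl
  rw [Matrix.submatrix_apply, kronHom_apply, kronecker_apply, h1, h1, h1,
    ← Finset.prod_mul_distrib]
  exact Finset.prod_congr rfl fun i _ => h.prod_eq _

theorem card_conf_split {S A B : Finset ι} (h : IsSplit S A B) :
    Fintype.card (Conf q S) = Fintype.card (Conf q A) * Fintype.card (Conf q B) := by
  have := Fintype.card_congr (splitEquiv (q := q) h 1)
  simpa [Fintype.card_prod] using this

theorem tensorPow_extend {S A B : Finset ι} (h : IsSplit S A B) (k : ℕ)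
    (M : Matrix (Conf q A) (Conf q A) ℂ) :
    tensorPow k (extend h.left M) = (tensorPow k M ⊗ₖ (1 : Matrix (Fin k → Conf q B)
      (Fin k → Conf q B) ℂ)).submatrix (splitEquiv h k) (splitEquiv h k) := by
  ext x y
  have h1 : (if (fun i => restr h.right (x i)) = (fun i => restr (q := q) h.right (y i))
      then (1 : ℂ) else 0) =
      ∏ i : Fin k, if ∀ j : S, (j : ι) ∉ A → x i j = y i j then 1 else 0 := by
    by_cases H : ∀ (i : Fin k) (j : S), (j : ι) ∉ A → x i j = y i j
    · rw [Finset.prod_eq_one fun i _ => if_pos (H i), if_pos]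
      exact funext fun i => funext fun j =>
        H i ⟨j, h.right j.2⟩ fun hj => Finset.disjoint_left.mp h.disjoint hj j.2
    · push Not at H
      obtain ⟨i, j, hj, hne⟩ := H
      rw [Finset.prod_eq_zero (Finset.mem_univ i) (if_neg fun hi => hne (hi j hj)), if_neg]
      exact fun hxy => hne (congrFun (congrFun hxy i) ⟨j, h.mem_right j.2 hj⟩)
  simp only [Matrix.submatrix_apply]
  change _ = (∏ i, _) * (if (fun i => restr h.right (x i)) = (fun i => restr (q := q) h.right (y i))
    then (1 : ℂ) else 0)
  rw [h1, ← Finset.prod_mul_distrib]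
  rfl

end Split

/-! ### Operators extended by the identity -/

section Extend

variable {G : Type*} {ι : Type*} [DecidableEq ι] {q : ι → Type*}

/-- The basis labels of a region, split into those of two parts. -/
def splitConf {S A B : Finset ι} (h : IsSplit S A B) : Conf q S ≃ Conf q A × Conf q B where
  toFun x := (restr h.left x, restr h.right x)
  invFun p j := if hj : (j : ι) ∈ A then p.1 ⟨j, hj⟩ else p.2 ⟨j, h.mem_right j.2 hj⟩
  left_inv x := by
    funext j
    by_cases hj : (j : ι) ∈ A <;> simp [hj, restr]
  right_inv p := by
    refine Prod.ext (funext fun j => ?_) (funext fun j => ?_)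
    · simp [restr]
    · have : (j : ι) ∉ A := fun hj => Finset.disjoint_left.mp h.disjoint hj j.2
      simp [restr, this]

theorem isSplit_sdiff {A S : Finset ι} (h : A ⊆ S) : IsSplit S A (S \ A) :=
  ⟨Finset.disjoint_sdiff, Finset.union_sdiff_of_subset h⟩

variable [∀ i, Fintype (q i)] [∀ i, DecidableEq (q i)] {S A B : Finset ι}

theorem extend_eq_kronecker (h : IsSplit S A B) (M : Matrix (Conf q A) (Conf q A) ℂ) :
    extend h.left M = (M ⊗ₖ (1 : Matrix (Conf q B) (Conf q B) ℂ)).submatrix (splitConf h)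
      (splitConf h) := by
  ext x y
  rw [Matrix.submatrix_apply, kronecker_apply, Matrix.one_apply]
  refine congrArg (_ * ·) (if_congr ?_ rfl rfl)
  rw [funext_iff]
  exact ⟨fun hi j => hi ⟨j, h.right j.2⟩ fun hj => Finset.disjoint_left.mp h.disjoint hj j.2,
    fun hi j hj => hi ⟨j, h.mem_right j.2 hj⟩⟩

theorem extend_mul (h : A ⊆ S) (M N : Matrix (Conf q A) (Conf q A) ℂ) :
    extend h (M * N) = extend h M * extend h N := by
  rw [extend_eq_kronecker (isSplit_sdiff h), extend_eq_kronecker (isSplit_sdiff h),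
    extend_eq_kronecker (isSplit_sdiff h), Matrix.submatrix_mul_equiv, ← mul_kronecker_mul,
    Matrix.one_mul]

theorem extend_one (h : A ⊆ S) : extend h (1 : Matrix (Conf q A) (Conf q A) ℂ) = 1 := by
  rw [extend_eq_kronecker (isSplit_sdiff h), one_kronecker_one, Matrix.submatrix_one_equiv]

theorem extend_conjTranspose (h : A ⊆ S) (M : Matrix (Conf q A) (Conf q A) ℂ) :
    (extend h M)ᴴ = extend h Mᴴ := by
  rw [extend_eq_kronecker (isSplit_sdiff h), extend_eq_kronecker (isSplit_sdiff h),
    conjTranspose_submatrix, conjTranspose_kronecker, conjTranspose_one]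

theorem extend_mem_unitary (h : A ⊆ S) {M : Matrix (Conf q A) (Conf q A) ℂ}
    (hM : M ∈ unitaryGroup (Conf q A) ℂ) : extend h M ∈ unitaryGroup (Conf q S) ℂ := by
  rw [mem_unitaryGroup_iff] at hM ⊢
  rw [star_eq_conjTranspose] at hM ⊢
  rw [extend_conjTranspose, ← extend_mul, hM, extend_one]

theorem extend_self (h : S ⊆ S) (M : Matrix (Conf q S) (Conf q S) ℂ) : extend h M = M := by
  ext x y
  have h1 : ∀ i : S, (i : ι) ∉ S → x i = y i := fun i hi => (hi i.2).elim
  change M x y * (if ∀ i : S, (i : ι) ∉ S → x i = y i then 1 else 0) = _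
  rw [if_pos h1, mul_one]

theorem extend_extend {T : Finset ι} (h : A ⊆ S) (h' : S ⊆ T)
    (M : Matrix (Conf q A) (Conf q A) ℂ) :
    extend h' (extend h M) = extend (h.trans h') M := by
  ext x y
  simp only [extend, mul_assoc]
  refine congrArg (_ * ·) ?_
  rw [mul_ite, mul_one, mul_zero, ← ite_and]
  refine if_congr ⟨fun hi j hj => ?_, fun hi => ⟨fun j hj => hi j fun hA => hj (h hA),
    fun j hj => hi ⟨j, h' j.2⟩ hj⟩⟩ rfl rfl
  by_cases hS : (j : ι) ∈ S
  · exact hi.2 ⟨j, hS⟩ hj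
  · exact hi.1 j hS

theorem IsSplit.symm (h : IsSplit S A B) : IsSplit S B A :=
  ⟨h.disjoint.symm, by rw [Finset.union_comm, h.union]⟩

theorem extend_eq_kronecker_right (h : IsSplit S A B) (M : Matrix (Conf q B) (Conf q B) ℂ) :
    extend h.right M = ((1 : Matrix (Conf q A) (Conf q A) ℂ) ⊗ₖ M).submatrix (splitConf h)
      (splitConf h) := by
  have h1 := extend_eq_kronecker h.symm M
  refine Eq.trans h1 ?_
  ext x y
  simp only [Matrix.submatrix_apply]
  exact mul_comm _ _

/-- Operators with disjoint supports commute. -/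
theorem extend_commute (hA : A ⊆ S) (hB : B ⊆ S) (hd : Disjoint A B)
    (M : Matrix (Conf q A) (Conf q A) ℂ) (N : Matrix (Conf q B) (Conf q B) ℂ) :
    extend hA M * extend hB N = extend hB N * extend hA M := by
  have h : IsSplit (A ∪ B) A B := ⟨hd, rfl⟩
  have hS := Finset.union_subset hA hB
  rw [← extend_extend h.left hS, ← extend_extend h.right hS, ← extend_mul, ← extend_mul,
    extend_eq_kronecker h, extend_eq_kronecker_right h, Matrix.submatrix_mul_equiv,
    Matrix.submatrix_mul_equiv, ← mul_kronecker_mul, ← mul_kronecker_mul]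
  simp only [Matrix.one_mul, Matrix.mul_one]

theorem regionRep_split {G : Type*} [Group G] (h : IsSplit S A B)
    (R : ∀ i, G →* unitaryGroup (q i) ℂ) (g : G) :
    regionRep R S g = (regionRep R A g ⊗ₖ regionRep R B g).submatrix (splitConf h)
      (splitConf h) := by
  ext x y
  exact h.prod_eq _

theorem extend_commute_regionRep {G : Type*} [Group G] (h : A ⊆ S)
    {R : ∀ i, G →* unitaryGroup (q i) ℂ} {M : Matrix (Conf q A) (Conf q A) ℂ} {g : G}
    (hM : M * regionRep R A g = regionRep R A g * M) :
    extend h M * regionRep R S g = regionRep R S g * extend h M := by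
  rw [extend_eq_kronecker (isSplit_sdiff h), regionRep_split (isSplit_sdiff h),
    Matrix.submatrix_mul_equiv, Matrix.submatrix_mul_equiv, ← mul_kronecker_mul,
    ← mul_kronecker_mul, hM, Matrix.one_mul, Matrix.mul_one]

theorem measurable_extend {Ω : Type*} [MeasurableSpace Ω] (h : A ⊆ S)
    {U : Ω → Matrix (Conf q A) (Conf q A) ℂ} (hU : ∀ x y, Measurable fun ω => U ω x y)
    (x y : Conf q S) : Measurable fun ω => extend h (U ω) x y :=
  (hU _ _).mul_const _

theorem kronecker_one_conj_apply {α β : Type*} [Fintype α] [Fintype β] [DecidableEq β]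
    (t : Matrix α α ℂ) (M : Matrix (α × β) (α × β) ℂ) (p p' : α × β) :
    ((t ⊗ₖ (1 : Matrix β β ℂ)) * M * (t ⊗ₖ (1 : Matrix β β ℂ))ᴴ) p p' =
      (t * (Matrix.of fun a a' => M (a, p.2) (a', p'.2)) * tᴴ) p.1 p'.1 := by
  rw [conj_apply, conj_apply]
  simp [Fintype.sum_prod_type, Matrix.one_apply, ite_mul, mul_ite, apply_ite (starRingEnd ℂ)]

theorem twirl_extend {Ω : Type*} [MeasurableSpace Ω] (P : Measure Ω) (h : IsSplit S A B) (k : ℕ)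
    (U : Ω → Matrix (Conf q A) (Conf q A) ℂ) :
    twirl P (fun ω => extend h.left (U ω)) k =
      conjMap (splitEquiv h k) (ampMap (Fin k → Conf q B) (twirl P U k)) := by
  funext M
  ext x y
  refine integral_congr_ae (Filter.Eventually.of_forall fun ω => ?_)
  have h1 : M = (M.submatrix (splitEquiv h k).symm (splitEquiv h k).symm).submatrix
      (splitEquiv h k) (splitEquiv h k) := by
    ext a b; simp
  change (tensorPow k (extend h.left (U ω)) * M * (tensorPow k (extend h.left (U ω)))ᴴ) x y = _
  conv_lhs => rw [h1]
  rw [tensorPow_extend h, conjTranspose_submatrix, Matrix.submatrix_mul_equiv,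
    Matrix.submatrix_mul_equiv, Matrix.submatrix_apply, kronecker_one_conj_apply]

end Extend

/-! ### Twirls of independent products -/

section Independence

open ProbabilityTheory

variable {X : Type*} [Fintype X] [DecidableEq X] {Ω : Type*} [MeasurableSpace Ω]
  {P : Measure Ω} [IsProbabilityMeasure P]

/-- Independence of two random matrices. -/
def IndepMatrix {X Y : Type*} (P : Measure Ω) (U : Ω → Matrix X X ℂ) (V : Ω → Matrix Y Y ℂ) :
    Prop :=
  IndepFun (fun ω (p : X × X) => U ω p.1 p.2) (fun ω (p : Y × Y) => V ω p.1 p.2) P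

theorem IndepMatrix.symm {X Y : Type*} {U : Ω → Matrix X X ℂ} {V : Ω → Matrix Y Y ℂ}
    (h : IndepMatrix P U V) : IndepMatrix P V U :=
  IndepFun.symm h

/-- Each entry is a finite sum of products of a function of `U` and a function of `V`, and
expectations of independent factors multiply. -/
theorem twirl_mul {U V : Ω → Matrix X X ℂ}
    (hUm : ∀ x y, Measurable fun ω => U ω x y) (hU : ∀ ω, U ω ∈ unitaryGroup X ℂ)
    (hVm : ∀ x y, Measurable fun ω => V ω x y) (hV : ∀ ω, V ω ∈ unitaryGroup X ℂ)
    (h : IndepMatrix P U V) (k : ℕ) (A : Matrix (Fin k → X) (Fin k → X) ℂ) :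
    twirl P (fun ω => U ω * V ω) k A = twirl P U k (twirl P V k A) := by
  rw [twirl_eq_kernelMap hUm hU]
  have h1 : ∀ x y u v : Fin k → X, IndepFun
      (fun ω => tensorPow k (U ω) x u * star (tensorPow k (U ω) y v))
      (fun ω => (tensorPow k (V ω) * A * (tensorPow k (V ω))ᴴ) u v) P := fun x y u v => by
    have h2 : Measurable fun m : X × X → ℂ =>
        (∏ i, m (x i, u i)) * star (∏ i, m (y i, v i)) := by fun_prop
    have h3 : Measurable fun m : X × X → ℂ => ∑ s, ∑ t,
        (∏ i, m (u i, s i)) * star (∏ i, m (v i, t i)) * A s t := by fun_prop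
    have h4 := IndepFun.comp h h2 h3
    simp only [conj_apply]
    exact h4
  ext x y
  have h2 : ∀ ω, (tensorPow k (U ω * V ω) * A * (tensorPow k (U ω * V ω))ᴴ) x y =
      ∑ u, ∑ v, (tensorPow k (U ω) x u * star (tensorPow k (U ω) y v)) *
        (tensorPow k (V ω) * A * (tensorPow k (V ω))ᴴ) u v := fun ω => by
    rw [← conj_apply, tensorPow_mul, conjTranspose_mul]
    simp only [Matrix.mul_assoc]
  have hint : ∀ u v, Integrable (fun ω => (tensorPow k (U ω) x u * star (tensorPow k (U ω) y v)) *
        (tensorPow k (V ω) * A * (tensorPow k (V ω))ᴴ) u v) P := fun u v =>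
    (h1 x y u v).integrable_mul (integrable_tensorPow_mul hUm hU k x u y v)
      (integrable_conj_tensorPow hVm hV k A u v)
  simp only [twirl, h2, kernelMap, Matrix.of_apply, twirlChoi]
  refine (integral_finsetSum _ fun u _ => integrable_finsetSum _ fun v _ => hint u v).trans ?_
  refine Finset.sum_congr rfl fun u _ => ?_
  refine (integral_finsetSum _ fun v _ => hint u v).trans ?_
  refine Finset.sum_congr rfl fun v _ => ?_
  exact (h1 x y u v).integral_fun_mul_eq_mul_integral
    (integrable_tensorPow_mul hUm hU k x u y v).aestronglyMeasurable
    (integrable_conj_tensorPow hVm hV k A u v).aestronglyMeasurable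

theorem twirl_comp_measurePreserving {Ω' : Type*} [MeasurableSpace Ω'] {Q : Measure Ω'}
    {f : Ω' → Ω} (hf : MeasurePreserving f Q P) {U : Ω → Matrix X X ℂ}
    (hUm : ∀ x y, Measurable fun ω => U ω x y) (hU : ∀ ω, U ω ∈ unitaryGroup X ℂ) (k : ℕ) :
    twirl Q (fun ω => U (f ω)) k = twirl P U k := by
  funext A
  ext x y
  have h := integrable_conj_tensorPow (P := P) hUm hU k A x y
  have h1 := integral_map (μ := Q) hf.measurable.aemeasurable
    (f := fun ω => (tensorPow k (U ω) * A * (tensorPow k (U ω))ᴴ) x y)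
    (by rw [hf.map_eq]; exact h.aestronglyMeasurable)
  rw [hf.map_eq] at h1
  exact h1.symm

theorem measurable_extend_entries {ι : Type*} [DecidableEq ι] {q : ι → Type*}
    [∀ i, DecidableEq (q i)] [∀ i, Fintype (q i)] {A S : Finset ι} (hA : A ⊆ S) :
    Measurable fun (m : Conf q A × Conf q A → ℂ) (p : Conf q S × Conf q S) =>
      extend hA (Matrix.of fun x y => m (x, y)) p.1 p.2 := by
  refine measurable_pi_lambda _ fun p => ?_
  have h1 : Measurable fun m : Conf q A × Conf q A → ℂ => m (restr hA p.1, restr hA p.2) :=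
    measurable_pi_apply _
  exact h1.mul_const _

theorem IndepMatrix.extend {ι : Type*} [DecidableEq ι] {q : ι → Type*} [∀ i, DecidableEq (q i)]
    [∀ i, Fintype (q i)]
    {A B S : Finset ι} (hA : A ⊆ S) (hB : B ⊆ S) {U : Ω → Matrix (Conf q A) (Conf q A) ℂ}
    {V : Ω → Matrix (Conf q B) (Conf q B) ℂ} (h : IndepMatrix P U V) :
    IndepMatrix P (fun ω => SymDesign.extend hA (U ω)) (fun ω => SymDesign.extend hB (V ω)) := by
  have h4 := IndepFun.comp h (measurable_extend_entries hA) (measurable_extend_entries hB)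
  exact h4

end Independence

/-! ### Two-sided multiplicative closeness of maps -/

section Closeness

variable {Y : Type v} [Fintype Y]

/-- `Φ` lies between `l • Ψ` and `u • Ψ`, for some `l ≥ 0` with `2 - u ≤ l`. -/
structure IsClose (u : ℝ) (Φ Ψ : Matrix Y Y ℂ → Matrix Y Y ℂ) : Prop where
  one_le : 1 ≤ u
  upper : CPLE Φ fun A => (u : ℂ) • Ψ A
  lower : ∃ l : ℝ, 0 ≤ l ∧ 2 - u ≤ l ∧ CPLE (fun A => (l : ℂ) • Ψ A) Φ

/-- If `u u' ≥ 2` the left side is at most zero. Otherwise it follows from `(2 - u)(2 - u') - (2 - u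
u') = 2(u - 1)(u' - 1) ≥ 0`. Lower bounds therefore compose automatically and only the upper
constants need tracking. -/
theorem two_sub_mul_le {u u' l l' : ℝ} (hu : 1 ≤ u) (hu' : 1 ≤ u') (hl : 0 ≤ l) (hl' : 0 ≤ l')
    (h : 2 - u ≤ l) (h' : 2 - u' ≤ l') : 2 - u * u' ≤ l * l' := by
  by_cases h1 : 2 ≤ u * u'
  · have := mul_nonneg hl hl'
    linarith
  · have h2 : u ≤ 2 := by nlinarith
    have h3 : u' ≤ 2 := by nlinarith
    have h4 : (2 - u) * (2 - u') ≤ l * l' := mul_le_mul h h' (by linarith) hl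
    nlinarith [mul_nonneg (sub_nonneg.mpr hu) (sub_nonneg.mpr hu')]

variable {Φ Ψ Ξ Φ' Ψ' : Matrix Y Y ℂ → Matrix Y Y ℂ} {u u' : ℝ}

theorem IsClose.trans (h : IsClose u Φ Ψ) (h' : IsClose u' Ψ Ξ) : IsClose (u * u') Φ Ξ := by
  obtain ⟨l, hl, hlu, hlow⟩ := h.lower
  obtain ⟨l', hl', hlu', hlow'⟩ := h'.lower
  refine ⟨one_le_mul_of_one_le_of_one_le h.one_le h'.one_le, ?_, l * l', mul_nonneg hl hl',
    two_sub_mul_le h.one_le h'.one_le hl hl' hlu hlu', ?_⟩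
  · have := h.upper.trans (h'.upper.smul (zero_le_one.trans h.one_le))
    simpa only [smul_smul, ← Complex.ofReal_mul] using this
  · have := (hlow'.smul hl).trans hlow
    simpa only [smul_smul, ← Complex.ofReal_mul] using this

theorem IsClose.comp (h : IsClose u Φ Ψ) (h' : IsClose u' Φ' Ψ') (hΦ : IsCompletelyPositive Φ)
    (hΨ : IsCompletelyPositive Ψ) (hΦ' : IsCompletelyPositive Φ') (hΨ' : IsCompletelyPositive Ψ') :
    IsClose (u * u') (fun A => Φ (Φ' A)) (fun A => Ψ (Ψ' A)) := by
  obtain ⟨l, hl, hlu, hlow⟩ := h.lower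
  obtain ⟨l', hl', hlu', hlow'⟩ := h'.lower
  refine ⟨one_le_mul_of_one_le_of_one_le h.one_le h'.one_le, ?_, l * l', mul_nonneg hl hl',
    two_sub_mul_le h.one_le h'.one_le hl hl' hlu hlu', ?_⟩
  · have := h.upper.comp h'.upper hΦ' (hΨ.smul (zero_le_one.trans h.one_le))
    simpa only [hΨ.1.map_smul, smul_smul, ← Complex.ofReal_mul] using this
  · have := hlow.comp hlow' (hΨ'.smul hl') hΦ
    simpa only [hΨ.1.map_smul, smul_smul, ← Complex.ofReal_mul] using this

theorem IsClose.ampMap (h : IsClose u Φ Ψ) (Z : Type*) [Fintype Z] :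
    IsClose u (SymDesign.ampMap Z Φ) (SymDesign.ampMap Z Ψ) := by
  obtain ⟨l, hl, hlu, hlow⟩ := h.lower
  exact ⟨h.one_le, h.upper.ampMap Z, l, hl, hlu, hlow.ampMap Z⟩

theorem IsClose.conjMap {Y' : Type v'} [Fintype Y'] (h : IsClose u Φ Ψ) (e : Y' ≃ Y) :
    IsClose u (SymDesign.conjMap e Φ) (SymDesign.conjMap e Ψ) := by
  obtain ⟨l, hl, hlu, hlow⟩ := h.lower
  exact ⟨h.one_le, h.upper.conjMap e, l, hl, hlu, hlow.conjMap e⟩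

end Closeness

/-! ### Approximate designs in terms of closeness -/

section Designs

variable {G : Type u} {X : Type v} [Fintype X] [DecidableEq X] {ρ : G → Matrix X X ℂ} {k : ℕ}
  {ε : ℝ} {Ω : Type w} [MeasurableSpace Ω] {P : Measure Ω} [IsProbabilityMeasure P]
  {U : Ω → Matrix X X ℂ}

theorem IsApproxSymDesign.isCompletelyPositive (h : IsApproxSymDesign ρ k ε P U) :
    IsCompletelyPositive (twirl P U k) :=
  isCompletelyPositive_twirl h.measurable h.unitary k

/-- Twirls fix the identity, so the upper bound evaluated there reads `1 ≤ 1 + ε`. -/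
theorem IsApproxSymDesign.nonneg [Nonempty X] (h : IsApproxSymDesign ρ k ε P U) : 0 ≤ ε := by
  have h1 := h.upper.2 1 1 PosSemidef.one
  obtain ⟨y⟩ : Nonempty (Fin k → X) := inferInstance
  have h2 := h1.diag_nonneg (i := (y, 0))
  have h3 : (Matrix.of fun a b : Fin k → X =>
      (1 : Matrix ((Fin k → X) × Fin 1) ((Fin k → X) × Fin 1) ℂ) (a, 0) (b, 0))
      = 1 := by
    ext a b
    simp [Matrix.one_apply]
  simp only [Matrix.of_apply] at h2
  rw [h3, twirl_one symVal_mem, twirl_one h.unitary] at h2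
  have h4 : (0 : ℂ) ≤ (ε : ℂ) := by simpa using h2
  exact_mod_cast h4

theorem IsApproxSymDesign.isClose [Nonempty X] (h : IsApproxSymDesign ρ k ε P U) :
    IsClose (1 + ε) (twirl P U k) (haarTwirl ρ k) := by
  -- For `ε > 1` the lower constant `1 - ε` is negative; it is replaced by `0`, using that the twirl
  -- is completely positive.
  refine ⟨by linarith [h.nonneg], h.upper, max 0 (1 - ε), le_max_left _ _,
    le_max_of_le_right (by linarith), ?_⟩
  rcases le_total (1 - ε) 0 with h1 | h1
  · rw [max_eq_left h1]
    have := h.isCompletelyPositive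
    unfold CPLE
    simpa using this
  · rw [max_eq_right h1]
    exact h.lower

theorem IsClose.isApproxSymDesign {u : ℝ} (h : IsClose u (twirl P U k) (haarTwirl ρ k))
    (hm : ∀ x y, Measurable fun ω => U ω x y) (hU : ∀ ω, U ω ∈ unitaryGroup X ℂ)
    (hs : ∀ ω g, U ω * ρ g = ρ g * U ω) : IsApproxSymDesign ρ k (u - 1) P U := by
  obtain ⟨l, -, hlu, hlow⟩ := h.lower
  refine ⟨hm, hU, hs, ((isCompletelyPositive_haarTwirl k).cple_smul (by linarith)).trans hlow, ?_⟩
  have := h.upper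
  rwa [show 1 + (u - 1) = u by ring]

theorem IsApproxSymDesign.mono {ε' : ℝ} (h : IsApproxSymDesign ρ k ε P U) (hε : ε ≤ ε') :
    IsApproxSymDesign ρ k ε' P U :=
  ⟨h.measurable, h.unitary, h.symmetric,
    ((isCompletelyPositive_haarTwirl k).cple_smul (by linarith)).trans h.lower,
    h.upper.trans ((isCompletelyPositive_haarTwirl k).cple_smul (by linarith))⟩

theorem isApproxSymDesign_zero_copies (hε : 0 ≤ ε)
    (hm : ∀ x y, Measurable fun ω => U ω x y) (hU : ∀ ω, U ω ∈ unitaryGroup X ℂ)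
    (hs : ∀ ω g, U ω * ρ g = ρ g * U ω) : IsApproxSymDesign ρ 0 ε P U := by
  have h1 : twirl P U 0 = haarTwirl ρ 0 := by
    funext A
    rw [twirl_zero_copies, haarTwirl, twirl_zero_copies]
  have h2 : IsClose 1 (twirl P U 0) (haarTwirl ρ 0) := by
    have h3 : CPLE (haarTwirl ρ 0) (fun A => ((1 : ℝ) : ℂ) • haarTwirl ρ 0 A) := by
      simpa using CPLE.refl (haarTwirl ρ 0)
    have h4 : CPLE (fun A => ((1 : ℝ) : ℂ) • haarTwirl ρ 0 A) (haarTwirl ρ 0) := by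
      simpa using CPLE.refl (haarTwirl ρ 0)
    rw [h1]
    exact ⟨le_rfl, h3, 1, zero_le_one, by norm_num, h4⟩
  exact (h2.isApproxSymDesign hm hU hs).mono (by linarith)

theorem isApproxSymDesign_symHaar : IsApproxSymDesign ρ k 0 (symHaar ρ) (symVal ρ) :=
  ⟨measurable_symVal, symVal_mem, symVal_commute, by simpa using CPLE.refl (haarTwirl ρ k),
    by simpa using CPLE.refl (haarTwirl ρ k)⟩

theorem IsApproxSymDesign.comp_measurePreserving {Ω' : Type*} [MeasurableSpace Ω'] {Q : Measure Ω'}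
    (h : IsApproxSymDesign ρ k ε P U) {f : Ω' → Ω} (hf : MeasurePreserving f Q P) :
    IsApproxSymDesign ρ k ε Q fun ω => U (f ω) := by
  have h1 := twirl_comp_measurePreserving hf h.measurable h.unitary k
  exact ⟨fun x y => (h.measurable x y).comp hf.measurable, fun ω => h.unitary _,
    fun ω => h.symmetric _, h1 ▸ h.lower, h1 ▸ h.upper⟩

end Designs

/-! ### Closeness of Haar twirl and trace map -/

section TraceMaps

theorem isCompletelyPositive_traceMap {N : Type*} [Group N] [Fintype N] {Y : Type*} [Fintype Y]
    [DecidableEq Y] {W : N →* Matrix Y Y ℂ} (hW : IsUnitaryHom W) :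
    IsCompletelyPositive (traceMap W) := by
  have h1 : traceMap W = kernelMap ((Fintype.card Y : ℂ)⁻¹ • ∑ w, kronHom W (conjHom W) w) :=
    funext (traceMap_eq_kernelMap W)
  rw [h1]
  exact isCompletelyPositive_kernelMap ((posSemidef_sum_hom (hW.kronHom hW.conjHom)).smul
    (a := (Fintype.card Y : ℂ)⁻¹) (by positivity))

theorem traceMap_submatrix {N : Type*} [Group N] [Fintype N] {Y Y' : Type*} [Fintype Y]
    [DecidableEq Y] [Fintype Y'] [DecidableEq Y'] {W : N →* Matrix Y Y ℂ}
    {W' : N →* Matrix Y' Y' ℂ} (e : Y' ≃ Y) (h : ∀ w, W' w = (W w).submatrix e e) :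
    traceMap W' = conjMap e (traceMap W) := by
  funext A
  have h1 : ∀ w, trace (A * (W' w)ᴴ) = trace (A.submatrix e.symm e.symm * (W w)ᴴ) := fun w => by
    rw [trace_mul_conjTranspose, trace_mul_conjTranspose, ← e.sum_comp]
    refine Finset.sum_congr rfl fun x _ => ?_
    rw [← e.sum_comp]
    refine Finset.sum_congr rfl fun y _ => ?_
    simp [h]
  ext x y
  have h2 : ∀ w, W' w x y = W w (e x) (e y) := fun w => by rw [h, Matrix.submatrix_apply]
  simp only [traceMap, conjMap, h1, h2, Fintype.card_congr e, Matrix.submatrix_apply,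
    Matrix.smul_apply, Matrix.sum_apply]

theorem exp_le_one_add_two_mul {t : ℝ} (h0 : 0 ≤ t) (h1 : t ≤ 1 / 2) :
    Real.exp t ≤ 1 + 2 * t := by
  have h2 : 1 - t ≤ Real.exp (-t) := by linarith [Real.add_one_le_exp (-t)]
  have h3 : Real.exp t * Real.exp (-t) = 1 := by rw [← Real.exp_add]; simp
  have h4 := Real.exp_pos t
  nlinarith

variable {G : Type u} [Group G] [Fintype G] {X : Type v} [Fintype X] [DecidableEq X] [Nonempty X]
  {ρ : G →* Matrix X X ℂ} {k : ℕ}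

theorem collision_bounds (k : ℕ) {Γ D : ℝ} (hΓ : 0 ≤ Γ) (hD : 0 < D) (hk : (k : ℝ) ^ 2 * Γ ≤ D) :
    0 ≤ (k : ℝ) * (k - 1) * Γ / (2 * D) ∧
      (k : ℝ) * (k - 1) * Γ / (2 * D) ≤ (k : ℝ) ^ 2 * Γ / (2 * D) ∧
      (k : ℝ) ^ 2 * Γ / (2 * D) ≤ 1 / 2 := by
  have h1 : 0 ≤ (k : ℝ) * (k - 1) := by
    rcases Nat.eq_zero_or_pos k with rfl | hk0
    · simp
    · have : (1 : ℝ) ≤ k := by exact_mod_cast hk0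
      exact mul_nonneg (by linarith) (by linarith)
  refine ⟨by positivity, ?_, ?_⟩
  · gcongr
    nlinarith [(Nat.cast_nonneg k : (0 : ℝ) ≤ k)]
  · rw [div_le_div_iff₀ (by positivity) two_pos]
    linarith

theorem mul_card_le_of_sq (hk : (k : ℝ) ^ 2 * Fintype.card G ≤ Fintype.card X) :
    k * Fintype.card G ≤ Fintype.card X := by
  have h1 : k ^ 2 * Fintype.card G ≤ Fintype.card X := by exact_mod_cast hk
  refine le_trans (Nat.mul_le_mul_right _ ?_) h1
  rw [sq]
  exact Nat.le_mul_self k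

theorem IsFreePermRep.isClose_haarTwirl_traceMap (h : IsFreePermRep.{w} ρ)
    (hk : (k : ℝ) ^ 2 * Fintype.card G ≤ Fintype.card X) :
    IsClose (1 - (k : ℝ) ^ 2 * Fintype.card G / (2 * Fintype.card X))⁻¹ (haarTwirl ρ k)
      (traceMap (wreathRep k ρ)) := by
  obtain ⟨h0, h1, h2⟩ := collision_bounds k (Γ := Fintype.card G) (D := Fintype.card X)
    (Nat.cast_nonneg _) (Nat.cast_pos.mpr Fintype.card_pos) hk
  have hu := h.haarTwirl_cple_traceMap (mul_card_le_of_sq hk)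
  have hl := h.traceMap_cple_haarTwirl (mul_card_le_of_sq hk)
  have hτ : IsCompletelyPositive (traceMap (wreathRep k ρ)) :=
    isCompletelyPositive_traceMap (wreathRep_conjTranspose h.conjTranspose)
  set t : ℝ := (k : ℝ) * (k - 1) * Fintype.card G / (2 * Fintype.card X)
  set x : ℝ := (k : ℝ) ^ 2 * Fintype.card G / (2 * Fintype.card X)
  have hx : 0 < 1 - x := by linarith
  have ht : 0 < 1 - t := by linarith
  -- The lower constant is admissible since `2 - (1 - x)⁻¹ ≤ 1 - x ≤ 1 - t ≤ e^{-t}`.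
  refine ⟨(one_le_inv₀ hx).mpr (by linarith), ?_, Real.exp (-t), (Real.exp_pos _).le, ?_, ?_⟩
  · have h3 := (hu.smul (inv_pos.mpr ht).le).trans
      (hτ.cple_smul (inv_anti₀ hx (by linarith : 1 - x ≤ 1 - t)))
    simpa only [smul_smul, ← Complex.ofReal_mul, inv_mul_cancel₀ ht.ne', Complex.ofReal_one,
      one_smul] using h3
  · have h3 : 1 - t ≤ Real.exp (-t) := by linarith [Real.add_one_le_exp (-t)]
    have h4 : 1 + x ≤ (1 - x)⁻¹ := by
      rw [le_inv_comm₀ (by linarith) hx, inv_eq_one_div, le_div_iff₀ (by linarith)]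
      nlinarith
    linarith
  · have h3 := hl.smul (Real.exp_pos (-t)).le
    simpa only [smul_smul, ← Complex.ofReal_mul, ← Real.exp_add, neg_add_cancel, Real.exp_zero,
      Complex.ofReal_one, one_smul] using h3

theorem IsFreePermRep.isClose_traceMap_haarTwirl (h : IsFreePermRep.{w} ρ)
    (hk : (k : ℝ) ^ 2 * Fintype.card G ≤ Fintype.card X) :
    IsClose (1 + (k : ℝ) ^ 2 * Fintype.card G / Fintype.card X) (traceMap (wreathRep k ρ))
      (haarTwirl ρ k) := by
  have hX : (0 : ℝ) < Fintype.card X := Nat.cast_pos.mpr Fintype.card_pos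
  obtain ⟨h0, h1, h2⟩ := collision_bounds k (Γ := Fintype.card G) (D := Fintype.card X)
    (Nat.cast_nonneg _) hX hk
  have hu := h.haarTwirl_cple_traceMap (mul_card_le_of_sq hk)
  have hl := h.traceMap_cple_haarTwirl (mul_card_le_of_sq hk)
  have hx : (k : ℝ) ^ 2 * Fintype.card G / Fintype.card X =
      2 * ((k : ℝ) ^ 2 * Fintype.card G / (2 * Fintype.card X)) := by field_simp
  rw [hx]
  set t : ℝ := (k : ℝ) * (k - 1) * Fintype.card G / (2 * Fintype.card X)
  set x : ℝ := (k : ℝ) ^ 2 * Fintype.card G / (2 * Fintype.card X)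
  refine ⟨by linarith, hl.trans ((isCompletelyPositive_haarTwirl k).cple_smul ?_), 1 - t,
    by linarith, by linarith, hu⟩
  linarith [exp_le_one_add_two_mul h0 (h1.trans h2)]

end TraceMaps

/-! ### Gluing two designs along an overlap -/

section Glue

variable {G : Type u} [Group G] [Fintype G] {ι : Type v} [DecidableEq ι] {q : ι → Type w}
  [∀ i, Fintype (q i)] [∀ i, DecidableEq (q i)] {R : ∀ i, G →* unitaryGroup (q i) ℂ}
  {V S T A B C : Finset ι}

/-- Splitting `k` copies of a region into `k` copies of three parts. -/
def splitEquivThree (hVA : IsSplit V A T) (hT : IsSplit T B C) (k : ℕ) :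
    (Fin k → Conf q V) ≃ (Fin k → Conf q A) × (Fin k → Conf q B) × (Fin k → Conf q C) :=
  (splitEquiv hVA k).trans ((Equiv.refl _).prodCongr (splitEquiv hT k))

theorem conjMap_ampMap_conjMap {Y Y' Z W : Type*} (Φ : Matrix Y Y ℂ → Matrix Y Y ℂ) (e : Y' ≃ Y)
    (f : W ≃ Y' × Z) : conjMap f (ampMap Z (conjMap e Φ)) =
      conjMap (f.trans (e.prodCongr (Equiv.refl Z))) (ampMap Z Φ) := rfl

theorem conjMap_comp {Y Y' : Type*} (Φ Ψ : Matrix Y Y ℂ → Matrix Y Y ℂ) (e : Y' ≃ Y)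
    (M : Matrix Y' Y' ℂ) :
    conjMap e (fun A => Φ (Ψ A)) M = conjMap e Φ (conjMap e Ψ M) := by
  simp [conjMap]

theorem conjMap_conjMap {Y Y' Y'' : Type*} (Φ : Matrix Y Y ℂ → Matrix Y Y ℂ) (e : Y' ≃ Y)
    (f : Y'' ≃ Y') : conjMap f (conjMap e Φ) = conjMap (f.trans e) Φ := rfl

theorem traceMap_regionHom (hVA : IsSplit V A T) (hT : IsSplit T B C) (k : ℕ) :
    traceMap (wreathRep k (regionHom R V)) = conjMap (splitEquivThree hVA hT k)
      (traceMap (kronHom (wreathRep k (regionHom R A))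
        (kronHom (wreathRep k (regionHom R B)) (wreathRep k (regionHom R C))))) := by
  refine traceMap_submatrix _ fun w => ?_
  ext x y
  rw [wreathRep_regionHom_split hVA]
  simp only [Matrix.submatrix_apply, kronHom_apply]
  rw [wreathRep_regionHom_split hT]
  rfl

theorem comp_traceMap_regionHom (hS : IsSplit S A B) (hT : IsSplit T B C) (hVC : IsSplit V S C)
    (hVA : IsSplit V A T) (k : ℕ) (M : Matrix (Fin k → Conf q V) (Fin k → Conf q V) ℂ) :
    conjMap (splitEquiv hVC k) (ampMap _ (traceMap (wreathRep k (regionHom R S))))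
      (conjMap (splitEquiv hVA.symm k) (ampMap _ (traceMap (wreathRep k (regionHom R T)))) M) =
    conjMap (splitEquivThree hVA hT k) (overlapMap (wreathRep k (regionHom R A))
      (wreathRep k (regionHom R B)) (wreathRep k (regionHom R C))) M := by
  rw [traceMap_submatrix (splitEquiv hS k) (wreathRep_regionHom_split hS k R),
    traceMap_submatrix (splitEquiv hT k) (wreathRep_regionHom_split hT k R),
    conjMap_ampMap_conjMap, conjMap_ampMap_conjMap]
  have h1 : (splitEquiv (q := q) hVC k).trans ((splitEquiv hS k).prodCongr (Equiv.refl _)) =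
      (splitEquivThree hVA hT k).trans (Equiv.prodAssoc _ _ _).symm := Equiv.ext fun _ => rfl
  have h2 : (splitEquiv (q := q) hVA.symm k).trans ((splitEquiv hT k).prodCongr (Equiv.refl _)) =
      (splitEquivThree hVA hT k).trans (Equiv.prodComm _ _) := Equiv.ext fun _ => rfl
  rw [h1, h2, ← conjMap_conjMap, ← conjMap_conjMap, ← conjMap_comp]
  rfl

variable [DecidableEq G]

theorem isClose_comp_traceMap (hR : ∀ i, IsRegularRep (R i)) (hS : IsSplit S A B)
    (hT : IsSplit T B C) (hVC : IsSplit V S C) (hVA : IsSplit V A T)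
    (hB : B.Nonempty ∨ Subsingleton G) {k : ℕ}
    (hk : (k : ℝ) ^ 2 * Fintype.card G ≤ dimR q B) :
    IsClose (Real.exp ((k : ℝ) * (k - 1) * Fintype.card G / (2 * dimR q B)))
      (fun M => conjMap (splitEquiv hVC k) (ampMap _ (traceMap (wreathRep k (regionHom R S))))
        (conjMap (splitEquiv hVA.symm k) (ampMap _ (traceMap (wreathRep k (regionHom R T)))) M))
      (traceMap (wreathRep k (regionHom R V))) := by
  have hne := nonempty_conf hR
  have hrep := isFreePermRep_regionHom hR hB
  have hU : ∀ D : Finset ι, IsUnitaryHom (wreathRep k (regionHom R D)) := fun D =>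
    wreathRep_conjTranspose fun g => by
      have h1 : ∀ g, regionHom R D g = piKron fun i : D => (R i g : Matrix (q i) (q i) ℂ) :=
        fun _ => rfl
      rw [h1, h1, piKron_conjTranspose]
      simp only [map_inv, UnitaryGroup.inv_val, star_eq_conjTranspose]
  obtain ⟨h0, h1, h2⟩ := collision_bounds k (Γ := Fintype.card G) (D := dimR q B)
    (Nat.cast_nonneg _) (Nat.cast_pos.mpr Fintype.card_pos) hk
  -- The exponent is at most `1/2`, hence the exponential at most `2`, and the lower constant `2 -
  -- E` is nonnegative.
  have h3 := exp_le_one_add_two_mul h0 (h1.trans h2)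
  have hlow := cple_overlapMap (hU A) (hU B) (hU C) hrep.wreathChar_nonneg wreathChar_one
    hrep.trace_wreathRep' hrep.wreathChar_inv wreathChar_conj (hrep.sum_wreathChar_le k)
  have hup := overlapMap_cple (hU A) (hU B) (hU C) hrep.wreathChar_nonneg
    hrep.trace_wreathRep' hrep.wreathChar_inv wreathChar_conj (hrep.sum_wreathChar_le k)
  have hclose : IsClose (Real.exp ((k : ℝ) * (k - 1) * Fintype.card G / (2 * dimR q B)))
    (overlapMap (wreathRep k (regionHom R A)) (wreathRep k (regionHom R B))
      (wreathRep k (regionHom R C))) (traceMap (kronHom (wreathRep k (regionHom R A))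
        (kronHom (wreathRep k (regionHom R B)) (wreathRep k (regionHom R C))))) :=
    ⟨Real.one_le_exp h0, hup, _, by linarith, le_rfl, hlow⟩
  have h4 : (fun M => conjMap (splitEquiv hVC k) (ampMap _ (traceMap (wreathRep k (regionHom R S))))
      (conjMap (splitEquiv hVA.symm k) (ampMap _ (traceMap (wreathRep k (regionHom R T)))) M)) =
    conjMap (splitEquivThree hVA hT k) (overlapMap (wreathRep k (regionHom R A))
      (wreathRep k (regionHom R B)) (wreathRep k (regionHom R C))) :=
    funext (comp_traceMap_regionHom hS hT hVC hVA k)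
  rw [h4, traceMap_regionHom hVA hT]
  exact hclose.conjMap _

theorem dimR_le (hR : ∀ i, IsRegularRep (R i)) (h : IsSplit S A B) : dimR q B ≤ dimR q S := by
  have := nonempty_conf hR A
  unfold dimR
  rw [card_conf_split h]
  exact_mod_cast Nat.le_mul_of_pos_left _ Fintype.card_pos

variable {k : ℕ} {ε ε' : ℝ} {Ω : Type*} [MeasurableSpace Ω] {P : Measure Ω}
  [IsProbabilityMeasure P]

theorem IsApproxSymDesign.isClose_traceMap (hR : ∀ i, IsRegularRep (R i))
    (hS : S.Nonempty ∨ Subsingleton G) (hk : (k : ℝ) ^ 2 * Fintype.card G ≤ dimR q S)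
    {U : Ω → Matrix (Conf q S) (Conf q S) ℂ} (hU : IsApproxSymDesign (regionRep R S) k ε P U) :
    IsClose ((1 + ε) * (1 - (k : ℝ) ^ 2 * Fintype.card G / (2 * dimR q S))⁻¹) (twirl P U k)
      (traceMap (wreathRep k (regionHom R S))) := by
  have hne := nonempty_conf hR S
  exact hU.isClose.trans ((isFreePermRep_regionHom hR hS).isClose_haarTwirl_traceMap hk)

/-- The accuracy `1 + ε` of two glued designs. -/
noncomputable def glueBound (k : ℕ) (Γ u u' DS DT DB DV : ℝ) : ℝ :=
  u * u' * (1 - (k : ℝ) ^ 2 * Γ / (2 * DS))⁻¹ * (1 - (k : ℝ) ^ 2 * Γ / (2 * DT))⁻¹ *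
    Real.exp ((k : ℝ) * (k - 1) * Γ / (2 * DB)) * (1 + (k : ℝ) ^ 2 * Γ / DV)

theorem IsApproxSymDesign.glue (hR : ∀ i, IsRegularRep (R i)) (hS : IsSplit S A B)
    (hT : IsSplit T B C) (hVC : IsSplit V S C) (hVA : IsSplit V A T)
    (hk : (k : ℝ) ^ 2 * Fintype.card G ≤ dimR q B)
    {U : Ω → Matrix (Conf q S) (Conf q S) ℂ} {U' : Ω → Matrix (Conf q T) (Conf q T) ℂ}
    (hU : IsApproxSymDesign (regionRep R S) k ε P U)
    (hU' : IsApproxSymDesign (regionRep R T) k ε' P U') (hind : IndepMatrix P U U') :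
    IsApproxSymDesign (regionRep R V) k (glueBound k (Fintype.card G) (1 + ε) (1 + ε') (dimR q S)
      (dimR q T) (dimR q B) (dimR q V) - 1) P
      (fun ω => extend hVC.left (U ω) * extend hVA.right (U' ω)) := by
  have hne := nonempty_conf hR
  have hm1 := fun x y => measurable_extend hVC.left hU.measurable x y
  have hm2 := fun x y => measurable_extend hVA.right hU'.measurable x y
  have hu1 := fun ω => extend_mem_unitary hVC.left (hU.unitary ω)
  have hu2 := fun ω => extend_mem_unitary hVA.right (hU'.unitary ω)
  have hm : ∀ x y, Measurable fun ω => (extend hVC.left (U ω) * extend hVA.right (U' ω)) x y :=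
    fun x y => Finset.measurable_fun_sum _ fun z _ => (hm1 x z).mul (hm2 z y)
  have hu : ∀ ω, extend hVC.left (U ω) * extend hVA.right (U' ω) ∈ unitaryGroup (Conf q V) ℂ :=
    fun ω => mul_mem (hu1 ω) (hu2 ω)
  have hs : ∀ ω g, extend hVC.left (U ω) * extend hVA.right (U' ω) * regionRep R V g =
      regionRep R V g * (extend hVC.left (U ω) * extend hVA.right (U' ω)) := fun ω g => by
    rw [Matrix.mul_assoc, extend_commute_regionRep hVA.right (hU'.symmetric ω g),
      ← Matrix.mul_assoc, extend_commute_regionRep hVC.left (hU.symmetric ω g), Matrix.mul_assoc]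
  -- For `k = 0` the dimension hypothesis says nothing, but every twirl is then the identity map.
  rcases Nat.eq_zero_or_pos k with rfl | hk0
  · refine isApproxSymDesign_zero_copies ?_ hm hu hs
    simp only [glueBound]
    have := hU.nonneg
    have := hU'.nonneg
    simp
    nlinarith [mul_nonneg hU.nonneg hU'.nonneg]
  -- An empty overlap has dimension one, which for `k ≥ 1` leaves only the trivial group.
  have hB : B.Nonempty ∨ Subsingleton G := by
    rcases B.eq_empty_or_nonempty with rfl | hB
    · refine Or.inr (Fintype.card_le_one_iff_subsingleton.mp ?_)
      have h1 : dimR q (∅ : Finset ι) = 1 := by simp [dimR]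
      rw [h1] at hk
      have h2 : k ^ 2 * Fintype.card G ≤ 1 := by exact_mod_cast hk
      exact le_trans (Nat.le_mul_of_pos_left _ (by positivity)) h2
    · exact Or.inl hB
  have hkS : (k : ℝ) ^ 2 * Fintype.card G ≤ dimR q S := hk.trans (dimR_le hR hS)
  have hkT : (k : ℝ) ^ 2 * Fintype.card G ≤ dimR q T := hk.trans (dimR_le hR hT.symm)
  have hkV : (k : ℝ) ^ 2 * Fintype.card G ≤ dimR q V := hkT.trans (dimR_le hR hVA)
  have hSne := hB.imp_left fun h => h.mono hS.right
  have hTne := hB.imp_left fun h => h.mono hT.left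
  have hVne := hTne.imp_left fun h => h.mono hVA.right
  have hτ : ∀ D : Finset ι, D.Nonempty ∨ Subsingleton G →
      IsCompletelyPositive (traceMap (wreathRep k (regionHom R D))) := fun D hD =>
    isCompletelyPositive_traceMap
      (wreathRep_conjTranspose (isFreePermRep_regionHom hR hD).conjTranspose)
  have h1 := ((hU.isClose_traceMap hR hSne hkS).ampMap (Fin k → Conf q C)).conjMap
    (splitEquiv hVC k)
  have h2 := ((hU'.isClose_traceMap hR hTne hkT).ampMap (Fin k → Conf q A)).conjMap
    (splitEquiv hVA.symm k)
  have h3 := h1.comp h2 ((hU.isCompletelyPositive.ampMap _).conjMap _)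
    (((hτ S hSne).ampMap _).conjMap _) ((hU'.isCompletelyPositive.ampMap _).conjMap _)
    (((hτ T hTne).ampMap _).conjMap _)
  have h4 := (h3.trans (isClose_comp_traceMap hR hS hT hVC hVA hB hk)).trans
    ((isFreePermRep_regionHom hR hVne).isClose_traceMap_haarTwirl hkV)
  have h5 : twirl P (fun ω => extend hVC.left (U ω) * extend hVA.right (U' ω)) k =
      fun M => conjMap (splitEquiv hVC k) (ampMap (Fin k → Conf q C) (twirl P U k))
        (conjMap (splitEquiv hVA.symm k) (ampMap (Fin k → Conf q A) (twirl P U' k)) M) := by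
    rw [← twirl_extend, ← twirl_extend]
    exact funext fun M => twirl_mul hm1 hu1 hm2 hu2 (hind.extend _ _) k M
  rw [← h5] at h4
  have h6 := h4.isApproxSymDesign hm hu hs
  have h7 : ∀ u u' c c' e x : ℝ, u * c * (u' * c') * e * x = u * u' * c * c' * e * x :=
    fun _ _ _ _ _ _ => by ring
  rw [h7] at h6
  exact h6

end Glue

/-! ### Segments of the line and their dimensions -/

section Segments

variable {n : ℕ}

/-- The qudits with index at least `a` and less than `b`. -/
def seg (n a b : ℕ) : Finset (Fin n) :=
  Finset.univ.filter fun i => a ≤ i.val ∧ i.val < b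

theorem mem_seg {a b : ℕ} {i : Fin n} : i ∈ seg n a b ↔ a ≤ i.val ∧ i.val < b := by
  simp [seg]

theorem isSplit_seg {a b c : ℕ} (hab : a ≤ b) (hbc : b ≤ c) :
    IsSplit (seg n a c) (seg n a b) (seg n b c) := by
  constructor
  · rw [Finset.disjoint_left]
    intro i hi hi'
    rw [mem_seg] at hi hi'
    omega
  · ext i
    rw [Finset.mem_union, mem_seg, mem_seg, mem_seg]
    omega

theorem disjoint_seg {a b c d : ℕ} (h : b ≤ c) : Disjoint (seg n a b) (seg n c d) := by
  rw [Finset.disjoint_left]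
  intro i hi hi'
  rw [mem_seg] at hi hi'
  omega

theorem card_seg {a b : ℕ} (h : b ≤ n) : (seg n a b).card = b - a := by
  rw [← Nat.card_Ico a b, ← Finset.card_map Fin.valEmbedding]
  congr 1
  ext i
  simp only [Finset.mem_map, mem_seg, Fin.valEmbedding_apply, Finset.mem_Ico]
  exact ⟨by rintro ⟨j, hj, rfl⟩; exact hj, fun hi => ⟨⟨i, by omega⟩, hi, rfl⟩⟩

theorem block_eq_seg (n ξ j : ℕ) : block n ξ j = seg n (j * ξ) ((j + 2) * ξ) := rfl

variable {q : Fin n → Type v} [∀ i, Fintype (q i)]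

theorem pow_le_dimR {b : ℝ} (hb : 0 ≤ b) (hq : ∀ i, b ≤ Fintype.card (q i)) (S : Finset (Fin n)) :
    b ^ S.card ≤ dimR q S := by
  have h1 : dimR q S = ∏ i : S, (Fintype.card (q i) : ℝ) := by
    simp [dimR]
  rw [h1, ← Fintype.card_coe, ← Finset.card_univ, ← Finset.prod_const]
  exact Finset.prod_le_prod (fun _ _ => hb) fun i _ => hq i

end Segments

/-! ### Numerical estimates -/

section Numerics

/-- `Y` bounds the dimension of one patch from below and `η` plays the role of `ε/n`. All regions
but the overlap have dimension at least `Y²`, so their factors are of second order in `η`, with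
total constant `4/7 + 4/7 + 1 = 15/7`; only the overlap contributes the linear term `η/2`. -/
theorem glueBound_nonneg_factor_le {k : ℕ} {Γ Y η u u' DS DT DB DV : ℝ} (hΓ : 0 ≤ Γ) (hY : 0 < Y)
    (hη : 0 ≤ η) (hη2 : η ≤ 1 / 2) (h1 : (k : ℝ) ^ 2 * Γ ≤ η * Y)
    (h2 : (k : ℝ) ^ 2 * Γ ≤ η ^ 2 * Y ^ 2) (hu : 0 ≤ u) (hu' : 0 ≤ u') (hS : Y ^ 2 ≤ DS)
    (hT : Y ^ 2 ≤ DT) (hB : Y ≤ DB) (hV : Y ^ 2 ≤ DV) :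
    glueBound k Γ u u' DS DT DB DV ≤ u * u' * Real.exp (η / 2 + 15 / 7 * η ^ 2) := by
  set z : ℝ := (k : ℝ) ^ 2 * Γ with hz
  have hz0 : 0 ≤ z := by positivity
  have hY2 : 0 < Y ^ 2 := by positivity
  have hη3 : η ^ 2 ≤ 1 / 4 := by nlinarith
  have hinv : ∀ D : ℝ, Y ^ 2 ≤ D → 0 ≤ (1 - z / (2 * D))⁻¹ ∧
      (1 - z / (2 * D))⁻¹ ≤ Real.exp (4 / 7 * η ^ 2) := fun D hD => by
    have hD0 : 0 < D := hY2.trans_le hD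
    have h3 : z / (2 * D) ≤ η ^ 2 / 2 := by
      rw [div_le_div_iff₀ (by positivity) two_pos]
      nlinarith [mul_le_mul_of_nonneg_left hD (sq_nonneg η)]
    have h4 : 0 < 1 - z / (2 * D) := by linarith
    refine ⟨(inv_pos.mpr h4).le, ?_⟩
    have h5 : (1 - z / (2 * D))⁻¹ ≤ (1 - η ^ 2 / 2)⁻¹ := inv_anti₀ (by linarith) (by linarith)
    -- `4/7` is the least constant valid on the whole range `η² ≤ 1/4`.
    have h6 : (1 - η ^ 2 / 2)⁻¹ ≤ 1 + 4 / 7 * η ^ 2 := by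
      rw [inv_eq_one_div, div_le_iff₀ (by linarith)]
      nlinarith [sq_nonneg η]
    linarith [Real.add_one_le_exp (4 / 7 * η ^ 2)]
  obtain ⟨hS0, hS1⟩ := hinv DS hS
  obtain ⟨hT0, hT1⟩ := hinv DT hT
  have hB0 : 0 < DB := hY.trans_le hB
  have hV0 : 0 < DV := hY2.trans_le hV
  have hE : Real.exp ((k : ℝ) * (k - 1) * Γ / (2 * DB)) ≤ Real.exp (η / 2) := by
    rw [Real.exp_le_exp, div_le_div_iff₀ (by positivity) two_pos]
    have h3 : (k : ℝ) * (k - 1) * Γ ≤ z := by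
      rw [hz]
      nlinarith [mul_nonneg (Nat.cast_nonneg k : (0 : ℝ) ≤ k) hΓ]
    nlinarith [mul_le_mul_of_nonneg_left hB hη]
  have hX : 1 + z / DV ≤ Real.exp (η ^ 2) := by
    have h3 : z / DV ≤ η ^ 2 := by
      rw [div_le_iff₀ hV0]
      nlinarith [mul_le_mul_of_nonneg_left hV (sq_nonneg η)]
    linarith [Real.add_one_le_exp (η ^ 2)]
  have hX0 : 0 ≤ 1 + z / DV := by positivity
  have hfin : Real.exp (η / 2 + 15 / 7 * η ^ 2) = Real.exp (4 / 7 * η ^ 2) *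
      Real.exp (4 / 7 * η ^ 2) * Real.exp (η / 2) * Real.exp (η ^ 2) := by
    rw [← Real.exp_add, ← Real.exp_add, ← Real.exp_add]
    ring_nf
  have huu := mul_nonneg hu hu'
  rw [hfin, glueBound]
  calc u * u' * (1 - z / (2 * DS))⁻¹ * (1 - z / (2 * DT))⁻¹ *
        Real.exp ((k : ℝ) * (k - 1) * Γ / (2 * DB)) * (1 + z / DV)
      ≤ u * u' * Real.exp (4 / 7 * η ^ 2) * Real.exp (4 / 7 * η ^ 2) * Real.exp (η / 2) *
        Real.exp (η ^ 2) := by gcongr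
    _ = _ := by ring

theorem brickwork_bound {m ξ : ℕ} {ε δ : ℝ} (hm : 2 ≤ m) (hξ : 1 ≤ ξ) (hε : 0 < ε) (hε1 : ε ≤ 1)
    (hδ : δ = 0 ∨ δ = ε / ((m * ξ : ℕ) : ℝ) ∧ (3 ≤ m → 3 ≤ ξ ∨ (ξ = 2 ∧ ε ≤ 1 / 2))) :
    (1 + δ) ^ (m - 1) * Real.exp ((m - 2 : ℕ) * (ε / ((m * ξ : ℕ) : ℝ) / 2 +
      15 / 7 * (ε / ((m * ξ : ℕ) : ℝ)) ^ 2)) ≤ 1 + ε := by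
  obtain ⟨m, rfl⟩ := Nat.exists_eq_add_of_le hm
  have hm1 : 2 + m - 1 = m + 1 := by omega
  have hm2 : 2 + m - 2 = m := by omega
  rw [hm1, hm2]
  have hξ' : (1 : ℝ) ≤ ξ := by exact_mod_cast hξ
  have hm0 : (0 : ℝ) ≤ m := Nat.cast_nonneg m
  -- From here on the number of patches is `2 + m`, and `s` is its inverse, so that `η ξ = ε s`.
  set s : ℝ := 1 / (2 + m) with hs
  have hs0 : 0 < s := by positivity
  have hsm : s * (2 + m) = 1 := by rw [hs]; field_simp
  set η : ℝ := ε / (((2 + m) * ξ : ℕ) : ℝ) with hη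
  have hηs : η = ε * s / ξ := by
    rw [hη, hs]; push_cast; field_simp
  have hηξ : η * ξ = ε * s := by rw [hηs]; field_simp
  have hη0 : 0 < η := by rw [hηs]; positivity
  have hηle : η ≤ ε * s := by rw [← hηξ]; nlinarith
  have hmη : m * η * ξ = ε * (1 - 2 * s) := by
    have : (m : ℝ) * η * ξ = m * (η * ξ) := by ring
    rw [this, hηξ]; linear_combination ε * hsm
  have hlog : 1 + ε = Real.exp (Real.log (1 + ε)) := (Real.exp_log (by linarith)).symm
  have hl := Real.le_log_one_add_of_nonneg hε.le
  -- From `log(1 + ε) ≥ 2ε/(ε + 2)`: the constant `c = 2/3` serves for `ε ≤ 1` and `c = 3/4` for `ε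
  -- ≤ 1/2`.
  have hl1 : ∀ c : ℝ, 0 < c → c * (ε + 2) ≤ 2 → c * ε ≤ Real.log (1 + ε) := fun c hc h => by
    refine le_trans ?_ hl
    rw [le_div_iff₀ (by linarith)]
    nlinarith
  have hs2 : s ≤ 1 / 2 := by nlinarith
  have key : ∀ d : ℝ, 0 < d → d ≤ ξ → m * (η / 2 + 15 / 7 * η ^ 2) ≤
      ε / d * ((1 - 2 * s) * (1 / 2 + 15 / 7 * (s / d))) := fun d hd hdξ => by
    have h1 : η ≤ ε * s / d := by
      rw [le_div_iff₀ hd]; nlinarith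
    have h2 : m * η ≤ ε / d * (1 - 2 * s) := by
      rw [div_mul_eq_mul_div, le_div_iff₀ hd]
      have : 0 ≤ m * η := by positivity
      nlinarith
    have h3 : ε * s / d ≤ s / d := by
      gcongr
      nlinarith
    have h4 : m * (η / 2 + 15 / 7 * η ^ 2) = m * η * (1 / 2 + 15 / 7 * η) := by ring
    rw [h4, ← mul_assoc]
    exact mul_le_mul h2 (by linarith) (by positivity)
      (mul_nonneg (by positivity) (by linarith))
  rcases hδ with rfl | ⟨rfl, hδ⟩
  · rw [add_zero, one_pow, one_mul, hlog, Real.exp_le_exp]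
    have h1 := key 1 one_pos hξ'
    refine h1.trans (le_trans ?_ (hl1 (2 / 3) (by norm_num) (by linarith)))
    -- `(1 - 2s)(1/2 + 15s/7)` has its maximum at `s = 2/15`, where it is below `2/3`.
    nlinarith [sq_nonneg s, mul_pos hs0 hs0, sq_nonneg (s - 2 / 15)]
  · have hpow : (1 + η) ^ (m + 1) ≤ Real.exp ((m + 1 : ℕ) * η) := by
      rw [Real.exp_nat_mul]
      exact pow_le_pow_left₀ (by linarith) (by linarith [Real.add_one_le_exp η]) _
    -- With designs the total exponent is at most `(3/2) ε/d`, so `c d ≥ 3/2` is required. For `ξ ≥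
    -- 3` this holds with `c = 2/3`; for `ξ = 2` it takes `c = 3/4`, which is why `ε ≤ 1/2` is
    -- assumed there.
    have key2 : ∀ d c : ℝ, 2 ≤ d → d ≤ ξ → 0 < c → c * (ε + 2) ≤ 2 → 3 / 2 ≤ c * d →
        (1 + η) ^ (m + 1) * Real.exp (m * (η / 2 + 15 / 7 * η ^ 2)) ≤ 1 + ε :=
      fun d c hd hdξ hc hcε hcd => by
        have hd0 : 0 < d := by linarith
        have h1 := key d hd0 hdξ
        have h2 : ((m + 1 : ℕ) : ℝ) * η ≤ ε / d * (1 - s) := by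
          rw [div_mul_eq_mul_div, le_div_iff₀ hd0]
          have h3 : ((m + 1 : ℕ) : ℝ) * η * ξ = ε * (1 - s) := by
            push_cast
            linear_combination hmη + hηξ
          have : 0 ≤ ((m + 1 : ℕ) : ℝ) * η := by positivity
          nlinarith
        refine (mul_le_mul_of_nonneg_right hpow (Real.exp_pos _).le).trans ?_
        rw [← Real.exp_add, hlog, Real.exp_le_exp]
        refine le_trans ?_ (hl1 c hc hcε)
        have h5 : s / d ≤ s / 2 := div_le_div_of_nonneg_left hs0.le two_pos hd
        have h6 : (1 - s) + (1 - 2 * s) * (1 / 2 + 15 / 7 * (s / d)) ≤ 3 / 2 := by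
          have : (1 - 2 * s) * (1 / 2 + 15 / 7 * (s / d)) ≤
              (1 - 2 * s) * (1 / 2 + 15 / 7 * (s / 2)) :=
            mul_le_mul_of_nonneg_left (by linarith) (by linarith)
          nlinarith [sq_nonneg s]
        have h7 : ε / d * (3 / 2) ≤ c * ε := by
          rw [div_mul_eq_mul_div, div_le_iff₀ hd0]
          linarith [mul_le_mul_of_nonneg_left hcd hε.le]
        have h8 := mul_le_mul_of_nonneg_left h6 (by positivity : 0 ≤ ε / d)
        rw [mul_add] at h8
        exact ((add_le_add h2 h1).trans h8).trans h7
    -- Two patches mean a single small unitary and no gluing.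
    rcases Nat.eq_zero_or_pos m with rfl | hm3
    · simp only [zero_add, pow_one, Nat.cast_zero, zero_mul, Real.exp_zero, mul_one]
      nlinarith
    · rcases hδ (by omega) with h | ⟨h, hε2⟩
      · exact key2 3 (2 / 3) (by norm_num) (by exact_mod_cast h) (by norm_num) (by linarith)
          (by norm_num)
      · exact key2 2 (3 / 4) (by norm_num) (by exact_mod_cast h.ge) (by norm_num) (by linarith)
          (by norm_num)

end Numerics

/-! ### Partial products of the two layers -/

section PartialProducts

variable {n : ℕ} {q : Fin n → Type v} [∀ i, Fintype (q i)] [∀ i, DecidableEq (q i)] {ξ r : ℕ}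

/-- The `i`-th small operator of a brickwork circuit, acting on all qudits. -/
def brick (U : ∀ j : Fin r, Matrix (Conf q (block n ξ j)) (Conf q (block n ξ j)) ℂ) (i : ℕ) :
    Matrix (Conf q Finset.univ) (Conf q Finset.univ) ℂ :=
  if h : i < r then extend (Finset.subset_univ (block n ξ i)) (U ⟨i, h⟩) else 1

/-- The product of the first `j` small operators whose index has a given parity. -/
def partialLayer (U : ∀ j : Fin r, Matrix (Conf q (block n ξ j)) (Conf q (block n ξ j)) ℂ)
    (p j : ℕ) : Matrix (Conf q Finset.univ) (Conf q Finset.univ) ℂ :=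
  (((List.range j).filter fun i => i % 2 = p).map (brick U)).prod

variable (U : ∀ j : Fin r, Matrix (Conf q (block n ξ j)) (Conf q (block n ξ j)) ℂ)

theorem brick_of_lt {i : ℕ} (h : i < r) :
    brick U i = extend (Finset.subset_univ (block n ξ i)) (U ⟨i, h⟩) := dif_pos h

theorem partialLayer_eq_brickLayer (p : ℕ) : partialLayer U p r = brickLayer ξ r p U := by
  unfold partialLayer brickLayer
  rw [← List.map_coe_finRange_eq_range, List.filter_map, List.map_map]
  refine congrArg List.prod ?_
  refine List.map_congr_left fun i _ => ?_
  exact brick_of_lt U i.2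

theorem partialLayer_zero (p : ℕ) : partialLayer U p 0 = 1 := rfl

theorem partialLayer_succ (p j : ℕ) : partialLayer U p (j + 1) =
    if j % 2 = p then partialLayer U p j * brick U j else partialLayer U p j := by
  unfold partialLayer
  rw [List.range_succ, List.filter_append, List.map_append, List.prod_append]
  by_cases h : j % 2 = p <;> simp [h]

theorem brick_commute {i j : ℕ} (h : i + 2 ≤ j) : Commute (brick U i) (brick U j) := by
  unfold brick
  split_ifs with hi hj
  · refine extend_commute _ _ (disjoint_seg ?_) _ _
    exact Nat.mul_le_mul_right _ h
  · exact Commute.one_right _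
  · exact Commute.one_left _
  · exact Commute.one_left _

theorem partialLayer_commute (j : ℕ) :
    Commute (partialLayer U (j % 2) j) (brick U j) := by
  refine Commute.list_prod_left _ _ fun M hM => ?_
  obtain ⟨i, hi, rfl⟩ := List.mem_map.mp hM
  rw [List.mem_filter, List.mem_range, decide_eq_true_iff] at hi
  exact brick_commute U (by omega)

end PartialProducts

/-! ### Assembling the brickwork circuit brick by brick -/

section Design

open ProbabilityTheory

variable {G : Type u} [Group G] [Fintype G] [DecidableEq G] {n : ℕ} {q : Fin n → Type v}
  [∀ i, Fintype (q i)] [∀ i, DecidableEq (q i)] {R : ∀ i, G →* unitaryGroup (q i) ℂ}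
  {ξ r k : ℕ} {Ω : Fin r → Type w} [∀ j, MeasurableSpace (Ω j)] {P : ∀ j, Measure (Ω j)}
  [∀ j, IsProbabilityMeasure (P j)]

/-- The events depending on the first `j + 1` coordinates. -/
abbrev pastSigma (Ω : Fin r → Type w) [∀ j, MeasurableSpace (Ω j)] (j : ℕ) :
    MeasurableSpace (∀ i, Ω i) :=
  ⨆ i ∈ {i : Fin r | i.val ≤ j}, MeasurableSpace.comap (fun ω : ∀ i, Ω i => ω i) inferInstance

theorem comap_le_pastSigma {j : ℕ} {i : Fin r} (h : i.val ≤ j) :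
    MeasurableSpace.comap (fun ω : ∀ i, Ω i => ω i) inferInstance ≤ pastSigma Ω j :=
  le_iSup₂_of_le (f := fun (i : Fin r) (_ : i ∈ {i : Fin r | i.val ≤ j}) =>
    MeasurableSpace.comap (fun ω : ∀ i, Ω i => ω i) inferInstance) i h le_rfl

theorem pastSigma_mono {j j' : ℕ} (h : j ≤ j') : pastSigma Ω j ≤ pastSigma Ω j' :=
  iSup₂_le fun _ hi => comap_le_pastSigma (le_trans hi h)

theorem indep_pastSigma (j : ℕ) (i : Fin r) (h : j < i.val) :
    Indep (pastSigma Ω j) (MeasurableSpace.comap (fun ω : ∀ i, Ω i => ω i) inferInstance)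
      (Measure.pi P) := by
  have h1 : iIndepFun (fun (i : Fin r) (ω : ∀ i, Ω i) => ω i) (Measure.pi P) :=
    iIndepFun_pi (X := fun i => (id : Ω i → Ω i)) fun i => aemeasurable_id
  have h2 := indep_iSup_of_disjoint (S := {i : Fin r | i.val ≤ j}) (T := {i})
    (m := fun i : Fin r => MeasurableSpace.comap (fun ω : ∀ i, Ω i => ω i) inferInstance)
    (fun i => (measurable_pi_apply i).comap_le) h1 (by
      rw [Set.disjoint_singleton_right]
      exact not_le.mpr h)
  rw [iSup_singleton] at h2
  exact h2

/-- The accuracy of the first `j + 1` small unitaries of a brickwork circuit. -/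
noncomputable def brickworkBound (δ c : ℝ) (j : ℕ) : ℝ := (1 + δ) ^ (j + 1) * Real.exp (j * c)

theorem brickworkBound_succ (δ c : ℝ) (j : ℕ) : brickworkBound δ c j * (1 + δ) * Real.exp c =
    brickworkBound δ c (j + 1) := by
  unfold brickworkBound
  push_cast
  rw [add_mul, Real.exp_add, one_mul]
  ring

/-- Induction from left to right, the next brick overlapping the circuit so far in exactly one
patch. Measurability with respect to the past coordinates gives independence of the next brick. The
region is given up to an equation because its operators have a type depending on it. -/
theorem exists_partial_brickwork (hR : ∀ i, IsRegularRep (R i)) {b η δ : ℝ} (hb : 1 ≤ b)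
    (hq : ∀ i, b ≤ Fintype.card (q i)) (hη : 0 ≤ η) (hη2 : η ≤ 1 / 2)
    (h1 : (k : ℝ) ^ 2 * Fintype.card G ≤ η * b ^ ξ)
    (h2 : (k : ℝ) ^ 2 * Fintype.card G ≤ η ^ 2 * (b ^ ξ) ^ 2) (hn : n = (r + 1) * ξ)
    {U : ∀ j : Fin r, Ω j → Matrix (Conf q (block n ξ j)) (Conf q (block n ξ j)) ℂ}
    (hU : ∀ j : Fin r, IsApproxSymDesign (regionRep R (block n ξ j)) k δ (P j) (U j)) (j : ℕ)
    (hj : j < r) :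
    ∃ (S : Finset (Fin n)) (W : (∀ i, Ω i) → Matrix (Conf q S) (Conf q S) ℂ),
      S = seg n 0 ((j + 2) * ξ) ∧
      IsApproxSymDesign (regionRep R S) k
        (brickworkBound δ (η / 2 + 15 / 7 * η ^ 2) j - 1) (Measure.pi P) W ∧
      (∀ x y, Measurable[pastSigma Ω j] fun ω => W ω x y) ∧
      ∀ ω, extend (Finset.subset_univ S) (W ω) =
        partialLayer (fun i => U i (ω i)) 1 (j + 1) *
          partialLayer (fun i => U i (ω i)) 0 (j + 1) := by
  have hUm : ∀ i : Fin r, ∀ x y, Measurable[MeasurableSpace.comap (fun ω : ∀ i, Ω i => ω i)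
      inferInstance] fun ω : ∀ i, Ω i => U i (ω i) x y := fun i x y =>
    ((hU i).measurable x y).comp (comap_measurable _)
  have hUd : ∀ i : Fin r, IsApproxSymDesign (regionRep R (block n ξ i)) k δ (Measure.pi P)
      fun ω => U i (ω i) := fun i =>
    (hU i).comp_measurePreserving (measurePreserving_eval P i)
  induction j with
  | zero =>
    refine ⟨block n ξ 0, fun ω => U ⟨0, hj⟩ (ω ⟨0, hj⟩), ?_, ?_, ?_, fun ω => ?_⟩
    · rw [block_eq_seg, zero_mul]
    · have h3 : brickworkBound δ (η / 2 + 15 / 7 * η ^ 2) 0 - 1 = δ := by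
        simp [brickworkBound]
      rw [h3]
      exact hUd ⟨0, hj⟩
    · exact fun x y => (hUm ⟨0, hj⟩ x y).mono (comap_le_pastSigma le_rfl) le_rfl
    · rw [partialLayer_succ, partialLayer_succ, partialLayer_zero, partialLayer_zero]
      simp [brick_of_lt _ hj]
  | succ j ih =>
    obtain ⟨S, W, rfl, hW, hWm, hWp⟩ := ih (by omega)
    set i : Fin r := ⟨j + 1, hj⟩ with hi
    have hle1 : (j + 1) * ξ ≤ (j + 1 + 1) * ξ := Nat.mul_le_mul_right _ (by omega)
    have hle2 : (j + 1 + 1) * ξ ≤ (j + 1 + 2) * ξ := Nat.mul_le_mul_right _ (by omega)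
    have hle3 : (j + 1 + 2) * ξ ≤ n := by
      rw [hn]; exact Nat.mul_le_mul_right _ (by omega)
    have hS : IsSplit (seg n 0 ((j + 2) * ξ)) (seg n 0 ((j + 1) * ξ))
        (seg n ((j + 1) * ξ) ((j + 1 + 1) * ξ)) := isSplit_seg (Nat.zero_le _) hle1
    have hT : IsSplit (block n ξ i) (seg n ((j + 1) * ξ) ((j + 1 + 1) * ξ))
        (seg n ((j + 1 + 1) * ξ) ((j + 1 + 2) * ξ)) := isSplit_seg hle1 hle2
    have hVC : IsSplit (seg n 0 ((j + 1 + 2) * ξ)) (seg n 0 ((j + 2) * ξ))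
        (seg n ((j + 1 + 1) * ξ) ((j + 1 + 2) * ξ)) := isSplit_seg (Nat.zero_le _) hle2
    have hVA : IsSplit (seg n 0 ((j + 1 + 2) * ξ)) (seg n 0 ((j + 1) * ξ)) (block n ξ i) :=
      isSplit_seg (Nat.zero_le _) (hle1.trans hle2)
    have hb0 : 0 ≤ b := by linarith
    have hY : 0 < b ^ ξ := by positivity
    have hdim : ∀ a c l : ℕ, c ≤ n → a + l * ξ ≤ c → (b ^ ξ) ^ l ≤ dimR q (seg n a c) :=
      fun a c l hc hl => by
        refine le_trans ?_ (pow_le_dimR hb0 hq _)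
        rw [← pow_mul, card_seg hc]
        refine pow_le_pow_right₀ hb ?_
        rw [mul_comm]
        omega
    have hDS : (b ^ ξ) ^ 2 ≤ dimR q (seg n 0 ((j + 2) * ξ)) :=
      hdim _ _ _ (hle2.trans hle3) (by rw [zero_add]; exact Nat.mul_le_mul_right _ (by omega))
    have hDT : (b ^ ξ) ^ 2 ≤ dimR q (block n ξ i) := by
      refine hdim _ _ _ hle3 (le_of_eq ?_)
      simp only [hi]; ring
    have hDB : b ^ ξ ≤ dimR q (seg n ((j + 1) * ξ) ((j + 1 + 1) * ξ)) := by
      have := hdim ((j + 1) * ξ) ((j + 1 + 1) * ξ) 1 (hle2.trans hle3) (le_of_eq (by ring))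
      rwa [pow_one] at this
    have hDV : (b ^ ξ) ^ 2 ≤ dimR q (seg n 0 ((j + 1 + 2) * ξ)) :=
      hdim _ _ _ hle3 (by rw [zero_add]; exact Nat.mul_le_mul_right _ (by omega))
    have hk : (k : ℝ) ^ 2 * Fintype.card G ≤ dimR q (seg n ((j + 1) * ξ) ((j + 1 + 1) * ξ)) := by
      nlinarith
    have hind : IndepMatrix (Measure.pi P) W fun ω => U i (ω i) := by
      rw [IndepMatrix, IndepFun_iff_Indep]
      refine indep_of_indep_of_le (indep_pastSigma j i (by simp [hi])) ?_ ?_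
      · exact Measurable.comap_le (@measurable_pi_lambda _ _ _ (pastSigma Ω j) _ _ fun p =>
          hWm p.1 p.2)
      · exact Measurable.comap_le (@measurable_pi_lambda _ _ _ (MeasurableSpace.comap
          (fun ω : ∀ i, Ω i => ω i) inferInstance) _ _ fun p => hUm i p.1 p.2)
    have hWn : 0 ≤ brickworkBound δ (η / 2 + 15 / 7 * η ^ 2) j := by
      have := nonempty_conf hR (seg n 0 ((j + 2) * ξ))
      linarith [hW.nonneg]
    have hδ : 0 ≤ 1 + δ := by
      have := nonempty_conf hR (block n ξ i)
      linarith [(hU i).nonneg]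
    have hWm' : ∀ x y, Measurable[pastSigma Ω (j + 1)] fun ω => extend hVC.left (W ω) x y :=
      @measurable_extend _ _ _ _ _ _ _ _ (pastSigma Ω (j + 1)) hVC.left W fun x y =>
        (hWm x y).mono (pastSigma_mono (Nat.le_succ j)) le_rfl
    have hUm' : ∀ x y, Measurable[pastSigma Ω (j + 1)] fun ω : ∀ i, Ω i =>
        extend hVA.right (U i (ω i)) x y :=
      @measurable_extend _ _ _ _ _ _ _ _ (pastSigma Ω (j + 1)) hVA.right (fun ω => U i (ω i))
        fun x y => (hUm i x y).mono (comap_le_pastSigma le_rfl) le_rfl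
    have hbrick : ∀ ω : ∀ i, Ω i, brick (fun i => U i (ω i)) (j + 1) =
        extend (Finset.subset_univ (block n ξ i)) (U i (ω i)) := fun ω => brick_of_lt _ hj
    -- A brick of even index belongs to the layer applied first and multiplies from the right. An
    -- odd one multiplies from the left, so the gluing lemma is used mirrored and the brick is
    -- commuted past the earlier odd bricks.
    rcases Nat.mod_two_eq_zero_or_one (j + 1) with hpar | hpar
    · refine ⟨seg n 0 ((j + 1 + 2) * ξ),
        fun ω => extend hVC.left (W ω) * extend hVA.right (U i (ω i)), rfl, ?_, ?_, fun ω => ?_⟩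
      · refine (hW.glue hR hS hT hVC hVA hk (hUd i) hind).mono (sub_le_sub_right ?_ 1)
        rw [add_sub_cancel, ← brickworkBound_succ]
        exact glueBound_nonneg_factor_le (Nat.cast_nonneg _) hY hη hη2 h1 h2 hWn hδ hDS hDT hDB hDV
      · exact fun x y => @Finset.measurable_fun_sum _ _ _ _ _ _ (pastSigma Ω (j + 1)) _ _
          fun z _ => (hWm' x z).mul (hUm' z y)
      · rw [extend_mul, extend_extend, extend_extend, hWp, partialLayer_succ _ 1 (j + 1),
          partialLayer_succ _ 0 (j + 1), hpar, hbrick]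
        simp only [zero_ne_one, if_true, if_false, Matrix.mul_assoc]
    · refine ⟨seg n 0 ((j + 1 + 2) * ξ),
        fun ω => extend hVA.right (U i (ω i)) * extend hVC.left (W ω), rfl, ?_, ?_, fun ω => ?_⟩
      · refine ((hUd i).glue hR hT.symm hS.symm hVA.symm hVC.symm hk hW hind.symm).mono
          (sub_le_sub_right ?_ 1)
        rw [add_sub_cancel, ← brickworkBound_succ, mul_comm (brickworkBound _ _ _)]
        exact glueBound_nonneg_factor_le (Nat.cast_nonneg _) hY hη hη2 h1 h2 hδ hWn hDT hDS hDB hDV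
      · exact fun x y => @Finset.measurable_fun_sum _ _ _ _ _ _ (pastSigma Ω (j + 1)) _ _
          fun z _ => (hUm' x z).mul (hWm' z y)
      · have hc := partialLayer_commute (fun i => U i (ω i)) (j + 1)
        rw [hpar, hbrick] at hc
        rw [extend_mul, extend_extend, extend_extend, hWp, partialLayer_succ _ 1 (j + 1),
          partialLayer_succ _ 0 (j + 1), hpar, hbrick]
        simp only [one_ne_zero, if_true, if_false]
        rw [← Matrix.mul_assoc, hc.eq]

end Design

/-! ### Circuit depth -/

section Depth

variable {ι : Type u} [DecidableEq ι] {q : ι → Type v} [∀ i, Fintype (q i)]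
  [∀ i, DecidableEq (q i)] {𝒢 : GateSet q} {T A B : Finset ι} {d : ℕ}

theorem extend_list_prod (h : A ⊆ T) (l : List (Matrix (Conf q A) (Conf q A) ℂ)) :
    extend h l.prod = (l.map (extend h)).prod := by
  induction l with
  | nil => exact extend_one h
  | cons M l ih => rw [List.prod_cons, extend_mul, ih, List.map_cons, List.prod_cons]

theorem IsLayer.mul_disjoint (hA : A ⊆ T) (hB : B ⊆ T) (hd : Disjoint A B)
    {L : Matrix (Conf q A) (Conf q A) ℂ} {K : Matrix (Conf q B) (Conf q B) ℂ}
    (hL : IsLayer 𝒢 A L) (hK : IsLayer 𝒢 B K) : IsLayer 𝒢 T (extend hA L * extend hB K) := by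
  obtain ⟨l, hl, hlG, rfl⟩ := hL
  obtain ⟨l', hl', hlG', rfl⟩ := hK
  refine ⟨l.map (fun a => ⟨⟨a.1.1, a.1.2.trans hA⟩, a.2⟩) ++
    l'.map (fun a => ⟨⟨a.1.1, a.1.2.trans hB⟩, a.2⟩), ?_, ?_, ?_⟩
  · rw [List.pairwise_append, List.pairwise_map, List.pairwise_map]
    refine ⟨hl, hl', fun a ha b hb => ?_⟩
    obtain ⟨a, -, rfl⟩ := List.mem_map.mp ha
    obtain ⟨b, -, rfl⟩ := List.mem_map.mp hb
    exact hd.mono a.1.2 b.1.2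
  · intro a ha
    rcases List.mem_append.mp ha with ha | ha
    · obtain ⟨a, ha', rfl⟩ := List.mem_map.mp ha
      exact hlG a ha'
    · obtain ⟨a, ha', rfl⟩ := List.mem_map.mp ha
      exact hlG' a ha'
  · rw [List.map_append, List.prod_append, extend_list_prod, extend_list_prod, List.map_map,
      List.map_map, List.map_map, List.map_map]
    congr 2
    · exact List.map_congr_left fun a _ => extend_extend _ _ _
    · exact List.map_congr_left fun a _ => extend_extend _ _ _

theorem hasDepth_one (𝒢 : GateSet q) (T : Finset ι) (d : ℕ) : HasDepth 𝒢 T d 1 :=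
  ⟨List.replicate d 1, List.length_replicate, fun L hL => by
    rw [List.eq_of_mem_replicate hL]
    exact ⟨[], List.Pairwise.nil, by simp, rfl⟩, by simp⟩

theorem HasDepth.mul {d' : ℕ} {M N : Matrix (Conf q T) (Conf q T) ℂ} (hM : HasDepth 𝒢 T d M)
    (hN : HasDepth 𝒢 T d' N) : HasDepth 𝒢 T (d + d') (M * N) := by
  obtain ⟨Ls, rfl, h1, rfl⟩ := hM
  obtain ⟨Ks, rfl, h2, rfl⟩ := hN
  exact ⟨Ls ++ Ks, List.length_append, fun L hL => (List.mem_append.mp hL).elim (h1 L) (h2 L),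
    List.prod_append.symm⟩

/-- The two circuits run in parallel: their layers are merged pairwise, each layer on `B` moving
past the remaining layers on `A`. -/
theorem HasDepth.mul_disjoint (hA : A ⊆ T) (hB : B ⊆ T) (hd : Disjoint A B)
    {M : Matrix (Conf q A) (Conf q A) ℂ} {N : Matrix (Conf q B) (Conf q B) ℂ}
    (hM : HasDepth 𝒢 A d M) (hN : HasDepth 𝒢 B d N) :
    HasDepth 𝒢 T d (extend hA M * extend hB N) := by
  obtain ⟨Ls, rfl, h1, rfl⟩ := hM
  obtain ⟨Ks, hlen, h2, rfl⟩ := hN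
  induction Ls generalizing Ks with
  | nil =>
    obtain rfl := List.length_eq_zero_iff.mp hlen
    rw [List.prod_nil, List.prod_nil, extend_one, extend_one, Matrix.one_mul]
    exact hasDepth_one 𝒢 T 0
  | cons L Ls ih =>
    obtain ⟨K, Ks, rfl⟩ := List.exists_cons_of_length_eq_add_one hlen
    have h3 := ih (fun L hL => h1 L (List.mem_cons_of_mem _ hL)) Ks (by simpa using hlen)
      (fun L hL => h2 L (List.mem_cons_of_mem _ hL))
    have h4 : HasDepth 𝒢 T 1 (extend hA L * extend hB K) :=
      ⟨[_], rfl, fun L' hL' => by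
        rw [List.mem_singleton.mp hL']
        exact (h1 L List.mem_cons_self).mul_disjoint hA hB hd (h2 K List.mem_cons_self),
        List.prod_singleton.symm⟩
    have h5 := h4.mul h3
    rw [add_comm] at h5
    refine Eq.subst (motive := HasDepth 𝒢 T (Ls.length + 1)) ?_ h5
    symm
    rw [List.prod_cons, List.prod_cons, extend_mul, extend_mul]
    have h6 := extend_commute hA hB hd Ls.prod K
    calc extend hA L * extend hA Ls.prod * (extend hB K * extend hB Ks.prod)
        = extend hA L * (extend hA Ls.prod * extend hB K) * extend hB Ks.prod := by
          simp only [Matrix.mul_assoc]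
      _ = _ := by rw [h6]; simp only [Matrix.mul_assoc]

theorem hasDepth_list_prod {I : Type*} {s : I → Finset ι} (hs : ∀ i, s i ⊆ T)
    (V : ∀ i, Matrix (Conf q (s i)) (Conf q (s i)) ℂ) (l : List I)
    (hl : l.Pairwise fun i j => Disjoint (s i) (s j)) (hV : ∀ i ∈ l, HasDepth 𝒢 (s i) d (V i)) :
    HasDepth 𝒢 T d (l.map fun i => extend (hs i) (V i)).prod := by
  -- The condition on all `E` records that `D` meets nothing outside the supports `s i`, which keeps
  -- the next factor disjoint from `D`.
  have key : ∃ (D : Finset ι) (hD : D ⊆ T) (M : Matrix (Conf q D) (Conf q D) ℂ),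
      (∀ E : Finset ι, (∀ i ∈ l, Disjoint E (s i)) → Disjoint E D) ∧ HasDepth 𝒢 D d M ∧
      (l.map fun i => extend (hs i) (V i)).prod = extend hD M := by
    induction l with
    | nil => exact ⟨∅, Finset.empty_subset _, 1, fun E _ => Finset.disjoint_empty_right E,
        hasDepth_one _ _ _, (extend_one _).symm⟩
    | cons i l ih =>
      rw [List.pairwise_cons] at hl
      obtain ⟨D, hD, M, hE, hM, hprod⟩ := ih hl.2 fun j hj => hV j (List.mem_cons_of_mem _ hj)
      refine ⟨s i ∪ D, Finset.union_subset (hs i) hD, extend Finset.subset_union_left (V i) *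
        extend Finset.subset_union_right M, fun E h => ?_, ?_, ?_⟩
      · rw [Finset.disjoint_union_right]
        exact ⟨h i List.mem_cons_self, hE E fun j hj => h j (List.mem_cons_of_mem _ hj)⟩
      · exact (hV i List.mem_cons_self).mul_disjoint _ _ (hE _ hl.1) hM
      · rw [List.map_cons, List.prod_cons, hprod, extend_mul, extend_extend, extend_extend]
  obtain ⟨D, hD, M, -, hM, hprod⟩ := key
  -- Pairing with the identity on the empty region carries the circuit from `D` to `T`.
  have h1 := hM.mul_disjoint hD (Finset.empty_subset T) (Finset.disjoint_empty_right D)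
    (hasDepth_one 𝒢 ∅ d)
  rw [extend_one, Matrix.mul_one] at h1
  rwa [hprod]

end Depth

/-! ### Depth of the brickwork circuit -/

section BrickworkDepth

variable {n ξ r d : ℕ} {q : Fin n → Type v} [∀ i, Fintype (q i)] [∀ i, DecidableEq (q i)]
  {𝒢 : GateSet q}

theorem hasDepth_brickLayer (p : ℕ)
    {U : ∀ j : Fin r, Matrix (Conf q (block n ξ j)) (Conf q (block n ξ j)) ℂ}
    (hU : ∀ j : Fin r, HasDepth 𝒢 (block n ξ j) d (U j)) :
    HasDepth 𝒢 Finset.univ d (brickLayer ξ r p U) := by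
  refine hasDepth_list_prod (fun j : Fin r => Finset.subset_univ (block n ξ j)) U _ ?_
    fun j _ => hU j
  rw [List.pairwise_filter]
  refine (List.pairwise_lt_finRange r).imp fun {i j} hij hi hj => disjoint_seg ?_
  rw [decide_eq_true_iff] at hi hj
  have : i.val < j.val := hij
  exact Nat.mul_le_mul_right _ (by omega)

theorem hasDepth_brickwork
    {U : ∀ j : Fin r, Matrix (Conf q (block n ξ j)) (Conf q (block n ξ j)) ℂ}
    (hU : ∀ j : Fin r, HasDepth 𝒢 (block n ξ j) d (U j)) :
    HasDepth 𝒢 Finset.univ (2 * d) (brickwork ξ r U) := by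
  rw [two_mul]
  exact (hasDepth_brickLayer 1 hU).mul (hasDepth_brickLayer 0 hU)

end BrickworkDepth

/-! ### The brickwork circuit as an approximate design -/

section BrickworkDesign

variable {G : Type u} [Group G] [Fintype G] [DecidableEq G]

theorem IsApproxSymDesign.extend_univ {n : ℕ} {q : Fin n → Type v} [∀ i, Fintype (q i)]
    [∀ i, DecidableEq (q i)] {R : ∀ i, G →* unitaryGroup (q i) ℂ} {S : Finset (Fin n)} {k : ℕ}
    {ε : ℝ} {Ω : Type w} [MeasurableSpace Ω] {P : Measure Ω}
    {W : Ω → Matrix (Conf q S) (Conf q S) ℂ} (h : IsApproxSymDesign (regionRep R S) k ε P W)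
    (hS : S = Finset.univ) : IsApproxSymDesign (regionRep R Finset.univ) k ε P
      fun ω => extend (Finset.subset_univ S) (W ω) := by
  subst hS
  simpa only [extend_self] using h

theorem isApproxSymDesign_brickwork {n m ξ k : ℕ} (hm : 2 ≤ m) (hξ : 1 ≤ ξ) (hn : n = m * ξ)
    {q : Fin n → Type v} [∀ i, Fintype (q i)] [∀ i, DecidableEq (q i)]
    {R : ∀ i, G →* unitaryGroup (q i) ℂ} (hR : ∀ i, IsRegularRep (R i)) {ε δ b : ℝ}
    (hε : 0 < ε) (hε1 : ε ≤ 1) (hb : 1 < b) (hq : ∀ i, b ≤ Fintype.card (q i))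
    (hlog : Real.logb b (n * (k : ℝ) ^ 2 * Fintype.card G / ε) ≤ ξ)
    {Ω : Fin (m - 1) → Type w} [∀ j, MeasurableSpace (Ω j)] {P : ∀ j, Measure (Ω j)}
    [∀ j, IsProbabilityMeasure (P j)]
    {U : ∀ j : Fin (m - 1), Ω j → Matrix (Conf q (block n ξ j)) (Conf q (block n ξ j)) ℂ}
    (hU : ∀ j : Fin (m - 1), IsApproxSymDesign (regionRep R (block n ξ j)) k δ (P j) (U j))
    (hδ : δ = 0 ∨ δ = ε / n ∧ (2 < b → 3 ≤ m → 3 ≤ ξ ∨ (ξ = 2 ∧ ε ≤ 1 / 2))) :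
    IsApproxSymDesign (regionRep R Finset.univ) k ε (Measure.pi P)
      (fun ω => brickwork ξ (m - 1) fun j => U j (ω j)) := by
  have hnr : n = (m - 1 + 1) * ξ := by rw [hn]; congr 1; omega
  have key : ∀ η : ℝ, 0 ≤ η → η ≤ 1 / 2 → (k : ℝ) ^ 2 * Fintype.card G ≤ η * b ^ ξ →
      (k : ℝ) ^ 2 * Fintype.card G ≤ η ^ 2 * (b ^ ξ) ^ 2 →
      IsApproxSymDesign (regionRep R Finset.univ) k
        (brickworkBound δ (η / 2 + 15 / 7 * η ^ 2) (m - 2) - 1) (Measure.pi P)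
        (fun ω => brickwork ξ (m - 1) fun j => U j (ω j)) := fun η hη hη2 h1 h2 => by
    obtain ⟨S, W, hS, hW, -, hWp⟩ :=
      exists_partial_brickwork hR hb.le hq hη hη2 h1 h2 hnr hU (m - 2) (by omega)
    have h3 : S = Finset.univ := by
      rw [hS]
      ext i
      have h4 : (m - 2 + 2) * ξ = n := by rw [hn]; congr 1; omega
      simp [mem_seg, h4]
    have h5 := hW.extend_univ h3
    have h6 : m - 2 + 1 = m - 1 := by omega
    simp only [hWp, h6, partialLayer_eq_brickLayer] at h5
    exact h5
  rcases Nat.eq_zero_or_pos k with rfl | hk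
  · have h1 := key 0 le_rfl (by norm_num) (by simp) (by simp)
    exact isApproxSymDesign_zero_copies hε.le h1.measurable h1.unitary h1.symmetric
  · have hk1 : (1 : ℝ) ≤ k := by exact_mod_cast hk
    have hΓ : (1 : ℝ) ≤ Fintype.card G := by exact_mod_cast Fintype.card_pos
    have hz : (1 : ℝ) ≤ (k : ℝ) ^ 2 * Fintype.card G := by nlinarith
    have hn2 : 2 ≤ n := by rw [hn]; nlinarith
    have hn2' : (2 : ℝ) ≤ n := by exact_mod_cast hn2
    have hn0 : (0 : ℝ) < n := by linarith
    have hY : n * (k : ℝ) ^ 2 * Fintype.card G / ε ≤ b ^ ξ := by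
      rw [Real.logb_le_iff_le_rpow hb (by positivity), Real.rpow_natCast] at hlog
      exact hlog
    have hη : 0 < ε / n := by positivity
    have h1 : (k : ℝ) ^ 2 * Fintype.card G ≤ ε / n * b ^ ξ := by
      calc (k : ℝ) ^ 2 * Fintype.card G
          = ε / n * (n * (k : ℝ) ^ 2 * Fintype.card G / ε) := by field_simp
        _ ≤ _ := mul_le_mul_of_nonneg_left hY hη.le
    -- Since `k²|G| ≥ 1`, it is bounded by its own square.
    have h2 : (k : ℝ) ^ 2 * Fintype.card G ≤ (ε / n) ^ 2 * (b ^ ξ) ^ 2 := by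
      rw [← mul_pow]
      nlinarith
    have h3 : ε / n ≤ 1 / 2 := by
      rw [div_le_div_iff₀ hn0 two_pos]
      linarith
    have hδ' : δ = 0 ∨ δ = ε / ((m * ξ : ℕ) : ℝ) ∧ (3 ≤ m → 3 ≤ ξ ∨ (ξ = 2 ∧ ε ≤ 1 / 2)) := by
      refine hδ.imp_right fun h => ⟨by rw [h.1, hn], fun hm3 => ?_⟩
      rcases lt_or_ge 2 b with hb2 | hb2
      · exact h.2 hb2 hm3
      -- For `b ≤ 2` the condition on `ξ` gives `m ξ = n ≤ 2^ξ`, which with `m ≥ 3` excludes `ξ = 1`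
      -- and `ξ = 2`.
      · left
        by_contra hξ3
        have h4 : b ^ ξ ≤ 2 ^ ξ := pow_le_pow_left₀ (by linarith) hb2 _
        have h5 : (n : ℝ) ≤ n * (k : ℝ) ^ 2 * Fintype.card G / ε := by
          rw [le_div_iff₀ hε]
          nlinarith
        have h6 : (n : ℝ) ≤ 2 ^ ξ := (h5.trans hY).trans h4
        have h7 : n ≤ 2 ^ ξ := by exact_mod_cast h6
        have h8 : ξ = 1 ∨ ξ = 2 := by omega
        rcases h8 with rfl | rfl <;> omega
    refine (key (ε / n) hη.le h3 h1 h2).mono ?_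
    have h4 := brickwork_bound hm hξ hε hε1 hδ'
    rw [← hn] at h4
    rw [sub_le_iff_le_add', brickworkBound]
    have h6 : m - 2 + 1 = m - 1 := by omega
    rw [h6]
    exact h4

end BrickworkDesign

theorem indepMatrix_prod {X Y Ω₁ Ω₂ : Type*} [MeasurableSpace Ω₁] [MeasurableSpace Ω₂]
    {P₁ : Measure Ω₁} [IsProbabilityMeasure P₁] {P₂ : Measure Ω₂} [IsProbabilityMeasure P₂]
    {U : Ω₁ → Matrix X X ℂ} {V : Ω₂ → Matrix Y Y ℂ} (hU : ∀ x y, Measurable fun ω => U ω x y)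
    (hV : ∀ x y, Measurable fun ω => V ω x y) :
    IndepMatrix (P₁.prod P₂) (fun ω => U ω.1) (fun ω => V ω.2) :=
  ProbabilityTheory.indepFun_prod (X := fun ω (p : X × X) => U ω p.1 p.2)
    (Y := fun ω (p : Y × Y) => V ω p.1 p.2) (measurable_pi_lambda _ fun p => hU p.1 p.2)
    (measurable_pi_lambda _ fun p => hV p.1 p.2)

end SymDesign

/-! ### The main theorem -/

theorem lemma1 {G : Type*} [Group G] [Fintype G] [DecidableEq G] :
    -- gluing two symmetric random unitaries
    (∀ {ι : Type*} [DecidableEq ι] {q : ι → Type*}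
      [∀ i, Fintype (q i)] [∀ i, DecidableEq (q i)]
      (R : ∀ i, G →* Matrix.unitaryGroup (q i) ℂ) (_ : ∀ i, SymDesign.IsRegularRep (R i))
      (A B C : Finset ι) (_ : Disjoint A B) (_ : Disjoint A C) (_ : Disjoint B C)
      (k : ℕ) (_ : (k : ℝ) ^ 2 ≤ SymDesign.dimR q B / Fintype.card G) (εAB εBC : ℝ)
      {Ω₁ Ω₂ : Type*} [MeasurableSpace Ω₁] [MeasurableSpace Ω₂]
      (P₁ : MeasureTheory.Measure Ω₁) [MeasureTheory.IsProbabilityMeasure P₁]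
      (P₂ : MeasureTheory.Measure Ω₂) [MeasureTheory.IsProbabilityMeasure P₂]
      (UAB : Ω₁ → Matrix (SymDesign.Conf q (A ∪ B)) (SymDesign.Conf q (A ∪ B)) ℂ)
      (UBC : Ω₂ → Matrix (SymDesign.Conf q (B ∪ C)) (SymDesign.Conf q (B ∪ C)) ℂ)
      (_ : SymDesign.IsApproxSymDesign (SymDesign.regionRep R (A ∪ B)) k εAB P₁ UAB)
      (_ : SymDesign.IsApproxSymDesign (SymDesign.regionRep R (B ∪ C)) k εBC P₂ UBC),
      SymDesign.IsApproxSymDesign (SymDesign.regionRep R (A ∪ B ∪ C)) k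
        ((1 + εAB) * (1 + εBC)
          * (1 - (k : ℝ) ^ 2 * Fintype.card G / (2 * SymDesign.dimR q (A ∪ B)))⁻¹
          * (1 - (k : ℝ) ^ 2 * Fintype.card G / (2 * SymDesign.dimR q (B ∪ C)))⁻¹
          * Real.exp ((k : ℝ) * (k - 1) * Fintype.card G / (2 * SymDesign.dimR q B))
          * (1 + (k : ℝ) ^ 2 * Fintype.card G / SymDesign.dimR q (A ∪ B ∪ C)) - 1)
        (P₁.prod P₂)
        (fun ω => SymDesign.extend Finset.subset_union_left (UAB ω.1)
          * SymDesign.extend (SymDesign.union_subset_union_union A B C) (UBC ω.2))) ∧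
    -- the two-layer brickwork circuit on `n = m ξ` qudits
    (∀ (n m ξ : ℕ) (_ : 2 ≤ m) (_ : 1 ≤ ξ) (_ : n = m * ξ) {q : Fin n → Type*}
      [∀ i, Fintype (q i)] [∀ i, DecidableEq (q i)]
      (R : ∀ i, G →* Matrix.unitaryGroup (q i) ℂ) (_ : ∀ i, SymDesign.IsRegularRep (R i))
      (k : ℕ) (ε : ℝ) (_ : 0 < ε) (_ : ε ≤ 1)
      (b : ℝ) (_ : 1 < b) (_ : ∀ i, b ≤ Fintype.card (q i))
      (_ : Real.logb b (n * (k : ℝ) ^ 2 * Fintype.card G / ε) ≤ ξ),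
      -- small unitaries drawn from the symmetric Haar ensemble
      SymDesign.IsApproxSymDesign (SymDesign.regionRep R Finset.univ) k ε
        (MeasureTheory.Measure.pi fun j : Fin (m - 1) =>
          SymDesign.symHaar (SymDesign.regionRep R (SymDesign.block n ξ j)))
        (fun V => SymDesign.brickwork ξ (m - 1) fun j =>
          SymDesign.symVal (SymDesign.regionRep R (SymDesign.block n ξ j)) (V j)) ∧
      -- small unitaries drawn from `ε / n`-approximate designs
      (∀ {Ω : Fin (m - 1) → Type*} [∀ j, MeasurableSpace (Ω j)]
        (P : ∀ j, MeasureTheory.Measure (Ω j)) [∀ j, MeasureTheory.IsProbabilityMeasure (P j)]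
        (U : ∀ j : Fin (m - 1), Ω j →
          Matrix (SymDesign.Conf q (SymDesign.block n ξ j))
            (SymDesign.Conf q (SymDesign.block n ξ j)) ℂ)
        (_ : ∀ j : Fin (m - 1), SymDesign.IsApproxSymDesign
          (SymDesign.regionRep R (SymDesign.block n ξ j)) k (ε / n) (P j) (U j)),
        ((2 < b → 3 ≤ m → 3 ≤ ξ ∨ (ξ = 2 ∧ ε ≤ 1 / 2)) →
          SymDesign.IsApproxSymDesign (SymDesign.regionRep R Finset.univ) k ε
            (MeasureTheory.Measure.pi P)
            (fun ω => SymDesign.brickwork ξ (m - 1) fun j => U j (ω j))) ∧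
        -- circuit depth, with respect to an arbitrary gate set
        (∀ (𝒢 : SymDesign.GateSet q) (d : ℕ),
          (∀ j : Fin (m - 1), ∀ᵐ ω ∂(P j), SymDesign.HasDepth 𝒢 (SymDesign.block n ξ j) d (U j ω)) →
          ∀ᵐ ω ∂(MeasureTheory.Measure.pi P), SymDesign.HasDepth 𝒢 Finset.univ (2 * d)
            (SymDesign.brickwork ξ (m - 1) fun j => U j (ω j))))) := by
  refine ⟨?_, ?_⟩
  · intro ι _ q _ _ R hR A B C hAB hAC hBC k hk εAB εBC Ω₁ Ω₂ _ _ P₁ _ P₂ _ UAB UBC hUAB hUBC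
    have hΓ : (0 : ℝ) < Fintype.card G := Nat.cast_pos.mpr Fintype.card_pos
    rw [le_div_iff₀ hΓ] at hk
    have hS : SymDesign.IsSplit (A ∪ B) A B := ⟨hAB, rfl⟩
    have hT : SymDesign.IsSplit (B ∪ C) B C := ⟨hBC, rfl⟩
    have hVC : SymDesign.IsSplit (A ∪ B ∪ C) (A ∪ B) C :=
      ⟨Finset.disjoint_union_left.mpr ⟨hAC, hBC⟩, rfl⟩
    have hVA : SymDesign.IsSplit (A ∪ B ∪ C) A (B ∪ C) :=
      ⟨Finset.disjoint_union_right.mpr ⟨hAB, hAC⟩, (Finset.union_assoc A B C).symm⟩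
    have hind : SymDesign.IndepMatrix (P₁.prod P₂) (fun ω => UAB ω.1) (fun ω => UBC ω.2) :=
      SymDesign.indepMatrix_prod hUAB.measurable hUBC.measurable
    exact SymDesign.IsApproxSymDesign.glue hR hS hT hVC hVA hk
      (hUAB.comp_measurePreserving measurePreserving_fst)
      (hUBC.comp_measurePreserving measurePreserving_snd) hind
  · intro n m ξ hm hξ hn q _ _ R hR k ε hε hε1 b hb hq hlog
    refine ⟨?_, ?_⟩
    · exact SymDesign.isApproxSymDesign_brickwork hm hξ hn hR hε hε1 hb hq hlog
        (fun j => SymDesign.isApproxSymDesign_symHaar) (Or.inl rfl)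
    · intro Ω _ P _ U hU
      refine ⟨fun h => ?_, fun 𝒢 d hd => ?_⟩
      · exact SymDesign.isApproxSymDesign_brickwork hm hξ hn hR hε hε1 hb hq hlog hU
          (Or.inr ⟨rfl, h⟩)
      · have h1 : ∀ᵐ ω ∂(MeasureTheory.Measure.pi P), ∀ j : Fin (m - 1),
            SymDesign.HasDepth 𝒢 (SymDesign.block n ξ j) d (U j (ω j)) :=
          ae_all_iff.mpr fun j =>
            (measurePreserving_eval P j).quasiMeasurePreserving.ae (hd j)
        filter_upwards [h1] with ω hω
        exact SymDesign.hasDepth_brickwork hω
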